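/- Let $\mathbb{R}^{4,2}$ be $\mathbb{R}^6$ with a symmetric bilinear form $(\,,)$ of signature $(4,2)$; identify $a\wedge b$ with the skew endomorphism $v\mapsto (a,v)b-(b,v)a$. Let $\Sigma$ be a non-empty smooth $2$-manifold and $f$ an umbilic-free Legendre map on $\Sigma$: a smooth rank $2$ isotropic subbundle of $\Sigma\times\mathbb{R}^{4,2}$ such that $d\sigma$ takes values in $f^\perp$ for all sections $\sigma$ of $f$, such that no $X\ne0$ satisfies $d_X\sigma\in f$ for all sections $\sigma$, and such that at every point there are two curvature spheres, i.e. lines $s\le f(x)$ for which some $X\neq 0$ satisfies $d_X\sigma\in f(x)$ for all local sections $\sigma$ of $f$ with $\sigma(x)\in s$. Denote them locally by $s_1,s_2$, with curvature directions $T_1,T_2$. Let $\mathfrak p,\mathfrak q\in\mathbb{R}^{4,2}$ with $(\mathfrak p,\mathfrak p)=\pm1$, $(\mathfrak p,\mathfrak q)=0$, and assume that $f$ projects everywhere to the space form $\mathfrak Q^3=\{y: (y,y)=0,(y,\mathfrak q)=-1,(y,\mathfrak p)=0\}$, i.e. $(\tau\mathfrak p,\mathfrak q)\ne0$ for all non-zero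 $\tau\in\wedge^2 f(x)$. Let $\mathfrak f=-\tau\mathfrak p/(\tau\mathfrak p,\mathfrak q)$ be the space form projection and $\mathfrak t=-\tau\mathfrak q/(\tau\mathfrak q,\mathfrak p)$ the tangent plane congruence, and assume that $\mathfrak f$ immerses on a dense set. For $a,b,c\in\mathbb{R}$ call $\mathfrak f$ linear Weingarten (for $a,b,c$) if $a,b,c$ are not all zero and, where $\mathfrak f$ immerses, $aK+2bH+c=0$, with $K=\kappa_1\kappa_2$, $H=\frac12(\kappa_1+\kappa_2)$ and principal curvatures $\kappa_i$ given by Rodrigues' equations $d\mathfrak t+\kappa_i\,d\mathfrak f=0$ on $T_i$. A pair $(\eta,q)$ makes $f$ Lie applicable if $\eta$ is a smooth closed $1$-form with values in $f\wedge f^\perp$, $[\eta\wedge\eta]=0$, and the quadratic differential $q(X,Y)=\mathrm{tr}(\sigma\mapsto\eta(X)d_Y\sigma: f\to f)$ is not identically zero; $f$ is then an $\Omega$-surface ($\Omega_0$-surface) if $q$ is non-degenerate (degenerate) on a dense open set. With $S_1=\langle\sigma_1,d_Y\sigma_1,d_Yd_Y\sigma_1\rangle$ and $S_2=\langle\sigma_2,d_X\sigma_2,d_Xd_X\sigma_2\rangle$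 for non-vanishing local sections $\sigma_i$ of $s_i$, $X$ of $T_1$, $Y$ of $T_2$, $\eta$ is a middle potential if the $S_1\wedge S_2$-part of $\eta$ in $\wedge^2\mathbb{R}^{4,2}=(S_1\wedge S_1\oplus S_2\wedge S_2)\oplus S_1\wedge S_2$ takes values in $\wedge^2f$. If, locally, $\pm q=(d\sigma_1,d\sigma_1)-\epsilon^2(d\sigma_2,d\sigma_2)$ with $\epsilon\in\{1,i\}$ and non-vanishing sections $\sigma_1,\sigma_2$ of the two curvature sphere congruences (suitably labelled), the isothermic sphere congruences are $s^\pm=\langle\sigma_1\pm\epsilon\sigma_2\rangle\le f\otimes\mathbb{C}$. A conserved quantity of $\{d+t\eta\}_{t\in\mathbb{R}}$ is a non-zero polynomial $p(t)$ with smooth $\mathbb{R}^{4,2}$-valued coefficients such that $dp(t)+t\eta\,p(t)=0$ for all $t\in\mathbb{R}$. Put \[\eta_0=c\,\mathfrak f\wedge d\mathfrak f-b(\mathfrak f\wedge d\mathfrak t+\mathfrak t\wedge d\mathfrak f)+a\,\mathfrak t\wedge d\mathfrak t,\qquad q_0=-c(d\mathfrak f,d\mathfrak f)+2b(d\mathfrak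 f,d\mathfrak t)-a(d\mathfrak t,d\mathfrak t),\] \[p(t)=\mathfrak p+t(-b\mathfrak f+a\mathfrak t),\qquad q(t)=\mathfrak q+t(c\mathfrak f-b\mathfrak t).\] Then the following hold for all $a,b,c\in\mathbb{R}$. (1) $\mathfrak f$ is linear Weingarten for $a,b,c$ if and only if $f$ is Lie applicable with middle potential $\eta_0$ and quadratic differential $q_0$. (2) $\mathfrak f$ is linear Weingarten for $a,b,c$ if and only if $f$ is Lie applicable with some middle potential $\eta^{mid}$ such that $p(t)$ and $q(t)$ are conserved quantities of $d+t\eta^{mid}$. (3) If $\mathfrak f$ is linear Weingarten for $a,b,c$, then $p(t)$ and $q(t)$ are conserved quantities of $d+t\eta_0$, and $q_0$ vanishes at no point. If moreover $b^2-ac=0$ (tubular case), then $f$ is an $\Omega_0$-surface by means of $(\eta_0,q_0)$. If $b^2-ac\neq0$, then $f$ is an $\Omega$-surface by means of $(\eta_0,q_0)$; its isothermic sphere congruences (which exist near every point) are real if $b^2-ac>0$ and complex conjugate (and distinct) if $b^2-ac<0$. -/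

import Mathlib

open scoped Manifold ContDiff

noncomputable section

namespace LieSphere

/-- The vector space underlying `ℝ^{4,2}`. -/
abbrev R42 : Type := Fin 6 → ℝ

/-- The symmetric bilinear form of signature `(4,2)`:
`(v,w) = v₀w₀ + v₁w₁ + v₂w₂ + v₃w₃ - v₄w₄ - v₅w₅`. -/
def form : LinearMap.BilinForm ℝ R42 :=
  Matrix.toBilin' (Matrix.diagonal ![1, 1, 1, 1, -1, -1])

/-- Continuous endomorphisms of `ℝ^{4,2}`; `∧²ℝ^{4,2}` is regarded as a space of such. -/
abbrev EndR42 : Type := R42 →L[ℝ] R42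

/-- The identification of `a ∧ b` with the skew endomorphism `v ↦ (a,v) b - (b,v) a`. -/
def wedge : R42 →ₗ[ℝ] R42 →ₗ[ℝ] EndR42 :=
  LinearMap.mk₂ ℝ
    (fun a b => LinearMap.toContinuousLinearMap
      ((form a).smulRight b - (form b).smulRight a))
    (by intro a a' b; ext v : 1; simp [add_smul]; abel)
    (by intro r a b; ext v : 1; simp [mul_smul, smul_sub, smul_comm r])
    (by intro a b b'; ext v : 1; simp [add_smul]; abel)
    (by intro r a b; ext v : 1; simp [mul_smul, smul_sub, smul_comm r])

/-- `A ∧ B`, the span of all `a ∧ b` with `a ∈ A`, `b ∈ B`. -/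
def wedgeSub (A B : Submodule ℝ R42) : Submodule ℝ EndR42 :=
  Submodule.map₂ wedge A B

/-- The orthogonal complement in `ℝ^{4,2}`. -/
def perp (A : Submodule ℝ R42) : Submodule ℝ R42 :=
  LinearMap.BilinForm.orthogonal form A

section Surface

variable {M : Type*} [TopologicalSpace M] [ChartedSpace (EuclideanSpace ℝ (Fin 2)) M]

/-- The derivative `d_X σ` at `x` of a map `σ : M → ℝ^{4,2}`. -/
abbrev deriv42 (σ : M → R42) (x : M) : TangentSpace (𝓡 2) x →L[ℝ] R42 :=
  mvfderiv (𝓡 2) σ x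

/-- `σ` is a smooth section of the family `f` of subspaces over the open set `U`. -/
structure IsSection (f : M → Submodule ℝ R42) (U : Set M) (σ : M → R42) : Prop where
  isOpen : IsOpen U
  smooth : ContMDiffOn (𝓡 2) 𝓘(ℝ, R42) ∞ σ U
  mem : ∀ y ∈ U, σ y ∈ f y

/-- A Legendre map: a smooth map into the Grassmannian of isotropic planes of `ℝ^{4,2}`
(i.e. a rank two isotropic subbundle of the trivial bundle, given by smooth local frames)
with the contact condition `f⁽¹⁾ ≤ f^⊥` and the immersion condition `ker β = 0`. -/
structure IsLegendre (f : M → Submodule ℝ R42) : Prop where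
  rank_two : ∀ x, Module.finrank ℝ (f x) = 2
  isotropic : ∀ x, f x ≤ perp (f x)
  smooth : ∀ x, ∃ U σ τ, x ∈ U ∧ IsSection f U σ ∧ IsSection f U τ ∧
    ∀ y ∈ U, f y = Submodule.span ℝ {σ y, τ y}
  contact : ∀ U σ, IsSection f U σ → ∀ x ∈ U, ∀ X, deriv42 σ x X ∈ perp (f x)
  immersion : ∀ x X, (∀ U σ, IsSection f U σ → x ∈ U → deriv42 σ x X ∈ f x) → X = 0

/-- The tangent vectors `X` at `x` with `β(X) s = 0`; for a curvature sphere `s` this is its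
curvature space. -/
def curvatureSpace (f : M → Submodule ℝ R42) (x : M) (s : Submodule ℝ R42) :
    Set (TangentSpace (𝓡 2) x) :=
  {X | ∀ U σ, IsSection f U σ → x ∈ U → σ x ∈ s → deriv42 σ x X ∈ f x}

/-- `s` is a curvature sphere of `f` at `x`. -/
def IsCurvatureSphere (f : M → Submodule ℝ R42) (x : M) (s : Submodule ℝ R42) : Prop :=
  s ≤ f x ∧ Module.finrank ℝ s = 1 ∧ ∃ X ∈ curvatureSpace f x s, X ≠ 0

/-- `x` is an umbilic point of `f` if there is exactly one curvature sphere at `x`. -/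
def IsUmbilic (f : M → Submodule ℝ R42) (x : M) : Prop :=
  ∃! s, IsCurvatureSphere f x s

def UmbilicFree (f : M → Submodule ℝ R42) : Prop :=
  ∀ x, ¬ IsUmbilic f x

/-- `σ` is a nowhere zero smooth lift over `U` of a curvature sphere congruence of `f`. -/
structure IsCurvatureLift (f : M → Submodule ℝ R42) (U : Set M) (σ : M → R42) : Prop where
  isSection : IsSection f U σ
  ne_zero : ∀ y ∈ U, σ y ≠ 0
  isCurvatureSphere : ∀ y ∈ U, IsCurvatureSphere f y (Submodule.span ℝ {σ y})

/-! ### Projection to a space form -/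

/-- `𝔣` and `𝔱` are the space form projection and the tangent plane congruence of `f`, which are
defined on all of `M`: for nonzero `τ ∈ ∧²f`, one has `(τ𝔭,𝔮) ≠ 0`,
`𝔣 = - τ𝔭 / (τ𝔭,𝔮)` and `𝔱 = - τ𝔮 / (τ𝔮,𝔭)`. -/
def IsSpaceFormProjection (f : M → Submodule ℝ R42) (p q : R42) (𝔣 𝔱 : M → R42) : Prop :=
  ∀ x, ∀ τ ∈ wedgeSub (f x) (f x), τ ≠ 0 →
    form (τ p) q ≠ 0 ∧
    𝔣 x = -((form (τ p) q)⁻¹ • τ p) ∧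
    𝔱 x = -((form (τ q) p)⁻¹ • τ q)

/-- `𝔣` immerses at `x`. -/
def ImmersesAt (𝔣 : M → R42) (x : M) : Prop :=
  Function.Injective (deriv42 𝔣 x)

/-- `κ₁, κ₂` are the principal curvatures at `x` of the surface `𝔣` with tangent plane
congruence `𝔱` (Rodrigues' equations). The unit normal field of `𝔣` in the space form is
`𝔱 + (𝔭,𝔭)⁻¹ 𝔭`, which has the same derivative as `𝔱`. -/
def ArePrincipalCurvatures (𝔣 𝔱 : M → R42) (x : M) (κ₁ κ₂ : ℝ) : Prop :=
  ∃ X : Fin 2 → TangentSpace (𝓡 2) x, LinearIndependent ℝ X ∧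
    deriv42 𝔱 x (X 0) + κ₁ • deriv42 𝔣 x (X 0) = 0 ∧
    deriv42 𝔱 x (X 1) + κ₂ • deriv42 𝔣 x (X 1) = 0

/-- `𝔣` is a linear Weingarten surface satisfying `aK + 2bH + c = 0` (where it immerses), with
`a, b, c` not all zero, `K = κ₁κ₂` and `H = (κ₁ + κ₂)/2`. -/
def IsLinearWeingarten (𝔣 𝔱 : M → R42) (a b c : ℝ) : Prop :=
  ¬ (a = 0 ∧ b = 0 ∧ c = 0) ∧
  ∀ x, ImmersesAt 𝔣 x → ∃ κ₁ κ₂, ArePrincipalCurvatures 𝔣 𝔱 x κ₁ κ₂ ∧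
    a * (κ₁ * κ₂) + 2 * b * ((κ₁ + κ₂) / 2) + c = 0

/-! ### One-forms with values in `∧²ℝ^{4,2}` -/

variable (M) in
/-- One-forms on `M` with values in `End(ℝ^{4,2})`, without regularity. -/
abbrev OneForm : Type _ := (x : M) → TangentSpace (𝓡 2) x →L[ℝ] EndR42

variable (M) in
/-- Fields of scalar valued functions of two tangent vectors. -/
abbrev QuadDiff : Type _ := (x : M) → TangentSpace (𝓡 2) x → TangentSpace (𝓡 2) x → ℝ

/-- The coordinate expression of `η` in the chart `e`, i.e. the pull-back of `η` along `e⁻¹`. -/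
def inChart (η : OneForm M) (e : OpenPartialHomeomorph M (EuclideanSpace ℝ (Fin 2)))
    (y : EuclideanSpace ℝ (Fin 2)) : EuclideanSpace ℝ (Fin 2) →L[ℝ] EndR42 :=
  (η (e.symm y)).comp (mfderiv (𝓡 2) (𝓡 2) e.symm y)

def OneForm.IsSmooth (η : OneForm M) : Prop :=
  ∀ e ∈ atlas (EuclideanSpace ℝ (Fin 2)) M, ContDiffOn ℝ ∞ (inChart η e) e.target

/-- `dη = 0`, in charts: `∂_u (η(v)) - ∂_v (η(u)) = 0` for all coordinate vectors `u, v`. -/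
def OneForm.IsClosed (η : OneForm M) : Prop :=
  ∀ e ∈ atlas (EuclideanSpace ℝ (Fin 2)) M, ∀ y ∈ e.target, ∀ u v,
    fderiv ℝ (inChart η e) y u v - fderiv ℝ (inChart η e) y v u = 0

/-- `q(X,Y) = tr (σ ↦ η(X) d_Y σ : f → f)`. -/
def IsQuadraticDifferential (f : M → Submodule ℝ R42) (η : OneForm M) (q : QuadDiff M) : Prop :=
  ∀ x X Y, ∃ T : f x →ₗ[ℝ] f x,
    (∀ U σ, ∀ h : IsSection f U σ, ∀ hx : x ∈ U,
      (T ⟨σ x, h.mem x hx⟩ : R42) = η x X (deriv42 σ x Y)) ∧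
    q x X Y = LinearMap.trace ℝ (f x) T

/-- `f` is a Lie applicable surface by means of the closed one-form `η`, with quadratic
differential `q`. -/
structure IsLieApplicableWith (f : M → Submodule ℝ R42) (η : OneForm M) (q : QuadDiff M) :
    Prop where
  smooth : η.IsSmooth
  mem : ∀ x X, η x X ∈ wedgeSub (f x) (perp (f x))
  closed : η.IsClosed
  bracket : ∀ x X Y, ⁅η x X, η x Y⁆ - ⁅η x Y, η x X⁆ = 0
  quadDiff : IsQuadraticDifferential f η q
  ne_zero : ∃ x X Y, q x X Y ≠ 0

/-- Nondegeneracy of `q` at `x`. -/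
def QuadDiff.NondegenerateAt (q : QuadDiff M) (x : M) : Prop :=
  ∀ X, (∀ Y, q x X Y = 0) → X = 0

/-- `f` is an `Ω`-surface by means of `η`, with quadratic differential `q`. -/
def IsOmegaWith (f : M → Submodule ℝ R42) (η : OneForm M) (q : QuadDiff M) : Prop :=
  IsLieApplicableWith f η q ∧ ∃ U : Set M, IsOpen U ∧ Dense U ∧ ∀ x ∈ U, q.NondegenerateAt x

/-- `f` is an `Ω₀`-surface by means of `η`, with quadratic differential `q`. -/
def IsOmegaZeroWith (f : M → Submodule ℝ R42) (η : OneForm M) (q : QuadDiff M) : Prop :=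
  IsLieApplicableWith f η q ∧ ∃ U : Set M, IsOpen U ∧ Dense U ∧ ∀ x ∈ U, ¬ q.NondegenerateAt x

/-! ### Middle potential -/

/-- The function `d_X σ` for a vector field `X`. -/
def dirDeriv (X : (x : M) → TangentSpace (𝓡 2) x) (σ : M → R42) : M → R42 :=
  fun x => deriv42 σ x (X x)

/-- `⟨σ, d_X σ, d_X d_X σ⟩` at `x`. -/
def osculating (X : (x : M) → TangentSpace (𝓡 2) x) (σ : M → R42) (x : M) : Submodule ℝ R42 :=
  Submodule.span ℝ {σ x, dirDeriv X σ x, dirDeriv X (dirDeriv X σ) x}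

/-- A local frame over `U` adapted to the curvature spheres of `f`: lifts `σ₁, σ₂` of the two
distinct curvature sphere congruences and smooth nowhere zero vector fields `X₁, X₂` in the
respective curvature subbundles `T₁, T₂`. -/
structure IsCurvatureFrame [IsManifold (𝓡 2) ∞ M] (f : M → Submodule ℝ R42) (U : Set M)
    (σ₁ σ₂ : M → R42) (X₁ X₂ : (x : M) → TangentSpace (𝓡 2) x) : Prop where
  lift₁ : IsCurvatureLift f U σ₁
  lift₂ : IsCurvatureLift f U σ₂
  distinct : ∀ y ∈ U, Submodule.span ℝ {σ₁ y} ≠ Submodule.span ℝ {σ₂ y}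
  smooth₁ : ContMDiffOn (𝓡 2) (𝓡 2).tangent ∞
    (fun y => (⟨y, X₁ y⟩ : TangentBundle (𝓡 2) M)) U
  smooth₂ : ContMDiffOn (𝓡 2) (𝓡 2).tangent ∞
    (fun y => (⟨y, X₂ y⟩ : TangentBundle (𝓡 2) M)) U
  ne_zero₁ : ∀ y ∈ U, X₁ y ≠ 0
  ne_zero₂ : ∀ y ∈ U, X₂ y ≠ 0
  mem₁ : ∀ y ∈ U, X₁ y ∈ curvatureSpace f y (Submodule.span ℝ {σ₁ y})
  mem₂ : ∀ y ∈ U, X₂ y ∈ curvatureSpace f y (Submodule.span ℝ {σ₂ y})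

/-- The closed one-form `η` is the middle potential of its gauge orbit: its component in
`𝔪 = S₁ ∧ S₂` takes values in `∧²f`. Here `S₁ = ⟨σ₁, d_{X₂}σ₁, d_{X₂}d_{X₂}σ₁⟩` and
`S₂ = ⟨σ₂, d_{X₁}σ₂, d_{X₁}d_{X₁}σ₂⟩` form the Lie cyclide splitting, which does not depend on the
frame, and `𝔥 = S₁ ∧ S₁ ⊕ S₂ ∧ S₂`. -/
def IsMiddlePotential [IsManifold (𝓡 2) ∞ M] (f : M → Submodule ℝ R42) (η : OneForm M) : Prop :=
  ∀ x, ∃ U σ₁ σ₂ X₁ X₂, x ∈ U ∧ IsCurvatureFrame f U σ₁ σ₂ X₁ X₂ ∧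
    ∀ Z, ∃ A ∈ wedgeSub (osculating X₂ σ₁ x) (osculating X₂ σ₁ x) ⊔
          wedgeSub (osculating X₁ σ₂ x) (osculating X₁ σ₂ x),
      ∃ B ∈ wedgeSub (osculating X₂ σ₁ x) (osculating X₁ σ₂ x),
        η x Z = A + B ∧ B ∈ wedgeSub (f x) (f x)

/-! ### Isothermic sphere congruences -/

/-- `σ₁ + ε σ₂` in the complexification of `ℝ^{4,2}`. -/
def complexComb (ε : ℂ) (v w : R42) : Fin 6 → ℂ :=
  fun i => (v i : ℂ) + ε * (w i : ℂ)

/-- `s⁺, s⁻` are the isothermic sphere congruences over `U` of an `Ω`-surface `f` with quadratic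
differential `q`: up to sign `q = (dσ₁,dσ₁) - ε²(dσ₂,dσ₂)` with `ε ∈ {1, i}` and
lifts `σ₁, σ₂` of the two curvature sphere congruences (labelled suitably), and
`s^± = ⟨σ₁ ± ε σ₂⟩ ≤ f ⊗ ℂ`. -/
def AreIsothermicSphereCongruences (f : M → Submodule ℝ R42) (q : QuadDiff M) (U : Set M)
    (sp sm : M → Submodule ℂ (Fin 6 → ℂ)) : Prop :=
  ∃ (δ : ℝ) (ε : ℂ) (σ₁ σ₂ : M → R42), (δ = 1 ∨ δ = -1) ∧ (ε = 1 ∨ ε = Complex.I) ∧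
    IsCurvatureLift f U σ₁ ∧ IsCurvatureLift f U σ₂ ∧
    (∀ y ∈ U, Submodule.span ℝ {σ₁ y} ≠ Submodule.span ℝ {σ₂ y}) ∧
    (∀ y ∈ U, ∀ X Y, ((δ * q y X Y : ℝ) : ℂ) =
      (form (deriv42 σ₁ y X) (deriv42 σ₁ y Y) : ℂ)
        - ε ^ 2 * (form (deriv42 σ₂ y X) (deriv42 σ₂ y Y) : ℂ)) ∧
    ∀ y ∈ U, sp y = Submodule.span ℂ {complexComb ε (σ₁ y) (σ₂ y)} ∧
      sm y = Submodule.span ℂ {complexComb (-ε) (σ₁ y) (σ₂ y)}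

/-- Both complex subspaces are invariant under conjugation. -/
def AreReal (s s' : Submodule ℂ (Fin 6 → ℂ)) : Prop :=
  (∀ w, w ∈ s ↔ star w ∈ s) ∧ (∀ w, w ∈ s' ↔ star w ∈ s')

/-- The two complex subspaces are distinct and interchanged by conjugation. -/
def AreComplexConjugate (s s' : Submodule ℂ (Fin 6 → ℂ)) : Prop :=
  s ≠ s' ∧ ∀ w, w ∈ s ↔ star w ∈ s'

/-- The isothermic sphere congruences exist near every point and have the property `P`. -/
def IsothermicSphereCongruencesSatisfy (f : M → Submodule ℝ R42) (q : QuadDiff M)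
    (P : Submodule ℂ (Fin 6 → ℂ) → Submodule ℂ (Fin 6 → ℂ) → Prop) : Prop :=
  (∀ x, ∃ U sp sm, x ∈ U ∧ AreIsothermicSphereCongruences f q U sp sm) ∧
  ∀ U sp sm, AreIsothermicSphereCongruences f q U sp sm → ∀ x ∈ U, P (sp x) (sm x)

/-! ### Polynomial conserved quantities -/

/-- The value at `t` of the polynomial `∑ tᵏ Pₖ` with coefficients `Pₖ : M → ℝ^{4,2}`. -/
def polyEval {d : ℕ} (P : Fin (d + 1) → M → R42) (t : ℝ) (x : M) : R42 :=
  ∑ k : Fin (d + 1), t ^ (k : ℕ) • P k x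

/-- `P` is a polynomial conserved quantity of `{d + tη}`: a nonzero polynomial with smooth
coefficients such that `P(t)` is parallel for `d + tη`, for all real `t`. -/
structure IsPolynomialConservedQuantity (η : OneForm M) {d : ℕ} (P : Fin (d + 1) → M → R42) :
    Prop where
  smooth : ∀ k, ContMDiff (𝓡 2) 𝓘(ℝ, R42) ∞ (P k)
  ne_zero : ∃ k x, P k x ≠ 0
  parallel : ∀ (t : ℝ) (x : M) (X : TangentSpace (𝓡 2) x),
    deriv42 (polyEval P t) x X + t • η x X (polyEval P t x) = 0

/-! ### The explicit forms -/

/-- The one-form `g ∧ dh`. -/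
def wedgeD (g h : M → R42) : OneForm M :=
  fun x => (LinearMap.toContinuousLinearMap (wedge (g x))).comp (deriv42 h x)

/-- `c 𝔣∧d𝔣 - b (𝔣∧d𝔱 + 𝔱∧d𝔣) + a 𝔱∧d𝔱`. -/
def weingartenForm (𝔣 𝔱 : M → R42) (a b c : ℝ) : OneForm M := fun x =>
  c • wedgeD 𝔣 𝔣 x - b • (wedgeD 𝔣 𝔱 x + wedgeD 𝔱 𝔣 x) + a • wedgeD 𝔱 𝔱 x

/-- `-c (d𝔣,d𝔣) + 2b (d𝔣,d𝔱) - a (d𝔱,d𝔱)`, as a symmetric bilinear form. -/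
def weingartenQuadDiff (𝔣 𝔱 : M → R42) (a b c : ℝ) : QuadDiff M := fun x X Y =>
  -c * form (deriv42 𝔣 x X) (deriv42 𝔣 x Y)
    + b * (form (deriv42 𝔣 x X) (deriv42 𝔱 x Y) + form (deriv42 𝔣 x Y) (deriv42 𝔱 x X))
    - a * form (deriv42 𝔱 x X) (deriv42 𝔱 x Y)

/-- The linear polynomial `𝔭 + t(-b 𝔣 + a 𝔱)`. -/
def pointPoly (p : R42) (𝔣 𝔱 : M → R42) (a b : ℝ) : Fin (1 + 1) → M → R42 :=
  ![fun _ => p, fun x => -b • 𝔣 x + a • 𝔱 x]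

/-- The linear polynomial `𝔮 + t(c 𝔣 - b 𝔱)`. -/
def spaceFormPoly (q : R42) (𝔣 𝔱 : M → R42) (b c : ℝ) : Fin (1 + 1) → M → R42 :=
  ![fun _ => q, fun x => c • 𝔣 x - b • 𝔱 x]

end Surface

end LieSphere

end

noncomputable section

namespace LieSphere

/-! ### Linear algebra of `ℝ^{4,2}` -/

/-! The sections `𝔣, 𝔱` form a null frame of `f` dual to `-𝔮, -𝔭`, and `d𝔣, d𝔱` take values in the
screen `⟨𝔣, 𝔱, 𝔭, 𝔮⟩^⊥`, a positive definite plane because of the signature. So the problem at a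
point is algebra of two maps `A = d𝔣`, `B = d𝔱` into a Euclidean plane with `(A X, B Y)` symmetric
(`ContactElement`). The curvature spheres are the `αᵢ 𝔣 + βᵢ 𝔱` with `αᵢ A Xᵢ + βᵢ B Xᵢ = 0`; then
`A Xᵢ = βᵢ wᵢ` and `B Xᵢ = -αᵢ wᵢ` with `w₁ ⊥ w₂` (`diagonalize`), and `κᵢ = αᵢ / βᵢ` where `𝔣`
immerses.

The exterior derivative of `η₀` is twice `curl`, and `curl (X₁, X₂) = Φ w₁ ∧ w₂`, where `Φ` is the
polarization of `a α² + 2b αβ + c β²` at the two curvature spheres (`curl_eq_zero_iff`). Where `𝔣`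
immerses, `Φ = β₁ β₂ (aK + 2bH + c)`. Hence `η₀` is closed exactly when the Weingarten equation
holds, density and continuity covering the points where `𝔣` does not immerse (`curl_eq_zero`). The
remaining algebraic properties of `η₀`, its quadratic differential and the two conserved quantities
need no Weingarten condition. Conversely, a form with values in `f ∧ f^⊥` is determined by its
values at `𝔭` and `𝔮`, which the conserved quantities prescribe, so it is `η₀`
(`eq_weingartenForm`). The case `a = b = c = 0` is excluded since it gives zero quadratic
differential.

If `Φ = 0`, then `η₀(X₁)` is a multiple of `σ₂ ∧ d_{X₁} σ₂` up to `∧²f`, and symmetrically for `X₂`;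
this is the middle condition (`isMiddlePotential`). Also `q₀` is diagonal in `X₁, X₂` with entries
negative multiples of the values `P₁, P₂` of the quadratic form at the curvature spheres. The Gram
identity `P₁ P₂ - Φ² = (ac - b²)(α₁β₂ - α₂β₁)²` then gives non-vanishing, the criterion for
degeneracy, and the sign `ε²` of the isothermic sphere congruences. -/

lemma form_apply (v w : R42) :
    form v w = v 0 * w 0 + v 1 * w 1 + v 2 * w 2 + v 3 * w 3 - v 4 * w 4 - v 5 * w 5 := by
  simp [form, Matrix.toBilin'_apply', Matrix.mulVec_diagonal, dotProduct, Fin.sum_univ_succ]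
  ring

lemma form_comm (v w : R42) : form v w = form w v := by
  rw [form_apply, form_apply]; ring

lemma eq_zero_of_forall_form {v : R42} (h : ∀ w, form v w = 0) : v = 0 := by
  have h0 := h (Pi.single 0 1)
  have h1 := h (Pi.single 1 1)
  have h2 := h (Pi.single 2 1)
  have h3 := h (Pi.single 3 1)
  have h4 := h (Pi.single 4 1)
  have h5 := h (Pi.single 5 1)
  simp [form_apply] at h0 h1 h2 h3 h4 h5
  ext i
  fin_cases i <;> simpa

lemma wedge_apply (a b v : R42) : wedge a b v = form a v • b - form b v • a := rfl

lemma wedge_self (a : R42) : wedge a a = 0 := by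
  ext v : 1; simp [wedge_apply]

lemma wedge_swap (a b : R42) : wedge a b = -wedge b a := by
  ext v : 1; simp [wedge_apply]

/-- `F, T` is a null frame dual to `-q, -p`. -/
structure NullFrame (p q F T : R42) : Prop where
  FF : form F F = 0
  FT : form F T = 0
  TT : form T T = 0
  Fp : form F p = 0
  Fq : form F q = -1
  Tp : form T p = -1
  Tq : form T q = 0

/-- The orthogonal complement of `⟨F, T, p, q⟩`. -/
def screen (p q F T : R42) : Submodule ℝ R42 where
  carrier := {w | form w F = 0 ∧ form w T = 0 ∧ form w p = 0 ∧ form w q = 0}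
  add_mem' := by
    rintro u v ⟨h1, h2, h3, h4⟩ ⟨k1, k2, k3, k4⟩
    simp [*]
  zero_mem' := by simp
  smul_mem' := by
    rintro r v ⟨h1, h2, h3, h4⟩
    simp [*]

lemma mem_screen {p q F T w : R42} : w ∈ screen p q F T ↔
    form w F = 0 ∧ form w T = 0 ∧ form w p = 0 ∧ form w q = 0 := Iff.rfl

namespace NullFrame

variable {p q F T : R42} (h : NullFrame p q F T)
include h

lemma TF : form T F = 0 := by rw [form_comm, h.FT]
lemma pF : form p F = 0 := by rw [form_comm, h.Fp]
lemma qF : form q F = -1 := by rw [form_comm, h.Fq]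
lemma pT : form p T = -1 := by rw [form_comm, h.Tp]
lemma qT : form q T = 0 := by rw [form_comm, h.Tq]

lemma coeff_eq_zero {r s : ℝ} {w : R42} (hw : w ∈ screen p q F T)
    (h0 : r • F + s • T + w = 0) : r = 0 ∧ s = 0 ∧ w = 0 := by
  obtain ⟨-, -, wp, wq⟩ := hw
  have hq := congrArg (fun v => form v q) h0
  have hp := congrArg (fun v => form v p) h0
  simp [h.Fp, h.Fq, h.Tp, h.Tq, wp, wq] at hp hq
  subst hp hq
  simpa using h0

lemma linearIndependent : LinearIndependent ℝ ![F, T] := by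
  rw [LinearIndependent.pair_iff]
  intro s t hst
  have := h.coeff_eq_zero (r := s) (s := t) (w := 0) (zero_mem _) (by simpa using hst)
  exact ⟨this.1, this.2.1⟩

/-- The form is positive definite on the screen space, since the signature is `(4,2)`. -/
lemma screen_pos {w : R42} (hw : w ∈ screen p q F T) (hw0 : w ≠ 0) : 0 < form w w := by
  by_contra hneg
  push Not at hneg
  obtain ⟨wF, wT, -, -⟩ := id hw
  -- If `(w,w) ≤ 0`, the span of `F, T, w` is negative semidefinite. Its three coefficients cannot
  -- be separated by the two negative coordinates, so a nontrivial combination `v` has `v 4 = v 5 =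
  -- 0`, where the form is positive definite.
  let L : (Fin 3 → ℝ) →ₗ[ℝ] (Fin 2 → ℝ) :=
    Matrix.toLin' !![F 4, T 4, w 4; F 5, T 5, w 5]
  have hL : LinearMap.ker L ≠ ⊥ := LinearMap.ker_ne_bot_of_finrank_lt (by simp)
  obtain ⟨z, hz, hz0⟩ := Submodule.exists_mem_ne_zero_of_ne_bot hL
  rw [LinearMap.mem_ker] at hz
  have h4 := congrFun hz 0
  have h5 := congrFun hz 1
  simp [L, Matrix.toLin'_apply, Matrix.mulVec, dotProduct, Fin.sum_univ_succ] at h4 h5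
  set v : R42 := z 0 • F + z 1 • T + z 2 • w with hv
  have v4 : v 4 = 0 := by simp [hv]; linarith
  have v5 : v 5 = 0 := by simp [hv]; linarith
  have hvv : form v v = z 2 ^ 2 * form w w := by
    simp [hv, h.FF, h.FT, h.TF, h.TT, wF, wT, form_comm F w, form_comm T w]
    ring
  have hle : form v v ≤ 0 := by rw [hvv]; nlinarith [sq_nonneg (z 2)]
  rw [form_apply, v4, v5] at hle
  have e0 : v 0 = 0 := by nlinarith [sq_nonneg (v 0), sq_nonneg (v 1), sq_nonneg (v 2), sq_nonneg (v 3)]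
  have e1 : v 1 = 0 := by nlinarith [sq_nonneg (v 0), sq_nonneg (v 1), sq_nonneg (v 2), sq_nonneg (v 3)]
  have e2 : v 2 = 0 := by nlinarith [sq_nonneg (v 0), sq_nonneg (v 1), sq_nonneg (v 2), sq_nonneg (v 3)]
  have e3 : v 3 = 0 := by nlinarith [sq_nonneg (v 0), sq_nonneg (v 1), sq_nonneg (v 2), sq_nonneg (v 3)]
  have hv0 : v = 0 := by ext i; fin_cases i <;> simpa
  obtain ⟨z0, z1, z2⟩ := h.coeff_eq_zero ((screen p q F T).smul_mem (z 2) hw) hv0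
  have z2 : z 2 = 0 := by simpa [hw0] using z2
  apply hz0
  ext i
  fin_cases i <;> simpa

end NullFrame

/-! ### The area form and linear algebra of the screen plane -/

lemma updateRow_zero (F T p q u v w : R42) :
    (Matrix.of ![u, v, F, T, p, q]).updateRow 0 w = Matrix.of ![w, v, F, T, p, q] := by
  ext i j; fin_cases i <;> simp [Matrix.updateRow, Function.update]

lemma updateRow_one (F T p q u v w : R42) :
    (Matrix.of ![u, v, F, T, p, q]).updateRow 1 w = Matrix.of ![u, w, F, T, p, q] := by
  ext i j; fin_cases i <;> simp [Matrix.updateRow, Function.update]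

/-- The area form `(u, v) ↦ det (u, v, F, T, p, q)`. -/
def area (p q F T : R42) : R42 →ₗ[ℝ] R42 →ₗ[ℝ] ℝ :=
  LinearMap.mk₂ ℝ (fun u v => Matrix.det (Matrix.of ![u, v, F, T, p, q]))
    (fun u u' v => by
      simpa only [updateRow_zero] using
        Matrix.det_updateRow_add (Matrix.of ![u, v, F, T, p, q]) 0 u u')
    (fun r u v => by
      simpa only [updateRow_zero, smul_eq_mul] using
        Matrix.det_updateRow_smul (Matrix.of ![u, v, F, T, p, q]) 0 r u)
    (fun u v v' => by
      simpa only [updateRow_one] using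
        Matrix.det_updateRow_add (Matrix.of ![u, v, F, T, p, q]) 1 v v')
    (fun r u v => by
      simpa only [updateRow_one, smul_eq_mul] using
        Matrix.det_updateRow_smul (Matrix.of ![u, v, F, T, p, q]) 1 r v)

lemma area_apply (p q F T u v : R42) :
    area p q F T u v = Matrix.det (Matrix.of ![u, v, F, T, p, q]) := rfl

lemma area_self (p q F T u : R42) : area p q F T u u = 0 := by
  rw [area_apply]
  exact Matrix.det_zero_of_row_eq (i := 0) (j := 1) (by decide) rfl

lemma area_swap (p q F T u v : R42) : area p q F T u v = -area p q F T v u := by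
  have := area_self p q F T (u + v)
  simp [area_self] at this
  linarith

namespace NullFrame

variable {p q F T : R42} (h : NullFrame p q F T)
include h

/-- A linear relation among the six vectors can be tested against the frame. Pairing with `F, T`
removes `q, p`; only then does pairing with `p, q` remove `T, F`, since `NullFrame` prescribes no
products among `p, q`. -/
lemma dependent_of_area_eq_zero {u v : R42} (hu : u ∈ screen p q F T) (hv : v ∈ screen p q F T)
    (h0 : area p q F T u v = 0) : ∃ r s : ℝ, (r ≠ 0 ∨ s ≠ 0) ∧ r • u + s • v = 0 := by
  rw [area_apply, ← Matrix.exists_vecMul_eq_zero_iff] at h0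
  obtain ⟨z, hz0, hz⟩ := h0
  have hsum : z 0 • u + z 1 • v + z 2 • F + z 3 • T + z 4 • p + z 5 • q = 0 := by
    rw [← hz]
    ext j
    simp [Matrix.vecMul, dotProduct, Fin.sum_univ_succ]
    ring
  obtain ⟨uF, uT, up, uq⟩ := hu
  obtain ⟨vF, vT, vp, vq⟩ := hv
  have z5 := congrArg (fun w => form w F) hsum
  have z4 := congrArg (fun w => form w T) hsum
  simp [uF, uT, vF, vT, h.FF, h.FT, h.TF, h.TT, h.pF, h.qF, h.pT, h.qT] at z4 z5
  simp only [z4, z5, zero_smul, add_zero] at hsum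
  have z3 := congrArg (fun w => form w p) hsum
  have z2 := congrArg (fun w => form w q) hsum
  simp [up, uq, vp, vq, h.Fp, h.Fq, h.Tp, h.Tq] at z2 z3
  simp only [z2, z3, zero_smul, add_zero] at hsum
  refine ⟨z 0, z 1, ?_, hsum⟩
  by_contra hcon
  push Not at hcon
  apply hz0
  ext i
  fin_cases i <;> simp_all

lemma area_ne_zero_of_orthogonal {u v : R42} (hu : u ∈ screen p q F T) (hv : v ∈ screen p q F T)
    (hu0 : u ≠ 0) (hv0 : v ≠ 0) (huv : form u v = 0) : area p q F T u v ≠ 0 := by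
  intro h0
  obtain ⟨r, s, hrs, h1⟩ := h.dependent_of_area_eq_zero hu hv h0
  have hu1 := congrArg (fun w => form w u) h1
  have hv1 := congrArg (fun w => form w v) h1
  have hup := h.screen_pos hu hu0
  have hvp := h.screen_pos hv hv0
  simp [huv, form_comm v u, hup.ne', hvp.ne'] at hu1 hv1
  simp_all

/-- Cramer's rule in the screen space, which is two-dimensional. -/
lemma cramer {u v w : R42} (hu : u ∈ screen p q F T) (hv : v ∈ screen p q F T)
    (hw : w ∈ screen p q F T) (h0 : area p q F T u v ≠ 0) :
    area p q F T u v • w = area p q F T w v • u + area p q F T u w • v := by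
  -- The defect `z` has zero area with both `u` and `v`. Were it nonzero, both would be multiples of
  -- it and their area would vanish.
  set z := area p q F T u v • w - (area p q F T w v • u + area p q F T u w • v) with hz
  rw [← sub_eq_zero, ← hz]
  by_contra hz0
  have hzm : z ∈ screen p q F T :=
    sub_mem (Submodule.smul_mem _ _ hw)
      (add_mem (Submodule.smul_mem _ _ hu) (Submodule.smul_mem _ _ hv))
  have zu : area p q F T z u = 0 := by
    simp [hz, area_self, area_swap p q F T w u, area_swap p q F T v u]; ring
  have zv : area p q F T z v = 0 := by
    simp [hz, area_self]; ring
  have key : ∀ y ∈ screen p q F T, area p q F T z y = 0 → ∃ k : ℝ, y = k • z := by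
    intro y hy hzy
    obtain ⟨r, s, hrs, h1⟩ := h.dependent_of_area_eq_zero hzm hy hzy
    have hs : s ≠ 0 := by
      rintro rfl
      simp_all
    refine ⟨-(s⁻¹ * r), ?_⟩
    have := congrArg (fun y => s⁻¹ • y) h1
    simp only [smul_add, smul_smul, inv_mul_cancel₀ hs, one_smul, smul_zero] at this
    rw [neg_smul]
    exact eq_neg_of_add_eq_zero_right this
  obtain ⟨k, hk⟩ := key u hu zu
  obtain ⟨l, hl⟩ := key v hv zv
  exact h0 (by rw [hk, hl]; simp [area_self])

end NullFrame

lemma range_pair {V : Type*} (v w : V) : Set.range ![v, w] = {v, w} := by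
  rw [Matrix.range_cons, Matrix.range_cons, Matrix.range_empty, Set.union_empty,
    Set.singleton_union]

lemma exists_eq_smul_add_smul {V : Type*} [AddCommGroup V] [Module ℝ V]
    (hV : Module.finrank ℝ V = 2) {X Y : V}
    (hXY : LinearIndependent ℝ ![X, Y]) (Z : V) : ∃ r s : ℝ, Z = r • X + s • Y := by
  have : Module.Finite ℝ V := Module.finite_of_finrank_pos (by omega)
  have : Submodule.span ℝ (Set.range ![X, Y]) = ⊤ :=
    hXY.span_eq_top_of_card_eq_finrank' (by simp [hV])
  have hZ : Z ∈ Submodule.span ℝ (Set.range ![X, Y]) := by rw [this]; trivial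
  rw [range_pair, Submodule.mem_span_pair] at hZ
  obtain ⟨r, s, h⟩ := hZ
  exact ⟨r, s, h.symm⟩

/-! ### First order data of a Legendre map at a point -/

section Pointwise

variable {V : Type*} [TopologicalSpace V] [AddCommGroup V] [Module ℝ V]

/-- The values `F, T` and the derivatives `A, B` at a point of the space form projection and the
tangent plane congruence of a Legendre map. -/
structure ContactElement (p q F T : R42) (A B : V →L[ℝ] R42) : Prop extends
    NullFrame p q F T where
  A_mem : ∀ X, A X ∈ screen p q F T
  B_mem : ∀ X, B X ∈ screen p q F T
  symm : ∀ X Y, form (A X) (B Y) = form (A Y) (B X)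
  ker : ∀ X, A X = 0 → B X = 0 → X = 0

/-- `α F + β T` is a curvature sphere with curvature direction `X`. -/
structure IsPrincipal (A B : V →L[ℝ] R42) (α β : ℝ) (X : V) : Prop where
  ne_zero : X ≠ 0
  coeff_ne_zero : α ≠ 0 ∨ β ≠ 0
  eq_zero : α • A X + β • B X = 0

lemma IsPrincipal.smul {A B : V →L[ℝ] R42} {α β : ℝ} {X : V} (h : IsPrincipal A B α β X) {k : ℝ}
    (hk : k ≠ 0) : IsPrincipal A B (k * α) (k * β) X :=
  ⟨h.ne_zero, h.coeff_ne_zero.imp (mul_ne_zero hk) (mul_ne_zero hk), by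
    rw [mul_smul, mul_smul, ← smul_add, h.eq_zero, smul_zero]⟩

/-- A `2 × 2` matrix with rows `(a, b)`, `(c, d)` that is self-adjoint for the Gram matrix with
entries `h₁, h₂, h₃` has real eigenvalues; the expression is the discriminant of its characteristic
polynomial. -/
lemma discriminant_nonneg {a b c d h₁ h₂ h₃ : ℝ} (h1 : 0 < h₁) (h3 : 0 < h₃)
    (hdet : h₂ ^ 2 ≤ h₁ * h₃) (hs : a * h₂ + b * h₃ = c * h₁ + d * h₂) :
    0 ≤ (a - d) ^ 2 + 4 * b * c := by
  by_contra hneg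
  push Not at hneg
  have e : (a - d) * h₂ = c * h₁ - b * h₃ := by linarith
  have hbc : b * c < 0 := by nlinarith [sq_nonneg (a - d)]
  have e2 : (a - d) ^ 2 * h₂ ^ 2 = (c * h₁ + b * h₃) ^ 2 - 4 * (b * c) * (h₁ * h₃) := by
    rw [← mul_pow, e]; ring
  have h13 : 0 < h₁ * h₃ := mul_pos h1 h3
  by_cases h2 : h₂ = 0
  · subst h2
    nlinarith [sq_nonneg (c * h₁ + b * h₃)]
  · have h2p : 0 < h₂ ^ 2 := by positivity
    nlinarith [sq_nonneg (c * h₁ + b * h₃), mul_pos_of_neg_of_neg hneg (neg_neg_of_pos h2p)]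

namespace ContactElement

variable {p q F T : R42} {A B : V →L[ℝ] R42} (h : ContactElement p q F T A B)
include h

/-- If `A` is singular, `F` itself is a curvature sphere. Otherwise `A⁻¹ B` is self-adjoint for the
metric induced by `A`, so some `κ A + B` is singular. This supplies the first curvature sphere,
which absence of umbilics alone does not give. -/
lemma exists_isPrincipal (hV : Module.finrank ℝ V = 2) :
    ∃ α β X, IsPrincipal A B α β X := by
  have : Module.Finite ℝ V := Module.finite_of_finrank_pos (by omega)
  let e := Module.finBasisOfFinrankEq ℝ V hV
  have hlin : ∀ r s : ℝ, r ≠ 0 ∨ s ≠ 0 → r • e 0 + s • e 1 ≠ 0 := by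
    intro r s hrs h0
    have := Fintype.linearIndependent_iff.1 e.linearIndependent ![r, s]
      (by simpa [Fin.sum_univ_two] using h0)
    have h0 := this 0
    have h1 := this 1
    simp at h0 h1
    simp_all
  by_cases h0 : area p q F T (A (e 0)) (A (e 1)) = 0
  · obtain ⟨r, s, hrs, h1⟩ := h.dependent_of_area_eq_zero (h.A_mem _) (h.A_mem _) h0
    exact ⟨1, 0, r • e 0 + s • e 1, hlin r s hrs, by simp, by simpa using h1⟩
  set u₁ := A (e 0)
  set u₂ := A (e 1)
  set v₁ := B (e 0)
  set v₂ := B (e 1)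
  have hu₁ : u₁ ∈ screen p q F T := h.A_mem _
  have hu₂ : u₂ ∈ screen p q F T := h.A_mem _
  have hv₁ : v₁ ∈ screen p q F T := h.B_mem _
  have hv₂ : v₂ ∈ screen p q F T := h.B_mem _
  -- The matrix of `A⁻¹ B`, up to the factor `area u₁ u₂`, consists of the areas in Cramer's rule.
  have c1 := h.cramer hu₁ hu₂ hv₁ h0
  have c2 := h.cramer hu₁ hu₂ hv₂ h0
  have hu₁0 : u₁ ≠ 0 := by rintro h; simp [h] at h0
  have hu₂0 : u₂ ≠ 0 := by rintro h; simp [h] at h0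
  have h11 := h.screen_pos hu₁ hu₁0
  have h22 := h.screen_pos hu₂ hu₂0
  have hcs : form u₁ u₂ ^ 2 ≤ form u₁ u₁ * form u₂ u₂ := by
    set w := form u₁ u₁ • u₂ - form u₁ u₂ • u₁ with hw
    have hwm : w ∈ screen p q F T := sub_mem (Submodule.smul_mem _ _ hu₂) (Submodule.smul_mem _ _ hu₁)
    have hww : 0 ≤ form w w := by
      by_cases hw0 : w = 0
      · simp [hw0]
      · exact (h.screen_pos hwm hw0).le
    have : form w w = form u₁ u₁ * (form u₁ u₁ * form u₂ u₂ - form u₁ u₂ ^ 2) := by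
      simp [hw, form_comm u₂ u₁]; ring
    rw [this] at hww
    linarith [nonneg_of_mul_nonneg_right hww h11]
  have hs := h.symm (e 1) (e 0)
  have s1 := congrArg (form u₂) c1
  have s2 := congrArg (form u₁) c2
  simp only [map_smul, map_add, smul_eq_mul, form_comm u₂ u₁] at s1 s2
  have hsym : area p q F T v₁ u₂ * form u₁ u₂ + area p q F T u₁ v₁ * form u₂ u₂ =
      area p q F T v₂ u₂ * form u₁ u₁ + area p q F T u₁ v₂ * form u₁ u₂ := by
    rw [← s1, ← s2]; congr 1
  have hdisc := discriminant_nonneg h11 h22 hcs hsym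
  -- A Plücker relation among the areas: it identifies the discriminant of `κ ↦ area (κ u₁ + v₁) (κ
  -- u₂ + v₂)` with the one just shown to be nonnegative.
  have hpl := congrArg (fun w => area p q F T w v₂) c1
  simp [area_swap p q F T u₂ v₂] at hpl
  obtain ⟨κ, hκ⟩ := exists_quadratic_eq_zero h0 (b := area p q F T v₁ u₂ + area p q F T u₁ v₂)
    (c := area p q F T v₁ v₂) ⟨√((area p q F T v₁ u₂ - area p q F T u₁ v₂) ^ 2 +
      4 * area p q F T u₁ v₁ * area p q F T v₂ u₂), by
      rw [Real.mul_self_sqrt hdisc, discrim, mul_assoc 4, hpl]; ring⟩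
  obtain ⟨r, s, hrs, h1⟩ := h.dependent_of_area_eq_zero
    (u := κ • u₁ + v₁) (v := κ • u₂ + v₂) (add_mem (Submodule.smul_mem _ _ hu₁) hv₁)
    (add_mem (Submodule.smul_mem _ _ hu₂) hv₂) (by simp; linarith)
  refine ⟨κ, 1, r • e 0 + s • e 1, hlin r s hrs, by simp, ?_⟩
  rw [← h1]
  simp only [map_add, map_smul]
  module

/-- The relation makes `(A X, B X)` proportional to `(β, -α)`; `w` is the coefficient of the
orthogonal projection onto that line, and it is nonzero by the immersion condition. -/
lemma exists_screen_vector {α β : ℝ} {X : V} (hX : IsPrincipal A B α β X) :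
    ∃ w ∈ screen p q F T, 0 < form w w ∧ A X = β • w ∧ B X = -α • w := by
  have hn : α ^ 2 + β ^ 2 ≠ 0 := by
    rcases hX.coeff_ne_zero with h | h <;> positivity
  have e := hX.eq_zero
  set w := (α ^ 2 + β ^ 2)⁻¹ • (β • A X - α • B X) with hw
  have hwm : w ∈ screen p q F T := Submodule.smul_mem _ _
    (sub_mem (Submodule.smul_mem _ _ (h.A_mem X)) (Submodule.smul_mem _ _ (h.B_mem X)))
  have hA : A X = β • w := by
    have : (α ^ 2 + β ^ 2) • A X = (α ^ 2 + β ^ 2) • β • w := by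
      rw [hw, smul_comm β, smul_smul, mul_inv_cancel₀ hn, one_smul]
      linear_combination (norm := module) α • e
    exact smul_right_injective _ hn this
  have hB : B X = -α • w := by
    have : (α ^ 2 + β ^ 2) • B X = (α ^ 2 + β ^ 2) • -α • w := by
      rw [hw, smul_comm (-α), smul_smul, mul_inv_cancel₀ hn, one_smul]
      linear_combination (norm := module) β • e
    exact smul_right_injective _ hn this
  refine ⟨w, hwm, h.screen_pos hwm ?_, hA, hB⟩
  intro h0
  rw [h0, smul_zero] at hA hB
  exact hX.ne_zero (h.ker X hA hB)

end ContactElement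

end Pointwise

/-! ### The Weingarten pairing of curvature spheres and the potential at a point -/

section Pointwise

variable {V : Type*} [TopologicalSpace V] [AddCommGroup V] [Module ℝ V]

/-- The polarization of the quadratic form `a α² + 2b αβ + c β²`. -/
def weingartenPolar (a b c α₁ β₁ α₂ β₂ : ℝ) : ℝ :=
  c * β₁ * β₂ + b * (α₁ * β₂ + α₂ * β₁) + a * α₁ * α₂

/-- This is how the determinant of a binary quadratic form changes under a change of basis. It ties
`b² - ac` to the values at the two curvature spheres. -/
lemma weingartenPolar_gram (a b c α₁ β₁ α₂ β₂ : ℝ) :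
    weingartenPolar a b c α₁ β₁ α₁ β₁ * weingartenPolar a b c α₂ β₂ α₂ β₂ -
      weingartenPolar a b c α₁ β₁ α₂ β₂ ^ 2 = (a * c - b ^ 2) * (α₁ * β₂ - α₂ * β₁) ^ 2 := by
  simp only [weingartenPolar]; ring

/-- The vectors `(αᵢ, βᵢ)` form a basis, so a form with all Gram entries zero is zero. The
combinations used in the proof invert the change of basis. -/
lemma weingartenPolar_ne_zero {a b c α₁ β₁ α₂ β₂ : ℝ} (habc : ¬ (a = 0 ∧ b = 0 ∧ c = 0))
    (hD : α₁ * β₂ - α₂ * β₁ ≠ 0) (h12 : weingartenPolar a b c α₁ β₁ α₂ β₂ = 0) :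
    weingartenPolar a b c α₁ β₁ α₁ β₁ ≠ 0 ∨ weingartenPolar a b c α₂ β₂ α₂ β₂ ≠ 0 := by
  by_contra hcon
  push Not at hcon
  obtain ⟨h11, h22⟩ := hcon
  have hD2 : (α₁ * β₂ - α₂ * β₁) ^ 2 ≠ 0 := pow_ne_zero 2 hD
  simp only [weingartenPolar] at h11 h12 h22
  refine habc ⟨?_, ?_, ?_⟩
  · refine (mul_eq_zero.1 (?_ : a * (α₁ * β₂ - α₂ * β₁) ^ 2 = 0)).resolve_right hD2
    linear_combination β₂ ^ 2 * h11 - 2 * β₁ * β₂ * h12 + β₁ ^ 2 * h22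
  · refine (mul_eq_zero.1 (?_ : b * (α₁ * β₂ - α₂ * β₁) ^ 2 = 0)).resolve_right hD2
    linear_combination -α₂ * β₂ * h11 + (α₁ * β₂ + α₂ * β₁) * h12 - α₁ * β₁ * h22
  · refine (mul_eq_zero.1 (?_ : c * (α₁ * β₂ - α₂ * β₁) ^ 2 = 0)).resolve_right hD2
    linear_combination α₂ ^ 2 * h11 - 2 * α₁ * α₂ * h12 + α₁ ^ 2 * h22

/-- Half the exterior derivative of `c 𝔣∧d𝔣 - b (𝔣∧d𝔱 + 𝔱∧d𝔣) + a 𝔱∧d𝔱`, where `A = d𝔣` and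
`B = d𝔱`. -/
def curl (A B : V →L[ℝ] R42) (a b c : ℝ) (X Y : V) : EndR42 :=
  c • wedge (A X) (A Y) - b • (wedge (A X) (B Y) + wedge (B X) (A Y)) + a • wedge (B X) (B Y)

lemma curl_smul_add_smul (A B : V →L[ℝ] R42) (a b c : ℝ) (X Y : V) (r₁ s₁ r₂ s₂ : ℝ) :
    curl A B a b c (r₁ • X + s₁ • Y) (r₂ • X + s₂ • Y) =
      (r₁ * s₂ - s₁ * r₂) • curl A B a b c X Y := by
  simp only [curl, map_add, map_smul, LinearMap.add_apply, LinearMap.smul_apply, wedge_self,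
    wedge_swap (A Y) (A X), wedge_swap (B Y) (B X), wedge_swap (A Y) (B X),
    wedge_swap (B Y) (A X), wedge_swap (B X) (A X), wedge_swap (B Y) (A Y)]
  module

/-- Substituting Rodrigues' equations turns `curl` into `aK + 2bH + c` times `d𝔣(X) ∧ d𝔣(Y)`. -/
lemma curl_eq_zero_of_rodrigues {A B : V →L[ℝ] R42} {a b c κ₁ κ₂ : ℝ} {X Y : V}
    (hX : B X + κ₁ • A X = 0) (hY : B Y + κ₂ • A Y = 0)
    (hκ : a * (κ₁ * κ₂) + 2 * b * ((κ₁ + κ₂) / 2) + c = 0) : curl A B a b c X Y = 0 := by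
  have hX' : B X = -κ₁ • A X := by rw [neg_smul]; exact eq_neg_of_add_eq_zero_left hX
  have hY' : B Y = -κ₂ • A Y := by rw [neg_smul]; exact eq_neg_of_add_eq_zero_left hY
  have : curl A B a b c X Y =
      (a * (κ₁ * κ₂) + 2 * b * ((κ₁ + κ₂) / 2) + c) • wedge (A X) (A Y) := by
    simp only [curl, hX', hY', map_smul, LinearMap.smul_apply]
    module
  rw [this, hκ, zero_smul]

/-- `-c (A,A) + 2b (A,B) - a (B,B)` as a symmetric bilinear form. -/
def quadForm (A B : V →L[ℝ] R42) (a b c : ℝ) (X Y : V) : ℝ :=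
  -c * form (A X) (A Y) + b * (form (A X) (B Y) + form (A Y) (B X)) - a * form (B X) (B Y)

lemma quadForm_smul_add_smul (A B : V →L[ℝ] R42) (a b c : ℝ) (X Y : V) (r₁ s₁ r₂ s₂ : ℝ) :
    quadForm A B a b c (r₁ • X + s₁ • Y) (r₂ • X + s₂ • Y) =
      r₁ * r₂ * quadForm A B a b c X X + (r₁ * s₂ + s₁ * r₂) * quadForm A B a b c X Y +
        s₁ * s₂ * quadForm A B a b c Y Y := by
  simp only [quadForm, map_add, map_smul, LinearMap.add_apply, LinearMap.smul_apply,
    smul_eq_mul, form_comm (A Y) (A X), form_comm (B Y) (B X)]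
  ring

/-- The value of `c 𝔣∧d𝔣 - b (𝔣∧d𝔱 + 𝔱∧d𝔣) + a 𝔱∧d𝔱` on a tangent vector. -/
def potential (F T : R42) (A B : V →L[ℝ] R42) (a b c : ℝ) (X : V) : EndR42 :=
  c • wedge F (A X) - b • (wedge F (B X) + wedge T (A X)) + a • wedge T (B X)

lemma potential_eq (F T : R42) (A B : V →L[ℝ] R42) (a b c : ℝ) (X : V) :
    potential F T A B a b c X =
      wedge F (c • A X - b • B X) + wedge T (a • B X - b • A X) := by
  simp only [potential, map_sub, map_smul]
  module

lemma potential_smul_add_smul (F T : R42) (A B : V →L[ℝ] R42) (a b c : ℝ) (X Y : V) (r s : ℝ) :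
    potential F T A B a b c (r • X + s • Y) =
      r • potential F T A B a b c X + s • potential F T A B a b c Y := by
  simp only [potential, map_add, map_smul]
  module

lemma wedge_add_wedge_screen_apply {p q F T w : R42} (hw : w ∈ screen p q F T) (v₁ v₂ : R42) :
    (wedge F v₁ + wedge T v₂) w = -form v₁ w • F - form v₂ w • T := by
  obtain ⟨wF, wT, -, -⟩ := hw
  simp [wedge_apply, form_comm F w, form_comm T w, wF, wT]
  module

lemma screen_le_perp (p q F T : R42) : screen p q F T ≤ perp (Submodule.span ℝ {F, T}) := by
  intro w hw s hs
  obtain ⟨r, t, rfl⟩ := Submodule.mem_span_pair.1 hs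
  obtain ⟨wF, wT, -, -⟩ := hw
  simp [form_comm _ w, wF, wT]

namespace NullFrame

variable {p q F T : R42} (h : NullFrame p q F T)
include h

lemma wedge_add_wedge_apply_frame {v₁ v₂ : R42} (h₁ : v₁ ∈ screen p q F T)
    (h₂ : v₂ ∈ screen p q F T) :
    (wedge F v₁ + wedge T v₂) F = 0 ∧ (wedge F v₁ + wedge T v₂) T = 0 ∧
      (wedge F v₁ + wedge T v₂) p = -v₂ ∧ (wedge F v₁ + wedge T v₂) q = -v₁ := by
  obtain ⟨a1, a2, a3, a4⟩ := h₁
  obtain ⟨b1, b2, b3, b4⟩ := h₂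
  simp [wedge_apply, h.FF, h.FT, h.TF, h.TT, h.Fp, h.Fq, h.Tp, h.Tq, a1, a2, a3, a4, b1, b2, b3, b4]

/-- Both endomorphisms kill `F, T` and send the screen into their span, so the commutator is a
multiple of `F ∧ T`. Its coefficient is the difference of the two sides of `hs`. -/
lemma wedge_add_wedge_bracket {v₁ v₂ w₁ w₂ : R42} (hv₁ : v₁ ∈ screen p q F T)
    (hv₂ : v₂ ∈ screen p q F T) (hw₁ : w₁ ∈ screen p q F T) (hw₂ : w₂ ∈ screen p q F T)
    (hs : form v₁ w₂ = form w₁ v₂) :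
    ⁅wedge F v₁ + wedge T v₂, wedge F w₁ + wedge T w₂⁆ = 0 := by
  have key : ∀ {v₁ v₂ w₁ w₂ : R42} (_ : v₁ ∈ screen p q F T) (_ : v₂ ∈ screen p q F T)
      (_ : w₁ ∈ screen p q F T) (_ : w₂ ∈ screen p q F T) (v : R42),
      (wedge F v₁ + wedge T v₂) ((wedge F w₁ + wedge T w₂) v) =
        form F v • (-form v₁ w₁ • F - form v₂ w₁ • T) +
          form T v • (-form v₁ w₂ • F - form v₂ w₂ • T) := by
    intro v₁ v₂ w₁ w₂ hv₁ hv₂ hw₁ hw₂ v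
    have e : (wedge F w₁ + wedge T w₂) v =
        form F v • w₁ - form w₁ v • F + (form T v • w₂ - form w₂ v • T) := rfl
    obtain ⟨f1, f2, -, -⟩ := h.wedge_add_wedge_apply_frame hv₁ hv₂
    rw [e]
    simp only [map_add, map_sub, map_smul, f1, f2, wedge_add_wedge_screen_apply hw₁,
      wedge_add_wedge_screen_apply hw₂, smul_zero, sub_zero]
  ext v : 1
  rw [Ring.lie_def]
  change (wedge F v₁ + wedge T v₂) ((wedge F w₁ + wedge T w₂) v) -
    (wedge F w₁ + wedge T w₂) ((wedge F v₁ + wedge T v₂) v) = 0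
  rw [key hv₁ hv₂ hw₁ hw₂, key hw₁ hw₂ hv₁ hv₂,
    form_comm v₁ w₁, form_comm v₂ w₂, form_comm v₂ w₁, form_comm w₂ v₁, hs]
  module

/-- An element of `f ∧ f^⊥` is determined by its values at `p` and `q`. -/
lemma eq_zero_of_mem_wedgeSub {ζ : EndR42}
    (hζ : ζ ∈ wedgeSub (Submodule.span ℝ {F, T}) (perp (Submodule.span ℝ {F, T})))
    (hp : ζ p = 0) (hq : ζ q = 0) : ζ = 0 := by
  have hex : ∃ v₁ v₂ : R42, ζ = wedge F v₁ + wedge T v₂ := by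
    have hle : wedgeSub (Submodule.span ℝ {F, T}) (perp (Submodule.span ℝ {F, T})) ≤
        LinearMap.range (wedge F) ⊔ LinearMap.range (wedge T) := by
      refine Submodule.map₂_le.2 fun m hm n _ => ?_
      obtain ⟨r, s, rfl⟩ := Submodule.mem_span_pair.1 hm
      rw [map_add, map_smul, map_smul, LinearMap.add_apply]
      exact add_mem (Submodule.mem_sup_left (Submodule.smul_mem _ r ⟨n, rfl⟩))
        (Submodule.mem_sup_right (Submodule.smul_mem _ s ⟨n, rfl⟩))
    obtain ⟨_, ⟨v₁, rfl⟩, _, ⟨v₂, rfl⟩, h0⟩ := Submodule.mem_sup.1 (hle hζ)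
    exact ⟨v₁, v₂, h0.symm⟩
  obtain ⟨v₁, v₂, rfl⟩ := hex
  simp only [add_apply, wedge_apply, h.Fp, h.Fq, h.Tp, h.Tq] at hp hq
  have e1 : v₁ = -form v₁ q • F - form v₂ q • T := by linear_combination (norm := module) -hq
  have e2 : v₂ = -form v₁ p • F - form v₂ p • T := by linear_combination (norm := module) -hp
  -- The vectors `v₁, v₂` now lie in `⟨F, T⟩`. Equality of these two coefficients makes the
  -- remaining multiples of `F ∧ T` and `T ∧ F` cancel.
  have e3 : form v₁ p = form v₂ q := by
    have := congrArg (fun w => form w p) e1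
    simpa [h.Fp, h.Tp] using this
  rw [e3] at e2
  generalize form v₁ q = x, form v₂ q = y, form v₂ p = z at e1 e2
  rw [e1, e2]
  simp only [map_sub, map_smul, wedge_self, wedge_swap T F]
  module

end NullFrame

namespace ContactElement

variable {p q F T : R42} {A B : V →L[ℝ] R42} (h : ContactElement p q F T A B)
include h

/-- Symmetry of `(A X, B Y)` on the two curvature directions reads `(α₁β₂ - α₂β₁)(w₁, w₂) = 0`. Thus
distinct curvature spheres have orthogonal screen vectors; the later pointwise computations take
place in this basis. -/
lemma diagonalize {α₁ β₁ α₂ β₂ : ℝ} {X₁ X₂ : V} (h₁ : IsPrincipal A B α₁ β₁ X₁)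
    (h₂ : IsPrincipal A B α₂ β₂ X₂) (hD : α₁ * β₂ - α₂ * β₁ ≠ 0) :
    ∃ w₁ ∈ screen p q F T, ∃ w₂ ∈ screen p q F T, 0 < form w₁ w₁ ∧ 0 < form w₂ w₂ ∧
      form w₁ w₂ = 0 ∧ A X₁ = β₁ • w₁ ∧ B X₁ = -α₁ • w₁ ∧ A X₂ = β₂ • w₂ ∧ B X₂ = -α₂ • w₂ ∧
      LinearIndependent ℝ ![X₁, X₂] := by
  obtain ⟨w₁, m₁, pos₁, A₁, B₁⟩ := h.exists_screen_vector h₁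
  obtain ⟨w₂, m₂, pos₂, A₂, B₂⟩ := h.exists_screen_vector h₂
  have hs := h.symm X₁ X₂
  simp [A₁, A₂, B₁, B₂, form_comm w₂ w₁] at hs
  have h12 : form w₁ w₂ = 0 := by
    refine (mul_eq_zero.1 (?_ : (α₁ * β₂ - α₂ * β₁) * form w₁ w₂ = 0)).resolve_left hD
    linear_combination -hs
  have h21 : form w₂ w₁ = 0 := by rw [form_comm, h12]
  refine ⟨w₁, m₁, w₂, m₂, pos₁, pos₂, h12, A₁, B₁, A₂, B₂, ?_⟩
  rw [LinearIndependent.pair_iff]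
  intro r s hrs
  have eA := congrArg A hrs
  have eB := congrArg B hrs
  simp only [map_add, map_smul, map_zero, A₁, A₂, B₁, B₂] at eA eB
  have a1 := congrArg (fun w => form w w₁) eA
  have a2 := congrArg (fun w => form w w₂) eA
  have b1 := congrArg (fun w => form w w₁) eB
  have b2 := congrArg (fun w => form w w₂) eB
  simp [h12, h21, pos₁.ne', pos₂.ne'] at a1 a2 b1 b2
  have c1 := h₁.coeff_ne_zero
  have c2 := h₂.coeff_ne_zero
  constructor
  · tauto
  · tauto

/-- The quadratic form `(α, β) ↦ area ((αA + βB)E₁) ((αA + βB)E₂)` factors into two linear forms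
whose zeros are the curvature spheres. Its discriminant is thus a square, nonzero because the
spheres are distinct. -/
lemma discriminant_pos (hV : Module.finrank ℝ V = 2) {α₁ β₁ α₂ β₂ : ℝ} {X₁ X₂ : V}
    (h₁ : IsPrincipal A B α₁ β₁ X₁) (h₂ : IsPrincipal A B α₂ β₂ X₂)
    (hD : α₁ * β₂ - α₂ * β₁ ≠ 0) {E₁ E₂ : V} (hE : LinearIndependent ℝ ![E₁, E₂]) :
    0 < ((area p q F T (A E₁) (B E₂) + area p q F T (B E₁) (A E₂)) / 2) ^ 2 -
      area p q F T (A E₁) (A E₂) * area p q F T (B E₁) (B E₂) := by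
  obtain ⟨w₁, m₁, w₂, m₂, pos₁, pos₂, h12, A₁, B₁, A₂, B₂, hX⟩ := h.diagonalize h₁ h₂ hD
  have hk : area p q F T w₁ w₂ ≠ 0 :=
    h.area_ne_zero_of_orthogonal m₁ m₂ (by rintro rfl; simp at pos₁) (by rintro rfl; simp at pos₂)
      h12
  obtain ⟨r₁, s₁, e₁⟩ := exists_eq_smul_add_smul hV hX E₁
  obtain ⟨r₂, s₂, e₂⟩ := exists_eq_smul_add_smul hV hX E₂
  have hdet : r₁ * s₂ - s₁ * r₂ ≠ 0 := by
    intro h0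
    rw [LinearIndependent.pair_iff] at hE
    have z1 := hE s₂ (-s₁) (by rw [e₁, e₂]; linear_combination (norm := module) h0 • X₁)
    have z2 := hE r₂ (-r₁) (by rw [e₁, e₂]; linear_combination (norm := module) -h0 • X₂)
    have := (hE 1 0 (by rw [e₁]; simp_all)).1
    norm_num at this
  have : ((area p q F T (A E₁) (B E₂) + area p q F T (B E₁) (A E₂)) / 2) ^ 2 -
      area p q F T (A E₁) (A E₂) * area p q F T (B E₁) (B E₂) =
      (area p q F T w₁ w₂ * (r₁ * s₂ - s₁ * r₂) * (α₁ * β₂ - α₂ * β₁) / 2) ^ 2 := by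
    rw [e₁, e₂]
    simp only [map_add, map_smul, A₁, A₂, B₁, B₂, LinearMap.add_apply, LinearMap.smul_apply,
      area_self, area_swap p q F T w₂ w₁, smul_eq_mul]
    ring
  rw [this]
  positivity

lemma exists_pencil_ne_zero {α₁ β₁ α₂ β₂ : ℝ} {X₁ X₂ : V} (h₁ : IsPrincipal A B α₁ β₁ X₁)
    (h₂ : IsPrincipal A B α₂ β₂ X₂) (hD : α₁ * β₂ - α₂ * β₁ ≠ 0) {α β : ℝ}
    (hαβ : α ≠ 0 ∨ β ≠ 0) : ∃ X, α • A X + β • B X ≠ 0 := by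
  obtain ⟨w₁, m₁, w₂, m₂, pos₁, pos₂, h12, A₁, B₁, A₂, B₂, hX⟩ := h.diagonalize h₁ h₂ hD
  by_contra hcon
  push Not at hcon
  have z1 := hcon X₁
  have z2 := hcon X₂
  have w10 : w₁ ≠ 0 := by rintro rfl; simp at pos₁
  have w20 : w₂ ≠ 0 := by rintro rfl; simp at pos₂
  rw [A₁, B₁, smul_smul, smul_smul, ← add_smul, smul_eq_zero_iff_left w10] at z1
  rw [A₂, B₂, smul_smul, smul_smul, ← add_smul, smul_eq_zero_iff_left w20] at z2
  rcases hαβ with h0 | h0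
  · exact h0 ((mul_eq_zero.1 (by linear_combination α₁ * z2 - α₂ * z1 :
      α * (α₁ * β₂ - α₂ * β₁) = 0)).resolve_right hD)
  · exact h0 ((mul_eq_zero.1 (by linear_combination β₁ * z2 - β₂ * z1 :
      β * (α₁ * β₂ - α₂ * β₁) = 0)).resolve_right hD)

/-- An alternating form on a plane is determined by one value, and on `X₁, X₂` it is the
polarization times the nonzero `w₁ ∧ w₂`. -/
lemma curl_eq_zero_iff (hV : Module.finrank ℝ V = 2) {α₁ β₁ α₂ β₂ : ℝ} {X₁ X₂ : V}
    (h₁ : IsPrincipal A B α₁ β₁ X₁) (h₂ : IsPrincipal A B α₂ β₂ X₂)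
    (hD : α₁ * β₂ - α₂ * β₁ ≠ 0) (a b c : ℝ) :
    (∀ X Y, curl A B a b c X Y = 0) ↔ weingartenPolar a b c α₁ β₁ α₂ β₂ = 0 := by
  obtain ⟨w₁, m₁, w₂, m₂, pos₁, pos₂, h12, A₁, B₁, A₂, B₂, hX⟩ := h.diagonalize h₁ h₂ hD
  have hc : curl A B a b c X₁ X₂ = weingartenPolar a b c α₁ β₁ α₂ β₂ • wedge w₁ w₂ := by
    simp only [curl, A₁, A₂, B₁, B₂, weingartenPolar, map_smul, LinearMap.smul_apply]
    module
  have hw : wedge w₁ w₂ ≠ 0 := by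
    intro h0
    have := congrArg (fun L : EndR42 => form (L w₁) w₂) h0
    simp [wedge_apply, h12, form_comm w₂ w₁, pos₁.ne', pos₂.ne'] at this
  constructor
  · intro h0
    rw [h0, eq_comm, smul_eq_zero_iff_left hw] at hc
    exact hc
  · intro h0 X Y
    obtain ⟨r₁, s₁, rfl⟩ := exists_eq_smul_add_smul hV hX X
    obtain ⟨r₂, s₂, rfl⟩ := exists_eq_smul_add_smul hV hX Y
    rw [curl_smul_add_smul, hc, h0, zero_smul, smul_zero]

lemma exists_rodrigues (hA : Function.Injective A) {α β : ℝ} {X : V}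
    (hX : IsPrincipal A B α β X) : β ≠ 0 ∧ B X + (α / β) • A X = 0 := by
  obtain ⟨w, -, -, A₁, B₁⟩ := h.exists_screen_vector hX
  have hβ : β ≠ 0 := by
    rintro rfl
    rw [zero_smul] at A₁
    exact hX.ne_zero (hA (by rw [A₁, map_zero]))
  refine ⟨hβ, ?_⟩
  rw [A₁, B₁, smul_smul, div_mul_cancel₀ _ hβ]
  module

/-- The numbers `gᵢ` are `(wᵢ, wᵢ)`. The last two identities compute the metric induced by each
curvature sphere along the other sphere's curvature direction, as needed to normalize the lifts. -/
lemma quadForm_principal {α₁ β₁ α₂ β₂ : ℝ} {X₁ X₂ : V} (h₁ : IsPrincipal A B α₁ β₁ X₁)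
    (h₂ : IsPrincipal A B α₂ β₂ X₂) (hD : α₁ * β₂ - α₂ * β₁ ≠ 0) (a b c : ℝ) :
    ∃ g₁ g₂ : ℝ, 0 < g₁ ∧ 0 < g₂ ∧
      quadForm A B a b c X₁ X₁ = -weingartenPolar a b c α₁ β₁ α₁ β₁ * g₁ ∧
      quadForm A B a b c X₂ X₂ = -weingartenPolar a b c α₂ β₂ α₂ β₂ * g₂ ∧
      quadForm A B a b c X₁ X₂ = 0 ∧
      form (α₁ • A X₂ + β₁ • B X₂) (α₁ • A X₂ + β₁ • B X₂) = (α₁ * β₂ - α₂ * β₁) ^ 2 * g₂ ∧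
      form (α₂ • A X₁ + β₂ • B X₁) (α₂ • A X₁ + β₂ • B X₁) = (α₁ * β₂ - α₂ * β₁) ^ 2 * g₁ := by
  obtain ⟨w₁, m₁, w₂, m₂, pos₁, pos₂, h12, A₁, B₁, A₂, B₂, hX⟩ := h.diagonalize h₁ h₂ hD
  refine ⟨form w₁ w₁, form w₂ w₂, pos₁, pos₂, ?_, ?_, ?_, ?_, ?_⟩ <;>
  simp [quadForm, weingartenPolar, A₁, A₂, B₁, B₂, h12, form_comm w₂ w₁] <;> ring

/-- On a curvature direction, the potential of a linear Weingarten surface takes values in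
`σ ∧ dσ`, for `σ` the other curvature sphere. -/
lemma potential_principal {α₁ β₁ α₂ β₂ : ℝ} {X₁ X₂ : V} (h₁ : IsPrincipal A B α₁ β₁ X₁)
    (h₂ : IsPrincipal A B α₂ β₂ X₂) (hD : α₁ * β₂ - α₂ * β₁ ≠ 0) {a b c : ℝ}
    (h12 : weingartenPolar a b c α₁ β₁ α₂ β₂ = 0) :
    ∃ μ : ℝ, potential F T A B a b c X₁ =
      μ • wedge (α₂ • F + β₂ • T) (α₂ • A X₁ + β₂ • B X₁) := by
  obtain ⟨w₁, -, -, A₁, B₁⟩ := h.exists_screen_vector h₁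
  have hn : α₂ ^ 2 + β₂ ^ 2 ≠ 0 := by
    rcases h₂.coeff_ne_zero with h | h <;> positivity
  have e : α₂ • A X₁ + β₂ • B X₁ = -(α₁ * β₂ - α₂ * β₁) • w₁ := by rw [A₁, B₁]; module
  set P := c * β₁ + b * α₁
  set Q := b * β₁ + a * α₁
  have hPQ : β₂ * P + α₂ * Q = 0 := by
    rw [← h12]; simp only [weingartenPolar, P, Q]; ring
  -- By `hPQ` the vector `(P, -Q)` is parallel to `(α₂, β₂)`; `ν` is the factor, computed by
  -- projection.
  set ν := (α₂ * P - β₂ * Q) / (α₂ ^ 2 + β₂ ^ 2)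
  have hP : P = ν * α₂ := by
    simp only [ν]; field_simp; linear_combination β₂ * hPQ
  have hQ : -Q = ν * β₂ := by
    simp only [ν]; field_simp; linear_combination -α₂ * hPQ
  have hpot : potential F T A B a b c X₁ = P • wedge F w₁ + -Q • wedge T w₁ := by
    simp only [potential, A₁, B₁, map_smul, P, Q]; module
  refine ⟨ν * -(α₁ * β₂ - α₂ * β₁)⁻¹, ?_⟩
  have hi : -(α₁ * β₂ - α₂ * β₁)⁻¹ * -(α₁ * β₂ - α₂ * β₁) = 1 := by field_simp
  rw [hpot, e, hP, hQ, map_smul, smul_smul, mul_assoc, hi, mul_one]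
  simp only [map_add, map_smul, LinearMap.add_apply, LinearMap.smul_apply]
  module

lemma combination_mem (r s : ℝ) (X : V) : r • A X - s • B X ∈ screen p q F T :=
  sub_mem (Submodule.smul_mem _ _ (h.A_mem X)) (Submodule.smul_mem _ _ (h.B_mem X))

lemma combination_mem' (r s : ℝ) (X : V) : r • B X - s • A X ∈ screen p q F T :=
  sub_mem (Submodule.smul_mem _ _ (h.B_mem X)) (Submodule.smul_mem _ _ (h.A_mem X))

lemma potential_bracket (a b c : ℝ) (X Y : V) :
    ⁅potential F T A B a b c X, potential F T A B a b c Y⁆ = 0 := by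
  rw [potential_eq, potential_eq]
  refine h.wedge_add_wedge_bracket (h.combination_mem _ _ X) (h.combination_mem' _ _ X)
    (h.combination_mem _ _ Y) (h.combination_mem' _ _ Y) ?_
  have := h.symm X Y
  simp only [map_sub, map_smul, LinearMap.sub_apply, LinearMap.smul_apply, smul_eq_mul,
    form_comm (A Y) (A X), form_comm (B Y) (B X), form_comm (B X) (A Y), form_comm (B Y) (A X),
    this]

lemma potential_apply_frame (a b c : ℝ) (X : V) :
    potential F T A B a b c X F = 0 ∧ potential F T A B a b c X T = 0 ∧
      potential F T A B a b c X p = -(a • B X - b • A X) ∧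
      potential F T A B a b c X q = -(c • A X - b • B X) := by
  rw [potential_eq]
  exact h.wedge_add_wedge_apply_frame (h.combination_mem _ _ X) (h.combination_mem' _ _ X)

omit h in
lemma potential_apply_screen (a b c : ℝ) (X : V) {w : R42} (hw : w ∈ screen p q F T) :
    potential F T A B a b c X w =
      -form (c • A X - b • B X) w • F - form (a • B X - b • A X) w • T := by
  rw [potential_eq]
  exact wedge_add_wedge_screen_apply hw _ _

lemma potential_mem (a b c : ℝ) (X : V) : potential F T A B a b c X ∈
    wedgeSub (Submodule.span ℝ {F, T}) (perp (Submodule.span ℝ {F, T})) := by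
  rw [potential_eq]
  exact add_mem
    (Submodule.apply_mem_map₂ _ (Submodule.subset_span (by simp))
      (screen_le_perp p q F T (h.combination_mem _ _ X)))
    (Submodule.apply_mem_map₂ _ (Submodule.subset_span (by simp))
      (screen_le_perp p q F T (h.combination_mem' _ _ X)))

end ContactElement

end Pointwise

/-! ### Smoothness of the space form projection -/

/-- `form` as a continuous bilinear map. -/
def formL : R42 →L[ℝ] R42 →L[ℝ] ℝ :=
  LinearMap.toContinuousLinearMap
    ((LinearMap.toContinuousLinearMap : (R42 →ₗ[ℝ] ℝ) ≃ₗ[ℝ] (R42 →L[ℝ] ℝ)).toLinearMap ∘ₗ form)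

lemma formL_apply (v w : R42) : formL v w = form v w := rfl

/-- `wedge` as a continuous bilinear map. -/
def wedgeL : R42 →L[ℝ] R42 →L[ℝ] EndR42 :=
  LinearMap.toContinuousLinearMap (F' := R42 →L[ℝ] EndR42)
    { toFun := fun v => LinearMap.toContinuousLinearMap (wedge v)
      map_add' := fun v w => by ext : 1; simp
      map_smul' := fun r v => by ext : 1; simp }

section Surface

variable {M : Type*} [TopologicalSpace M] [ChartedSpace (EuclideanSpace ℝ (Fin 2)) M]

lemma contMDiffWithinAt_form {g h : M → R42} {s : Set M} {x : M}
    (hg : ContMDiffWithinAt (𝓡 2) 𝓘(ℝ, R42) ∞ g s x)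
    (hh : ContMDiffWithinAt (𝓡 2) 𝓘(ℝ, R42) ∞ h s x) :
    ContMDiffWithinAt (𝓡 2) 𝓘(ℝ, ℝ) ∞ (fun y => form (g y) (h y)) s x :=
  ContMDiffWithinAt.clm_apply (g := fun y => formL (g y))
    (formL.contMDiff.contMDiffAt.comp_contMDiffWithinAt x hg) hh

lemma contMDiffWithinAt_wedge_apply {g h : M → R42} {s : Set M} {x : M}
    (hg : ContMDiffWithinAt (𝓡 2) 𝓘(ℝ, R42) ∞ g s x)
    (hh : ContMDiffWithinAt (𝓡 2) 𝓘(ℝ, R42) ∞ h s x) (v : R42) :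
    ContMDiffWithinAt (𝓡 2) 𝓘(ℝ, R42) ∞ (fun y => wedge (g y) (h y) v) s x := by
  simp only [wedge_apply]
  exact ((contMDiffWithinAt_form hg contMDiffWithinAt_const).smul hh).sub
    ((contMDiffWithinAt_form hh contMDiffWithinAt_const).smul hg)

lemma wedge_ne_zero_of_linearIndependent {v w : R42} (h : LinearIndependent ℝ ![v, w]) :
    wedge v w ≠ 0 := by
  rw [LinearIndependent.pair_iff] at h
  intro h0
  have hv : v = 0 := eq_zero_of_forall_form fun u => by
    have := congrArg (fun L : EndR42 => L u) h0
    simp only [wedge_apply, zero_apply] at this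
    exact (h (-form w u) (form v u) (by rw [← this]; module)).2
  have := (h 1 0 (by simp [hv])).1
  norm_num at this

lemma span_pair_linearIndependent {S : Submodule ℝ R42} {v w : R42}
    (h : S = Submodule.span ℝ {v, w}) (hS : Module.finrank ℝ S = 2) :
    LinearIndependent ℝ ![v, w] := by
  rw [linearIndependent_iff_card_eq_finrank_span]
  rw [Set.finrank, range_pair, ← h, hS, Fintype.card_fin]

section Projection

variable {f : M → Submodule ℝ R42} {p q : R42} {𝔣 𝔱 : M → R42}

/-- The vectors `τ𝔭, τ𝔮` lie in the isotropic plane `f x`, and skewness of `τ` gives `(τ𝔭, 𝔭) = (τ𝔮,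
𝔮) = 0` and `(τ𝔮, 𝔭) = -(τ𝔭, 𝔮)`. The chosen normalizations then yield the dual frame. -/
lemma IsSpaceFormProjection.frame (hf : IsLegendre f) (hproj : IsSpaceFormProjection f p q 𝔣 𝔱)
    (x : M) : NullFrame p q (𝔣 x) (𝔱 x) ∧ f x = Submodule.span ℝ {𝔣 x, 𝔱 x} := by
  obtain ⟨U, σ, τ, hxU, hσ, hτ, hspan⟩ := hf.smooth x
  have hlin := span_pair_linearIndependent (hspan x hxU) (hf.rank_two x)
  have hσx := hσ.mem x hxU
  have hτx := hτ.mem x hxU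
  obtain ⟨h0, h𝔣, h𝔱⟩ := hproj x (wedge (σ x) (τ x)) (Submodule.apply_mem_map₂ _ hσx hτx)
    (wedge_ne_zero_of_linearIndependent hlin)
  have hneg : form (wedge (σ x) (τ x) q) p = -form (wedge (σ x) (τ x) p) q := by
    simp [wedge_apply]; ring
  have hself : ∀ v, form (wedge (σ x) (τ x) v) v = 0 := by
    intro v; simp [wedge_apply]; ring
  have m𝔣 : 𝔣 x ∈ f x := by
    rw [h𝔣, wedge_apply]
    exact neg_mem (Submodule.smul_mem _ _ (sub_mem (Submodule.smul_mem _ _ hτx)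
      (Submodule.smul_mem _ _ hσx)))
  have m𝔱 : 𝔱 x ∈ f x := by
    rw [h𝔱, wedge_apply]
    exact neg_mem (Submodule.smul_mem _ _ (sub_mem (Submodule.smul_mem _ _ hτx)
      (Submodule.smul_mem _ _ hσx)))
  have hframe : NullFrame p q (𝔣 x) (𝔱 x) := by
    refine ⟨hf.isotropic x m𝔣 _ m𝔣, hf.isotropic x m𝔱 _ m𝔣, hf.isotropic x m𝔱 _ m𝔱, ?_, ?_, ?_, ?_⟩
    · rw [h𝔣]; simp [hself]
    · rw [h𝔣]; simp [h0]
    · rw [h𝔱]; simp [hneg, h0]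
    · rw [h𝔱]; simp [hself]
  refine ⟨hframe, ?_⟩
  symm
  refine Submodule.eq_of_le_of_finrank_eq ?_ ?_
  · rw [Submodule.span_le]
    rintro _ (rfl | rfl)
    exacts [m𝔣, m𝔱]
  · rw [hf.rank_two x]
    have := finrank_span_eq_card hframe.linearIndependent
    rwa [range_pair, Fintype.card_fin] at this

lemma IsSpaceFormProjection.contMDiff (hf : IsLegendre f)
    (hproj : IsSpaceFormProjection f p q 𝔣 𝔱) :
    ContMDiff (𝓡 2) 𝓘(ℝ, R42) ∞ 𝔣 ∧ ContMDiff (𝓡 2) 𝓘(ℝ, R42) ∞ 𝔱 := by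
  have key : ∀ x, ContMDiffAt (𝓡 2) 𝓘(ℝ, R42) ∞ 𝔣 x ∧ ContMDiffAt (𝓡 2) 𝓘(ℝ, R42) ∞ 𝔱 x := by
    intro x
    obtain ⟨U, σ, τ, hxU, hσ, hτ, hspan⟩ := hf.smooth x
    have hU := hσ.isOpen.mem_nhds hxU
    have main : ∀ y ∈ U, form (wedge (σ y) (τ y) p) q ≠ 0 ∧
        𝔣 y = -((form (wedge (σ y) (τ y) p) q)⁻¹ • wedge (σ y) (τ y) p) ∧
        𝔱 y = -((form (wedge (σ y) (τ y) q) p)⁻¹ • wedge (σ y) (τ y) q) := fun y hy =>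
      hproj y (wedge (σ y) (τ y)) (Submodule.apply_mem_map₂ _ (hσ.mem y hy) (hτ.mem y hy))
        (wedge_ne_zero_of_linearIndependent
          (span_pair_linearIndependent (hspan y hy) (hf.rank_two y)))
    have hneg : form (wedge (σ x) (τ x) q) p = -form (wedge (σ x) (τ x) p) q := by
      simp [wedge_apply]; ring
    have cp := contMDiffWithinAt_wedge_apply (hσ.smooth x hxU) (hτ.smooth x hxU) p
    have cq := contMDiffWithinAt_wedge_apply (hσ.smooth x hxU) (hτ.smooth x hxU) q
    have c1 := contMDiffWithinAt_form cp (contMDiffWithinAt_const (c := q))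
    have c2 := contMDiffWithinAt_form cq (contMDiffWithinAt_const (c := p))
    constructor
    · refine ContMDiffWithinAt.contMDiffAt (s := U) ?_ hU
      refine ((c1.inv₀ (main x hxU).1).smul cp).neg.congr (fun y hy => ?_) ?_
      exacts [(main y hy).2.1, (main x hxU).2.1]
    · refine ContMDiffWithinAt.contMDiffAt (s := U) ?_ hU
      refine ((c2.inv₀ (by rw [hneg]; exact neg_ne_zero.2 (main x hxU).1)).smul cq).neg.congr
        (fun y hy => ?_) ?_
      exacts [(main y hy).2.2, (main x hxU).2.2]
  exact ⟨fun x => (key x).1, fun x => (key x).2⟩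

end Projection

/-! ### Derivatives in charts -/

section Charts

variable [IsManifold (𝓡 2) ∞ M] {e : OpenPartialHomeomorph M (EuclideanSpace ℝ (Fin 2))}

lemma contDiffOn_comp_symm
    (he : e ∈ atlas (EuclideanSpace ℝ (Fin 2)) M) {h : M → R42}
    (hh : ContMDiff (𝓡 2) 𝓘(ℝ, R42) ∞ h) : ContDiffOn ℝ ∞ (h ∘ e.symm) e.target := by
  rw [← contMDiffOn_iff_contDiffOn]
  exact hh.comp_contMDiffOn
    (contMDiffOn_symm_of_mem_maximalAtlas (IsManifold.subset_maximalAtlas he))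

lemma deriv42_mfderiv_symm (he : e ∈ atlas (EuclideanSpace ℝ (Fin 2)) M) {h : M → R42}
    (hh : ContMDiff (𝓡 2) 𝓘(ℝ, R42) ∞ h) {y : EuclideanSpace ℝ (Fin 2)} (hy : y ∈ e.target) :
    (deriv42 h (e.symm y)).comp (mfderiv (𝓡 2) (𝓡 2) e.symm y) = fderiv ℝ (h ∘ e.symm) y := by
  have : IsManifold (𝓡 2) 1 M := IsManifold.of_le (n := ∞) (by simp)
  rw [← mfderiv_eq_fderiv]
  exact (mfderiv_comp y ((hh.mdifferentiable (by simp)) _)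
    (mdifferentiableAt_atlas_symm he hy)).symm

/-- The derivative of a chart inverts that of its inverse. Pointwise identities may therefore be
checked on coordinate vectors, where second derivatives are available. -/
lemma exists_eq_mfderiv_symm (he : e ∈ atlas (EuclideanSpace ℝ (Fin 2)) M)
    {y : EuclideanSpace ℝ (Fin 2)} (hy : y ∈ e.target) (X : TangentSpace (𝓡 2) (e.symm y)) :
    ∃ u : TangentSpace (𝓡 2) y, X = mfderiv (𝓡 2) (𝓡 2) e.symm y u := by
  have : IsManifold (𝓡 2) 1 M := IsManifold.of_le (n := ∞) (by simp)
  have h := (mdifferentiable_of_mem_atlas (I := 𝓡 2) he).symm_comp_deriv (e.map_target hy)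
  rw [e.right_inv hy] at h
  exact ⟨mfderiv (𝓡 2) (𝓡 2) e (e.symm y) X, (DFunLike.congr_fun h X).symm⟩

end Charts

end Surface

/-! ### Differentiated orthogonality relations -/

section Flat

variable {E : Type*} [NormedAddCommGroup E] [NormedSpace ℝ E]

/-- If `(dφ, ψ) = 0` then `(dφ, dψ)` is symmetric. -/
lemma form_fderiv_symm {φ ψ : E → R42} {s : Set E} (hs : IsOpen s) (hφ : ContDiffOn ℝ ∞ φ s)
    (hψ : ContDiffOn ℝ ∞ ψ s) (h : ∀ z ∈ s, ∀ v, form (fderiv ℝ φ z v) (ψ z) = 0) {y : E}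
    (hy : y ∈ s) (u v : E) :
    form (fderiv ℝ φ y u) (fderiv ℝ ψ y v) = form (fderiv ℝ φ y v) (fderiv ℝ ψ y u) := by
  have hφy : ContDiffAt ℝ ∞ φ y := hφ.contDiffAt (hs.mem_nhds hy)
  have hψy : HasFDerivAt ψ (fderiv ℝ ψ y) y :=
    ((hψ.contDiffAt (hs.mem_nhds hy)).differentiableAt (by simp)).hasFDerivAt
  have hD : HasFDerivAt (fderiv ℝ φ) (fderiv ℝ (fderiv ℝ φ) y) y :=
    ((hφy.fderiv_right (m := ∞) (by simp)).differentiableAt (by simp)).hasFDerivAt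
  -- This is the derivative of `(dφ(v), ψ) = 0` in the direction `u`. Its first term is symmetric in
  -- `u, v`, hence so is the second.
  have key : ∀ u v, form (fderiv ℝ (fderiv ℝ φ) y u v) (ψ y) +
      form (fderiv ℝ φ y v) (fderiv ℝ ψ y u) = 0 := by
    intro u v
    have h1 : HasFDerivAt (fun z => fderiv ℝ φ z v)
        ((fderiv ℝ (fderiv ℝ φ) y).flip v) y :=
      (ContinuousLinearMap.apply ℝ R42 v).hasFDerivAt.comp y hD
    have h2 := formL.hasFDerivAt_of_bilinear h1 hψy
    have h3 : (fun z => formL (fderiv ℝ φ z v) (ψ z)) =ᶠ[nhds y] fun _ => 0 := by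
      filter_upwards [hs.mem_nhds hy] with z hz using h z hz v
    have h4 := h2.unique ((hasFDerivAt_const (0 : ℝ) y).congr_of_eventuallyEq h3)
    have h5 := DFunLike.congr_fun h4 u
    simp [formL_apply] at h5
    linarith
  have hsymm : fderiv ℝ (fderiv ℝ φ) y u v = fderiv ℝ (fderiv ℝ φ) y v u :=
    (hφy.isSymmSndFDerivAt (by
      rw [minSmoothness_of_isRCLikeNormedField]; exact WithTop.coe_le_coe.2 (le_top : (2 : ℕ∞) ≤ ⊤))).eq u v
  have k1 := key u v
  have k2 := key v u
  rw [hsymm] at k1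
  linarith

lemma form_fderiv_const {φ : E → R42} {s : Set E} (hs : IsOpen s) (hφ : ContDiffOn ℝ ∞ φ s)
    {v : R42} {k : ℝ} (h : ∀ z ∈ s, form (φ z) v = k) {y : E} (hy : y ∈ s) (u : E) :
    form (fderiv ℝ φ y u) v = 0 := by
  have hφy : HasFDerivAt φ (fderiv ℝ φ y) y :=
    ((hφ.contDiffAt (hs.mem_nhds hy)).differentiableAt (by simp)).hasFDerivAt
  have h2 := (formL.flip v).hasFDerivAt.comp y hφy
  have h3 : ((formL.flip v) ∘ φ) =ᶠ[nhds y] fun _ => k := by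
    filter_upwards [hs.mem_nhds hy] with z hz using h z hz
  have h4 := h2.unique ((hasFDerivAt_const k y).congr_of_eventuallyEq h3)
  exact DFunLike.congr_fun h4 u

end Flat

/-! ### Curvature spheres in terms of `𝔣` and `𝔱` -/

section Surface

variable {M : Type*} [TopologicalSpace M] [ChartedSpace (EuclideanSpace ℝ (Fin 2)) M]
  {f : M → Submodule ℝ R42} {p q : R42} {𝔣 𝔱 : M → R42}

lemma deriv42_congr {σ τ : M → R42} {x : M} (h : σ =ᶠ[nhds x] τ) :
    deriv42 σ x = deriv42 τ x := by
  ext1 X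
  exact DFunLike.congr_fun (h.mfderiv_eq (I := 𝓡 2) (I' := 𝓘(ℝ, R42))) X

lemma finrank_tangentSpace (x : M) : Module.finrank ℝ (TangentSpace (𝓡 2) x) = 2 :=
  finrank_euclideanSpace_fin (𝕜 := ℝ) (n := 2)

/-- The hypotheses on a Legendre map with a projection to a space form, as used below. -/
structure FramedLegendre (f : M → Submodule ℝ R42) (p q : R42) (𝔣 𝔱 : M → R42) : Prop where
  legendre : IsLegendre f
  smooth_f : ContMDiff (𝓡 2) 𝓘(ℝ, R42) ∞ 𝔣
  smooth_t : ContMDiff (𝓡 2) 𝓘(ℝ, R42) ∞ 𝔱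
  frame : ∀ x, NullFrame p q (𝔣 x) (𝔱 x)
  span : ∀ x, f x = Submodule.span ℝ {𝔣 x, 𝔱 x}

lemma IsSpaceFormProjection.framedLegendre (hf : IsLegendre f)
    (hproj : IsSpaceFormProjection f p q 𝔣 𝔱) : FramedLegendre f p q 𝔣 𝔱 :=
  ⟨hf, (hproj.contMDiff hf).1, (hproj.contMDiff hf).2, fun x => (hproj.frame hf x).1,
    fun x => (hproj.frame hf x).2⟩

namespace FramedLegendre

variable (h : FramedLegendre f p q 𝔣 𝔱)
include h

lemma mem_iff {x : M} {v : R42} : v ∈ f x ↔ ∃ r s : ℝ, v = r • 𝔣 x + s • 𝔱 x := by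
  rw [h.span x, Submodule.mem_span_pair]
  simp only [eq_comm]

lemma combination_mem (x : M) (r s : ℝ) : r • 𝔣 x + s • 𝔱 x ∈ f x := h.mem_iff.2 ⟨r, s, rfl⟩

lemma eq_combination {x : M} {v : R42} (hv : v ∈ f x) :
    v = -form v q • 𝔣 x + -form v p • 𝔱 x := by
  obtain ⟨r, s, rfl⟩ := h.mem_iff.1 hv
  have := h.frame x
  simp [this.Fp, this.Fq, this.Tp, this.Tq]

lemma isSection {U : Set M} (hU : IsOpen U) {α β : M → ℝ}
    (hα : ContMDiffOn (𝓡 2) 𝓘(ℝ, ℝ) ∞ α U) (hβ : ContMDiffOn (𝓡 2) 𝓘(ℝ, ℝ) ∞ β U) :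
    IsSection f U (fun y => α y • 𝔣 y + β y • 𝔱 y) :=
  ⟨hU, (hα.smul h.smooth_f.contMDiffOn).add (hβ.smul h.smooth_t.contMDiffOn),
    fun y _ => h.combination_mem y _ _⟩

lemma deriv42_combination {U : Set M} (hU : IsOpen U) {α β : M → ℝ}
    (hα : ContMDiffOn (𝓡 2) 𝓘(ℝ, ℝ) ∞ α U) (hβ : ContMDiffOn (𝓡 2) 𝓘(ℝ, ℝ) ∞ β U)
    {x : M} (hx : x ∈ U) (X : TangentSpace (𝓡 2) x) :
    ∃ r s : ℝ, deriv42 (fun y => α y • 𝔣 y + β y • 𝔱 y) x X =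
      α x • deriv42 𝔣 x X + β x • deriv42 𝔱 x X + (r • 𝔣 x + s • 𝔱 x) := by
  have hα' : MDifferentiableAt (𝓡 2) 𝓘(ℝ, ℝ) α x :=
    (hα.contMDiffAt (hU.mem_nhds hx)).mdifferentiableAt (by simp)
  have hβ' : MDifferentiableAt (𝓡 2) 𝓘(ℝ, ℝ) β x :=
    (hβ.contMDiffAt (hU.mem_nhds hx)).mdifferentiableAt (by simp)
  have h𝔣' : MDifferentiableAt (𝓡 2) 𝓘(ℝ, R42) 𝔣 x := h.smooth_f.mdifferentiable (by simp) x
  have h𝔱' : MDifferentiableAt (𝓡 2) 𝓘(ℝ, R42) 𝔱 x := h.smooth_t.mdifferentiable (by simp) x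
  refine ⟨mvfderiv (𝓡 2) α x X, mvfderiv (𝓡 2) β x X, ?_⟩
  have e : deriv42 (fun y => α y • 𝔣 y + β y • 𝔱 y) x = _ :=
    mvfderiv_add (hα'.smul h𝔣') (hβ'.smul h𝔱')
  rw [e, mvfderiv_fun_smul hα' h𝔣', mvfderiv_fun_smul hβ' h𝔱']
  simp
  abel

lemma deriv42_section {U : Set M} {σ : M → R42} (hσ : IsSection f U σ) {x : M} (hx : x ∈ U)
    (X : TangentSpace (𝓡 2) x) :
    ∃ r s : ℝ, deriv42 σ x X =
      -form (σ x) q • deriv42 𝔣 x X + -form (σ x) p • deriv42 𝔱 x X + (r • 𝔣 x + s • 𝔱 x) := by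
  have e : σ =ᶠ[nhds x] fun y => -form (σ y) q • 𝔣 y + -form (σ y) p • 𝔱 y := by
    filter_upwards [hσ.isOpen.mem_nhds hx] with y hy using h.eq_combination (hσ.mem y hy)
  rw [deriv42_congr e]
  exact h.deriv42_combination hσ.isOpen
    (fun y hy => (contMDiffWithinAt_form (hσ.smooth y hy) contMDiffWithinAt_const).neg)
    (fun y hy => (contMDiffWithinAt_form (hσ.smooth y hy) contMDiffWithinAt_const).neg) hx X

lemma deriv42_mem_perp (x : M) (X : TangentSpace (𝓡 2) x) :
    deriv42 𝔣 x X ∈ perp (f x) ∧ deriv42 𝔱 x X ∈ perp (f x) :=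
  ⟨h.legendre.contact Set.univ 𝔣 ⟨isOpen_univ, h.smooth_f.contMDiffOn, fun y _ => by
    simpa using h.combination_mem y 1 0⟩ x trivial X,
  h.legendre.contact Set.univ 𝔱 ⟨isOpen_univ, h.smooth_t.contMDiffOn, fun y _ => by
    simpa using h.combination_mem y 0 1⟩ x trivial X⟩

/-- Orthogonality to `f` is the contact condition and orthogonality to `𝔭, 𝔮` comes from constant
products. Differentiating `(d𝔣, 𝔱) = 0` gives the symmetry. The kernel condition is the immersion
condition, since modulo `f` the derivative of a section is a combination of `d𝔣, d𝔱`. -/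
lemma contactElement [IsManifold (𝓡 2) ∞ M] (x : M) :
    ContactElement p q (𝔣 x) (𝔱 x) (deriv42 𝔣 x) (deriv42 𝔱 x) := by
  have memF : ∀ y, 𝔣 y ∈ f y := fun y => by simpa using h.combination_mem y 1 0
  have memT : ∀ y, 𝔱 y ∈ f y := fun y => by simpa using h.combination_mem y 0 1
  have main : ∀ e ∈ atlas (EuclideanSpace ℝ (Fin 2)) M, ∀ y ∈ e.target,
      (∀ X, form (deriv42 𝔣 (e.symm y) X) p = 0 ∧ form (deriv42 𝔣 (e.symm y) X) q = 0 ∧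
        form (deriv42 𝔱 (e.symm y) X) p = 0 ∧ form (deriv42 𝔱 (e.symm y) X) q = 0) ∧
      ∀ X Y, form (deriv42 𝔣 (e.symm y) X) (deriv42 𝔱 (e.symm y) Y) =
        form (deriv42 𝔣 (e.symm y) Y) (deriv42 𝔱 (e.symm y) X) := by
    intro e he y hy
    have sf := contDiffOn_comp_symm he h.smooth_f
    have st := contDiffOn_comp_symm he h.smooth_t
    have df : ∀ z ∈ e.target, ∀ u, deriv42 𝔣 (e.symm z) (mfderiv (𝓡 2) (𝓡 2) e.symm z u) =
      fderiv ℝ (𝔣 ∘ e.symm) z u := fun z hz u =>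
        DFunLike.congr_fun (deriv42_mfderiv_symm he h.smooth_f hz) u
    have dt : ∀ z ∈ e.target, ∀ u, deriv42 𝔱 (e.symm z) (mfderiv (𝓡 2) (𝓡 2) e.symm z u) =
      fderiv ℝ (𝔱 ∘ e.symm) z u := fun z hz u =>
        DFunLike.congr_fun (deriv42_mfderiv_symm he h.smooth_t hz) u
    constructor
    · intro X
      obtain ⟨u, rfl⟩ := exists_eq_mfderiv_symm he hy X
      rw [df y hy, dt y hy]
      exact ⟨form_fderiv_const e.open_target sf (fun z _ => (h.frame _).Fp) hy u,
        form_fderiv_const e.open_target sf (fun z _ => (h.frame _).Fq) hy u,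
        form_fderiv_const e.open_target st (fun z _ => (h.frame _).Tp) hy u,
        form_fderiv_const e.open_target st (fun z _ => (h.frame _).Tq) hy u⟩
    · intro X Y
      obtain ⟨u, rfl⟩ := exists_eq_mfderiv_symm he hy X
      obtain ⟨v, rfl⟩ := exists_eq_mfderiv_symm he hy Y
      rw [df y hy, dt y hy, df y hy, dt y hy]
      refine form_fderiv_symm e.open_target sf st (fun z hz v => ?_) hy u v
      rw [form_comm]
      refine (congrArg (form _) (df z hz v).symm).trans ?_
      exact (h.deriv42_mem_perp (e.symm z) _).1 _ (memT _)
  have hx := main (chartAt _ x) (chart_mem_atlas _ x) (chartAt _ x x) (mem_chart_target _ x)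
  rw [(chartAt (EuclideanSpace ℝ (Fin 2)) x).left_inv (mem_chart_source _ x)] at hx
  refine ⟨h.frame x, fun X => ⟨?_, ?_, (hx.1 X).1, (hx.1 X).2.1⟩,
    fun X => ⟨?_, ?_, (hx.1 X).2.2.1, (hx.1 X).2.2.2⟩, hx.2, ?_⟩
  · rw [form_comm]; exact (h.deriv42_mem_perp x X).1 _ (memF x)
  · rw [form_comm]; exact (h.deriv42_mem_perp x X).1 _ (memT x)
  · rw [form_comm]; exact (h.deriv42_mem_perp x X).2 _ (memF x)
  · rw [form_comm]; exact (h.deriv42_mem_perp x X).2 _ (memT x)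
  · intro X hA hB
    refine h.legendre.immersion x X fun U σ hσ hxU => ?_
    obtain ⟨r, s, e⟩ := h.deriv42_section hσ hxU X
    rw [e, hA, hB, smul_zero, smul_zero, zero_add, zero_add]
    exact h.combination_mem x r s

lemma mem_of_screen_add [IsManifold (𝓡 2) ∞ M] {x : M} {α β r s : ℝ} {X : TangentSpace (𝓡 2) x}
    (hm : α • deriv42 𝔣 x X + β • deriv42 𝔱 x X + (r • 𝔣 x + s • 𝔱 x) ∈ f x) :
    α • deriv42 𝔣 x X + β • deriv42 𝔱 x X = 0 := by
  have hc := h.contactElement x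
  obtain ⟨r', s', e⟩ := h.mem_iff.1 hm
  exact (hc.coeff_eq_zero (r := r - r') (s := s - s')
    (add_mem (Submodule.smul_mem _ α (hc.A_mem X)) (Submodule.smul_mem _ β (hc.B_mem X)))
    (by linear_combination (norm := module) e)).2.2

/-- Modulo `f`, the derivative of a section depends only on its value at the point, and the screen
meets `f` trivially. A single section with constant coefficients therefore tests the condition. -/
lemma mem_curvatureSpace_iff [IsManifold (𝓡 2) ∞ M] {x : M} {α β : ℝ}
    {X : TangentSpace (𝓡 2) x} :
    X ∈ curvatureSpace f x (Submodule.span ℝ {α • 𝔣 x + β • 𝔱 x}) ↔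
      α • deriv42 𝔣 x X + β • deriv42 𝔱 x X = 0 := by
  have hc := h.contactElement x
  constructor
  · intro hX
    have hm := hX Set.univ (fun y => α • 𝔣 y + β • 𝔱 y)
      (h.isSection isOpen_univ contMDiffOn_const contMDiffOn_const) trivial
      (Submodule.mem_span_singleton_self _)
    obtain ⟨r, s, e⟩ := h.deriv42_combination isOpen_univ (α := fun _ => α) (β := fun _ => β)
      contMDiffOn_const contMDiffOn_const (Set.mem_univ x) X
    rw [e] at hm
    exact h.mem_of_screen_add hm
  · intro hX U σ hσ hxU hs
    obtain ⟨k, hk⟩ := Submodule.mem_span_singleton.1 hs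
    obtain ⟨r, s, e⟩ := h.deriv42_section hσ hxU X
    have e2 : -form (σ x) q • deriv42 𝔣 x X + -form (σ x) p • deriv42 𝔱 x X = 0 := by
      rw [← hk]
      simp only [map_smul, map_add, LinearMap.smul_apply, LinearMap.add_apply, hc.Fp, hc.Fq,
        hc.Tp, hc.Tq, smul_eq_mul]
      linear_combination (norm := module) k • hX
    rw [e, e2, zero_add]
    exact h.combination_mem x r s

lemma isCurvatureSphere_of_isPrincipal [IsManifold (𝓡 2) ∞ M] {x : M} {α β : ℝ}
    {X : TangentSpace (𝓡 2) x} (hX : IsPrincipal (deriv42 𝔣 x) (deriv42 𝔱 x) α β X) :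
    IsCurvatureSphere f x (Submodule.span ℝ {α • 𝔣 x + β • 𝔱 x}) := by
  refine ⟨?_, finrank_span_singleton ?_, X, h.mem_curvatureSpace_iff.2 hX.eq_zero, hX.ne_zero⟩
  · rw [Submodule.span_singleton_le_iff_mem]
    exact h.combination_mem x α β
  · intro h0
    have := LinearIndependent.pair_iff.1 (h.frame x).linearIndependent α β h0
    have := hX.coeff_ne_zero
    tauto

lemma exists_isPrincipal_of_isCurvatureSphere [IsManifold (𝓡 2) ∞ M] {x : M}
    {s : Submodule ℝ R42} (hs : IsCurvatureSphere f x s) :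
    ∃ α β X, s = Submodule.span ℝ {α • 𝔣 x + β • 𝔱 x} ∧
      IsPrincipal (deriv42 𝔣 x) (deriv42 𝔱 x) α β X := by
  obtain ⟨hle, hrank, X, hX, hX0⟩ := hs
  obtain ⟨v, hv, hv0⟩ := Submodule.exists_mem_ne_zero_of_ne_bot
    (p := s) (by rintro rfl; simp at hrank)
  have hspan : s = Submodule.span ℝ {v} := by
    refine (Submodule.eq_of_le_of_finrank_eq ?_ ?_).symm
    · rwa [Submodule.span_singleton_le_iff_mem]
    · rw [hrank, finrank_span_singleton hv0]
  obtain ⟨α, β, rfl⟩ := h.mem_iff.1 (hle hv)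
  refine ⟨α, β, X, hspan, hX0, ?_, h.mem_curvatureSpace_iff.1 (hspan ▸ hX)⟩
  by_contra hcon
  push Not at hcon
  exact hv0 (by simp [hcon])

lemma span_eq_of_det_eq_zero {x : M} {α₁ β₁ α₂ β₂ : ℝ} (h₁ : α₁ ≠ 0 ∨ β₁ ≠ 0)
    (h₂ : α₂ ≠ 0 ∨ β₂ ≠ 0) :
    Submodule.span ℝ {α₁ • 𝔣 x + β₁ • 𝔱 x} = Submodule.span ℝ {α₂ • 𝔣 x + β₂ • 𝔱 x} ↔
      α₁ * β₂ - α₂ * β₁ = 0 := by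
  have hlin := LinearIndependent.pair_iff.1 (h.frame x).linearIndependent
  constructor
  · intro he
    have hm : α₁ • 𝔣 x + β₁ • 𝔱 x ∈ Submodule.span ℝ {α₂ • 𝔣 x + β₂ • 𝔱 x} := by
      rw [← he]; exact Submodule.mem_span_singleton_self _
    obtain ⟨k, hk⟩ := Submodule.mem_span_singleton.1 hm
    obtain ⟨e1, e2⟩ := hlin (k * α₂ - α₁) (k * β₂ - β₁)
      (by linear_combination (norm := module) hk)
    linear_combination -β₂ * e1 + α₂ * e2
  · intro hD
    have hn : α₂ ^ 2 + β₂ ^ 2 ≠ 0 := by rcases h₂ with h | h <;> positivity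
    set k := (α₁ * α₂ + β₁ * β₂) / (α₂ ^ 2 + β₂ ^ 2) with hk
    have k1 : α₁ = k * α₂ := by
      rw [hk]; field_simp; linear_combination β₂ * hD
    have k2 : β₁ = k * β₂ := by
      rw [hk]; field_simp; linear_combination -α₂ * hD
    have hk0 : k ≠ 0 := by
      intro h0
      rw [h0, zero_mul] at k1 k2
      tauto
    have : α₁ • 𝔣 x + β₁ • 𝔱 x = k • (α₂ • 𝔣 x + β₂ • 𝔱 x) := by rw [k1, k2]; module
    rw [this, Submodule.span_singleton_smul_eq (IsUnit.mk0 k hk0)]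

/-- Being umbilic-free only forbids exactly one curvature sphere. One exists by
`exists_isPrincipal`, so there is a second. -/
lemma exists_principal_pair [IsManifold (𝓡 2) ∞ M] (humb : UmbilicFree f) (x : M) :
    ∃ α₁ β₁ X₁ α₂ β₂ X₂, IsPrincipal (deriv42 𝔣 x) (deriv42 𝔱 x) α₁ β₁ X₁ ∧
      IsPrincipal (deriv42 𝔣 x) (deriv42 𝔱 x) α₂ β₂ X₂ ∧ α₁ * β₂ - α₂ * β₁ ≠ 0 := by
  obtain ⟨α₁, β₁, X₁, h₁⟩ := (h.contactElement x).exists_isPrincipal (finrank_tangentSpace x)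
  by_contra hcon
  refine humb x ⟨_, h.isCurvatureSphere_of_isPrincipal h₁, fun s hs => ?_⟩
  obtain ⟨α₂, β₂, X₂, rfl, h₂⟩ := h.exists_isPrincipal_of_isCurvatureSphere hs
  symm
  rw [h.span_eq_of_det_eq_zero h₁.coeff_ne_zero h₂.coeff_ne_zero]
  by_contra hD
  exact hcon ⟨α₁, β₁, X₁, α₂, β₂, X₂, h₁, h₂, hD⟩

end FramedLegendre

end Surface

/-! ### Smooth choice of curvature spheres and curvature directions -/

lemma contDiff_det : ContDiff ℝ ∞ (fun m : Fin 6 → R42 => Matrix.det (Matrix.of m)) := by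
  simp only [Matrix.det_apply]
  refine ContDiff.sum fun s _ => ContDiff.const_smul _ (contDiff_prod fun i _ => ?_)
  exact contDiff_apply_apply ℝ ℝ (s i) i

section Surface

variable {M : Type*} [TopologicalSpace M] [ChartedSpace (EuclideanSpace ℝ (Fin 2)) M]
  {f : M → Submodule ℝ R42} {p q : R42} {𝔣 𝔱 : M → R42}

lemma contMDiffOn_area {F T u v : M → R42} {s : Set M} (p q : R42)
    (hF : ContMDiffOn (𝓡 2) 𝓘(ℝ, R42) ∞ F s) (hT : ContMDiffOn (𝓡 2) 𝓘(ℝ, R42) ∞ T s)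
    (hu : ContMDiffOn (𝓡 2) 𝓘(ℝ, R42) ∞ u s) (hv : ContMDiffOn (𝓡 2) 𝓘(ℝ, R42) ∞ v s) :
    ContMDiffOn (𝓡 2) 𝓘(ℝ, ℝ) ∞ (fun y => area p q (F y) (T y) (u y) (v y)) s := by
  have hm : ContMDiffOn (𝓡 2) 𝓘(ℝ, Fin 6 → R42) ∞ (fun y => ![u y, v y, F y, T y, p, q]) s := by
    rw [contMDiffOn_pi_space]
    intro i
    fin_cases i
    exacts [hu, hv, hF, hT, contMDiffOn_const, contMDiffOn_const]
  have hd : ContMDiff 𝓘(ℝ, Fin 6 → R42) 𝓘(ℝ, ℝ) ∞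
      (fun m : Fin 6 → R42 => Matrix.det (Matrix.of m)) := contDiff_det.contMDiff
  refine (hd.comp_contMDiffOn hm).congr fun y _ => ?_
  rw [area_apply, Function.comp_apply]

/-- The null lines of `P α² + 2R αβ + S β²` solve a linear system with parameter `l = ε √(R² - PS)`.
It has the solutions `(-R + l, P)` and `(S, -R - l)`, and since `l ≠ 0` one of them is nonzero near
`x`. Keeping the linear equations rather than the null equation records which of the two lines was
chosen. -/
lemma exists_smooth_null_vector {P R S : M → ℝ} {V : Set M} (hV : IsOpen V)
    (hP : ContMDiffOn (𝓡 2) 𝓘(ℝ, ℝ) ∞ P V) (hR : ContMDiffOn (𝓡 2) 𝓘(ℝ, ℝ) ∞ R V)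
    (hS : ContMDiffOn (𝓡 2) 𝓘(ℝ, ℝ) ∞ S V) (hdisc : ∀ y ∈ V, 0 < R y ^ 2 - P y * S y)
    {x : M} (hx : x ∈ V) {ε : ℝ} (hε : ε ^ 2 = 1) :
    ∃ (W : Set M) (α β : M → ℝ), IsOpen W ∧ x ∈ W ∧ W ⊆ V ∧
      ContMDiffOn (𝓡 2) 𝓘(ℝ, ℝ) ∞ α W ∧ ContMDiffOn (𝓡 2) 𝓘(ℝ, ℝ) ∞ β W ∧
      ∀ y ∈ W, (α y ≠ 0 ∨ β y ≠ 0) ∧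
        P y * α y + R y * β y = ε * √(R y ^ 2 - P y * S y) * β y ∧
        R y * α y + S y * β y = -(ε * √(R y ^ 2 - P y * S y)) * α y := by
  have hd : ContMDiffOn (𝓡 2) 𝓘(ℝ, ℝ) ∞ (fun y => R y ^ 2 - P y * S y) V :=
    (hR.pow 2).sub (hP.mul hS)
  have hl : ContMDiffOn (𝓡 2) 𝓘(ℝ, ℝ) ∞ (fun y => ε * √(R y ^ 2 - P y * S y)) V := by
    refine contMDiffOn_const.mul fun y hy => ?_
    exact (Real.contDiffAt_sqrt (hdisc y hy).ne').contMDiffAt.comp_contMDiffWithinAt y (hd y hy)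
  have hsq : ∀ y ∈ V, (ε * √(R y ^ 2 - P y * S y)) ^ 2 = R y ^ 2 - P y * S y := fun y hy => by
    rw [mul_pow, hε, Real.sq_sqrt (hdisc y hy).le, one_mul]
  set l : M → ℝ := fun y => ε * √(R y ^ 2 - P y * S y) with hldef
  have hlx : l x ≠ 0 := fun h0 => by
    have h1 := hsq x hx
    have h2 := hdisc x hx
    change l x ^ 2 = _ at h1
    rw [h0] at h1
    linarith
  by_cases hc : -R x + l x = 0
  · have hc' : -R x - l x ≠ 0 := fun h0 => hlx (by linarith)
    have hg : ContMDiffOn (𝓡 2) 𝓘(ℝ, ℝ) ∞ (fun y => -R y - l y) V := hR.neg.sub hl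
    refine ⟨V ∩ (fun y => -R y - l y) ⁻¹' {0}ᶜ, S, fun y => -R y - l y,
      hg.continuousOn.isOpen_inter_preimage hV isOpen_compl_singleton, ⟨hx, hc'⟩,
      Set.inter_subset_left, hS.mono Set.inter_subset_left, hg.mono Set.inter_subset_left,
      fun y hy => ⟨Or.inr hy.2, ?_, ?_⟩⟩
    · have := hsq y hy.1
      change P y * S y + R y * (-R y - l y) = l y * (-R y - l y)
      change l y ^ 2 = _ at this
      linear_combination this
    · change R y * S y + S y * (-R y - l y) = -l y * S y
      ring
  · have hg : ContMDiffOn (𝓡 2) 𝓘(ℝ, ℝ) ∞ (fun y => -R y + l y) V := hR.neg.add hl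
    refine ⟨V ∩ (fun y => -R y + l y) ⁻¹' {0}ᶜ, fun y => -R y + l y, P,
      hg.continuousOn.isOpen_inter_preimage hV isOpen_compl_singleton, ⟨hx, hc⟩,
      Set.inter_subset_left, hg.mono Set.inter_subset_left, hP.mono Set.inter_subset_left,
      fun y hy => ⟨Or.inl hy.2, ?_, ?_⟩⟩
    · change P y * (-R y + l y) + R y * P y = l y * P y
      ring
    · have := hsq y hy.1
      change R y * (-R y + l y) + S y * P y = -l y * (-R y + l y)
      change l y ^ 2 = _ at this
      linear_combination this

variable [IsManifold (𝓡 2) ∞ M]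

lemma contMDiffOn_dirDeriv {g : M → R42} (hg : ContMDiff (𝓡 2) 𝓘(ℝ, R42) ∞ g)
    {X : (x : M) → TangentSpace (𝓡 2) x} {s : Set M}
    (hX : ContMDiffOn (𝓡 2) (𝓡 2).tangent ∞ (fun y => (⟨y, X y⟩ : TangentBundle (𝓡 2) M)) s) :
    ContMDiffOn (𝓡 2) 𝓘(ℝ, R42) ∞ (dirDeriv X g) s := by
  have h1 := (hg.contMDiff_tangentMap (m := ∞) (by simp)).comp_contMDiffOn hX
  exact (contMDiff_snd_tangentBundle_modelSpace R42 𝓘(ℝ, R42)).comp_contMDiffOn h1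

lemma exists_tangent_frame (x : M) :
    ∃ (V : Set M) (E₁ E₂ : (x : M) → TangentSpace (𝓡 2) x), IsOpen V ∧ x ∈ V ∧
      ContMDiffOn (𝓡 2) (𝓡 2).tangent ∞ (fun y => (⟨y, E₁ y⟩ : TangentBundle (𝓡 2) M)) V ∧
      ContMDiffOn (𝓡 2) (𝓡 2).tangent ∞ (fun y => (⟨y, E₂ y⟩ : TangentBundle (𝓡 2) M)) V ∧
      ∀ y ∈ V, LinearIndependent ℝ ![E₁ y, E₂ y] := by
  let e := trivializationAt (EuclideanSpace ℝ (Fin 2)) (TangentSpace (𝓡 2) : M → Type _) x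
  let b := (EuclideanSpace.basisFun (Fin 2) ℝ).toBasis
  have hfr := e.isLocalFrameOn_localFrame_baseSet (𝓡 2) ∞ b
  refine ⟨e.baseSet, e.localFrame b 0, e.localFrame b 1, e.open_baseSet,
    FiberBundle.mem_baseSet_trivializationAt' x, hfr.contMDiffOn 0, hfr.contMDiffOn 1,
    fun y hy => ?_⟩
  have := hfr.linearIndependent hy
  have hfun : (fun i => e.localFrame b i y) = ![e.localFrame b 0 y, e.localFrame b 1 y] := by
    ext i : 1
    fin_cases i <;> rfl
  rw [hfun] at this
  exact this

namespace FramedLegendre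

variable (h : FramedLegendre f p q 𝔣 𝔱)
include h

/-- The images `L₁, L₂` of the frame under `α d𝔣 + β d𝔱` are dependent but not both zero at `x`. If
the `j`-th coordinate detects this, then `L₂ʲ E₁ - L₁ʲ E₂` is a smooth kernel field that is nonzero
near `x`. -/
lemma exists_smooth_principal_of_null {W : Set M} (hW : IsOpen W) {x : M} (hx : x ∈ W)
    {E₁ E₂ : (x : M) → TangentSpace (𝓡 2) x}
    (hE₁ : ContMDiffOn (𝓡 2) (𝓡 2).tangent ∞ (fun y => (⟨y, E₁ y⟩ : TangentBundle (𝓡 2) M)) W)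
    (hE₂ : ContMDiffOn (𝓡 2) (𝓡 2).tangent ∞ (fun y => (⟨y, E₂ y⟩ : TangentBundle (𝓡 2) M)) W)
    (hE : ∀ y ∈ W, LinearIndependent ℝ ![E₁ y, E₂ y]) {α β : M → ℝ}
    (hα : ContMDiffOn (𝓡 2) 𝓘(ℝ, ℝ) ∞ α W) (hβ : ContMDiffOn (𝓡 2) 𝓘(ℝ, ℝ) ∞ β W)
    (hαβ : ∀ y ∈ W, α y ≠ 0 ∨ β y ≠ 0)
    (hnull : ∀ y ∈ W, area p q (𝔣 y) (𝔱 y)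
      (α y • deriv42 𝔣 y (E₁ y) + β y • deriv42 𝔱 y (E₁ y))
      (α y • deriv42 𝔣 y (E₂ y) + β y • deriv42 𝔱 y (E₂ y)) = 0)
    (hne : ∃ X, α x • deriv42 𝔣 x X + β x • deriv42 𝔱 x X ≠ 0) :
    ∃ (W' : Set M) (X : (x : M) → TangentSpace (𝓡 2) x), IsOpen W' ∧ x ∈ W' ∧ W' ⊆ W ∧
      ContMDiffOn (𝓡 2) (𝓡 2).tangent ∞ (fun y => (⟨y, X y⟩ : TangentBundle (𝓡 2) M)) W' ∧
      ∀ y ∈ W', IsPrincipal (deriv42 𝔣 y) (deriv42 𝔱 y) (α y) (β y) (X y) := by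
  set L₁ : M → R42 := fun y => α y • deriv42 𝔣 y (E₁ y) + β y • deriv42 𝔱 y (E₁ y) with hL₁
  set L₂ : M → R42 := fun y => α y • deriv42 𝔣 y (E₂ y) + β y • deriv42 𝔱 y (E₂ y) with hL₂
  have sL₁ : ContMDiffOn (𝓡 2) 𝓘(ℝ, R42) ∞ L₁ W :=
    (hα.smul (contMDiffOn_dirDeriv h.smooth_f hE₁)).add
      (hβ.smul (contMDiffOn_dirDeriv h.smooth_t hE₁))
  have sL₂ : ContMDiffOn (𝓡 2) 𝓘(ℝ, R42) ∞ L₂ W :=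
    (hα.smul (contMDiffOn_dirDeriv h.smooth_f hE₂)).add
      (hβ.smul (contMDiffOn_dirDeriv h.smooth_t hE₂))
  have hj : ∃ j, ![L₂ x j, -L₁ x j] ≠ 0 := by
    by_contra hcon
    push Not at hcon
    obtain ⟨X, hX⟩ := hne
    obtain ⟨r, s, rfl⟩ := exists_eq_smul_add_smul (finrank_tangentSpace x) (hE x hx) X
    have z2 : L₂ x = 0 := by ext j; simpa using congrFun (hcon j) 0
    have z1 : L₁ x = 0 := by ext j; simpa using congrFun (hcon j) 1
    apply hX
    have : α x • deriv42 𝔣 x (r • E₁ x + s • E₂ x) + β x • deriv42 𝔱 x (r • E₁ x + s • E₂ x) =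
        r • L₁ x + s • L₂ x := by
      simp only [hL₁, hL₂, map_add, map_smul]; module
    rw [this, z1, z2, smul_zero, smul_zero, add_zero]
  obtain ⟨j, hj⟩ := hj
  have cL₁ : ContMDiffOn (𝓡 2) 𝓘(ℝ, ℝ) ∞ (fun y => -L₁ y j) W :=
    (contMDiffOn_pi_space.1 sL₁ j).neg
  have cL₂ : ContMDiffOn (𝓡 2) 𝓘(ℝ, ℝ) ∞ (fun y => L₂ y j) W := contMDiffOn_pi_space.1 sL₂ j
  have cc : ContinuousOn (fun y => ![L₂ y j, -L₁ y j]) W := by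
    rw [continuousOn_pi]
    intro i
    fin_cases i
    exacts [cL₂.continuousOn, cL₁.continuousOn]
  refine ⟨W ∩ (fun y => ![L₂ y j, -L₁ y j]) ⁻¹' {0}ᶜ, fun y => L₂ y j • E₁ y + -L₁ y j • E₂ y,
    cc.isOpen_inter_preimage hW isOpen_compl_singleton, ⟨hx, hj⟩, Set.inter_subset_left,
    ((cL₂.smul_section hE₁).add_section (cL₁.smul_section hE₂)).mono Set.inter_subset_left, ?_⟩
  rintro y ⟨hy, hy0⟩
  refine ⟨fun h0 => hy0 ?_, hαβ y hy, ?_⟩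
  · obtain ⟨z1, z2⟩ := LinearIndependent.pair_iff.1 (hE y hy) _ _ h0
    simp [z1, z2]
  · have hc := h.contactElement y
    have mem : ∀ X, α y • deriv42 𝔣 y X + β y • deriv42 𝔱 y X ∈ screen p q (𝔣 y) (𝔱 y) := fun X =>
      add_mem (Submodule.smul_mem _ _ (hc.A_mem X)) (Submodule.smul_mem _ _ (hc.B_mem X))
    obtain ⟨r, s, hrs, h0⟩ := hc.dependent_of_area_eq_zero (mem _) (mem _) (hnull y hy)
    change r • L₁ y + s • L₂ y = 0 at h0
    have h0j : r * L₁ y j + s * L₂ y j = 0 := by simpa using congrFun h0 j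
    have goal : L₂ y j • L₁ y - L₁ y j • L₂ y = 0 := by
      rcases hrs with hr | hs
      · refine smul_right_injective _ hr ?_
        simp only [smul_zero]
        linear_combination (norm := module) L₂ y j • h0 - h0j • L₂ y
      · refine smul_right_injective _ hs ?_
        simp only [smul_zero]
        linear_combination (norm := module) -L₁ y j • h0 + h0j • L₁ y
    rw [← goal]
    simp only [hL₁, hL₂, map_add, map_smul]
    module

/-- Smooth coefficients `αᵢ, βᵢ` of the curvature spheres `⟨αᵢ 𝔣 + βᵢ 𝔱⟩` and smooth curvature
directions, near any point of an umbilic-free Legendre map. -/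
lemma exists_smooth_principal_pair (humb : UmbilicFree f) (x : M) :
    ∃ (W : Set M) (α₁ β₁ α₂ β₂ : M → ℝ) (X₁ X₂ : (x : M) → TangentSpace (𝓡 2) x),
      IsOpen W ∧ x ∈ W ∧
      ContMDiffOn (𝓡 2) 𝓘(ℝ, ℝ) ∞ α₁ W ∧ ContMDiffOn (𝓡 2) 𝓘(ℝ, ℝ) ∞ β₁ W ∧
      ContMDiffOn (𝓡 2) 𝓘(ℝ, ℝ) ∞ α₂ W ∧ ContMDiffOn (𝓡 2) 𝓘(ℝ, ℝ) ∞ β₂ W ∧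
      ContMDiffOn (𝓡 2) (𝓡 2).tangent ∞ (fun y => (⟨y, X₁ y⟩ : TangentBundle (𝓡 2) M)) W ∧
      ContMDiffOn (𝓡 2) (𝓡 2).tangent ∞ (fun y => (⟨y, X₂ y⟩ : TangentBundle (𝓡 2) M)) W ∧
      ∀ y ∈ W, IsPrincipal (deriv42 𝔣 y) (deriv42 𝔱 y) (α₁ y) (β₁ y) (X₁ y) ∧
        IsPrincipal (deriv42 𝔣 y) (deriv42 𝔱 y) (α₂ y) (β₂ y) (X₂ y) ∧
        α₁ y * β₂ y - α₂ y * β₁ y ≠ 0 := by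
  obtain ⟨V, E₁, E₂, hV, hxV, sE₁, sE₂, hE⟩ := exists_tangent_frame x
  have sf : ContMDiffOn (𝓡 2) 𝓘(ℝ, R42) ∞ 𝔣 V := h.smooth_f.contMDiffOn
  have st : ContMDiffOn (𝓡 2) 𝓘(ℝ, R42) ∞ 𝔱 V := h.smooth_t.contMDiffOn
  have su₁ := contMDiffOn_dirDeriv h.smooth_f sE₁
  have su₂ := contMDiffOn_dirDeriv h.smooth_f sE₂
  have sv₁ := contMDiffOn_dirDeriv h.smooth_t sE₁
  have sv₂ := contMDiffOn_dirDeriv h.smooth_t sE₂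
  set P : M → ℝ := fun y =>
    area p q (𝔣 y) (𝔱 y) (deriv42 𝔣 y (E₁ y)) (deriv42 𝔣 y (E₂ y)) with hP
  set R : M → ℝ := fun y =>
    (area p q (𝔣 y) (𝔱 y) (deriv42 𝔣 y (E₁ y)) (deriv42 𝔱 y (E₂ y)) +
      area p q (𝔣 y) (𝔱 y) (deriv42 𝔱 y (E₁ y)) (deriv42 𝔣 y (E₂ y))) / 2 with hR
  set S : M → ℝ := fun y =>
    area p q (𝔣 y) (𝔱 y) (deriv42 𝔱 y (E₁ y)) (deriv42 𝔱 y (E₂ y)) with hS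
  have sP : ContMDiffOn (𝓡 2) 𝓘(ℝ, ℝ) ∞ P V := contMDiffOn_area p q sf st su₁ su₂
  have sS : ContMDiffOn (𝓡 2) 𝓘(ℝ, ℝ) ∞ S V := contMDiffOn_area p q sf st sv₁ sv₂
  have sR : ContMDiffOn (𝓡 2) 𝓘(ℝ, ℝ) ∞ R V :=
    ((contMDiffOn_area p q sf st su₁ sv₂).add (contMDiffOn_area p q sf st sv₁ su₂)).div_const 2
  have hdisc : ∀ y ∈ V, 0 < R y ^ 2 - P y * S y := fun y hy => by
    obtain ⟨α₁, β₁, X₁, α₂, β₂, X₂, h₁, h₂, hD⟩ := h.exists_principal_pair humb y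
    exact (h.contactElement y).discriminant_pos (finrank_tangentSpace y) h₁ h₂ hD (hE y hy)
  have key : ∀ ε : ℝ, ε ^ 2 = 1 → ∃ (W : Set M) (α β : M → ℝ)
      (X : (x : M) → TangentSpace (𝓡 2) x), IsOpen W ∧ x ∈ W ∧ W ⊆ V ∧
      ContMDiffOn (𝓡 2) 𝓘(ℝ, ℝ) ∞ α W ∧ ContMDiffOn (𝓡 2) 𝓘(ℝ, ℝ) ∞ β W ∧
      ContMDiffOn (𝓡 2) (𝓡 2).tangent ∞ (fun y => (⟨y, X y⟩ : TangentBundle (𝓡 2) M)) W ∧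
      ∀ y ∈ W, IsPrincipal (deriv42 𝔣 y) (deriv42 𝔱 y) (α y) (β y) (X y) ∧
        P y * α y + R y * β y = ε * √(R y ^ 2 - P y * S y) * β y ∧
        R y * α y + S y * β y = -(ε * √(R y ^ 2 - P y * S y)) * α y := by
    intro ε hε
    obtain ⟨W, α, β, hW, hxW, hWV, sα, sβ, hαβ⟩ :=
      exists_smooth_null_vector hV sP sR sS hdisc hxV hε
    obtain ⟨α₁, β₁, X₁, α₂, β₂, X₂, h₁, h₂, hD⟩ := h.exists_principal_pair humb x
    have hnull : ∀ y ∈ W, area p q (𝔣 y) (𝔱 y)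
        (α y • deriv42 𝔣 y (E₁ y) + β y • deriv42 𝔱 y (E₁ y))
        (α y • deriv42 𝔣 y (E₂ y) + β y • deriv42 𝔱 y (E₂ y)) = 0 := by
      intro y hy
      obtain ⟨-, e1, e2⟩ := hαβ y hy
      have : P y * α y ^ 2 + 2 * R y * α y * β y + S y * β y ^ 2 = 0 := by
        linear_combination α y * e1 + β y * e2
      rw [← this]
      simp only [hP, hR, hS, map_add, map_smul, LinearMap.add_apply, LinearMap.smul_apply,
        smul_eq_mul]
      ring
    obtain ⟨W', X, hW', hxW', hW'W, sX, hX⟩ := h.exists_smooth_principal_of_null hW hxW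
      (sE₁.mono hWV) (sE₂.mono hWV) (fun y hy => hE y (hWV hy)) sα sβ (fun y hy => (hαβ y hy).1)
      hnull ((h.contactElement x).exists_pencil_ne_zero h₁ h₂ hD (hαβ x hxW).1)
    exact ⟨W', α, β, X, hW', hxW', hW'W.trans hWV, sα.mono hW'W, sβ.mono hW'W, sX,
      fun y hy => ⟨hX y hy, (hαβ y (hW'W hy)).2⟩⟩
  obtain ⟨W₁, α₁, β₁, X₁, hW₁, hx₁, hV₁, sα₁, sβ₁, sX₁, h₁⟩ := key 1 (by norm_num)
  obtain ⟨W₂, α₂, β₂, X₂, hW₂, hx₂, hV₂, sα₂, sβ₂, sX₂, h₂⟩ := key (-1) (by norm_num)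
  refine ⟨W₁ ∩ W₂, α₁, β₁, α₂, β₂, X₁, X₂, hW₁.inter hW₂, ⟨hx₁, hx₂⟩,
    sα₁.mono Set.inter_subset_left, sβ₁.mono Set.inter_subset_left,
    sα₂.mono Set.inter_subset_right, sβ₂.mono Set.inter_subset_right,
    sX₁.mono Set.inter_subset_left, sX₂.mono Set.inter_subset_right, ?_⟩
  rintro y ⟨hy₁, hy₂⟩
  obtain ⟨p₁, e₁, e₁'⟩ := h₁ y hy₁
  obtain ⟨p₂, e₂, e₂'⟩ := h₂ y hy₂
  refine ⟨p₁, p₂, fun hD => ?_⟩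
  have hl : √(R y ^ 2 - P y * S y) ≠ 0 := (Real.sqrt_pos.2 (hdisc y (hV₁ hy₁))).ne'
  -- The two branches carry opposite square roots. If they gave the same line, eliminating between
  -- the two systems would force `β₁β₂ = 0` and `α₁α₂ = 0`, which is incompatible with proportional
  -- nonzero vectors.
  have z1 : β₁ y * β₂ y = 0 := by
    refine (mul_eq_zero.1 (?_ : √(R y ^ 2 - P y * S y) * (β₁ y * β₂ y) = 0)).resolve_left hl
    linear_combination (P y * hD - β₂ y * e₁ + β₁ y * e₂) / 2
  have z2 : α₁ y * α₂ y = 0 := by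
    refine (mul_eq_zero.1 (?_ : √(R y ^ 2 - P y * S y) * (α₁ y * α₂ y) = 0)).resolve_left hl
    linear_combination (S y * hD + α₂ y * e₁' - α₁ y * e₂') / 2
  have c1 := p₁.coeff_ne_zero
  have c2 := p₂.coeff_ne_zero
  rcases mul_eq_zero.1 z1 with z | z <;> rcases mul_eq_zero.1 z2 with w | w <;>
    simp [z, w] at c1 c2 hD <;> tauto

end FramedLegendre

end Surface

/-! ### Exterior derivative of the Weingarten form -/

section Flat

variable {E V W G : Type*} [NormedAddCommGroup E] [NormedSpace ℝ E] [NormedAddCommGroup V]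
  [NormedSpace ℝ V] [NormedAddCommGroup W] [NormedSpace ℝ W] [NormedAddCommGroup G]
  [NormedSpace ℝ G] {φ : E → V} {ψ : E → W} {s : Set E}

lemma contDiffOn_bilinear_fderiv (L : V →L[ℝ] W →L[ℝ] G) (hs : IsOpen s)
    (hφ : ContDiffOn ℝ ∞ φ s) (hψ : ContDiffOn ℝ ∞ ψ s) :
    ContDiffOn ℝ ∞ (fun y => (L (φ y)).comp (fderiv ℝ ψ y)) s :=
  (L.contDiff.comp_contDiffOn hφ).clm_comp (hψ.fderiv_of_isOpen hs (by simp))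

/-- The exterior derivative of the one-form `L(φ, dψ)` is `L(dφ ∧ dψ)`. -/
lemma fderiv_bilinear_fderiv (L : V →L[ℝ] W →L[ℝ] G) (hs : IsOpen s)
    (hφ : ContDiffOn ℝ ∞ φ s) (hψ : ContDiffOn ℝ ∞ ψ s) {y : E} (hy : y ∈ s) (u v : E) :
    fderiv ℝ (fun y => (L (φ y)).comp (fderiv ℝ ψ y)) y u v -
        fderiv ℝ (fun y => (L (φ y)).comp (fderiv ℝ ψ y)) y v u =
      L (fderiv ℝ φ y u) (fderiv ℝ ψ y v) - L (fderiv ℝ φ y v) (fderiv ℝ ψ y u) := by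
  have hψy : ContDiffAt ℝ ∞ ψ y := hψ.contDiffAt (hs.mem_nhds hy)
  have hφy : HasFDerivAt φ (fderiv ℝ φ y) y :=
    ((hφ.contDiffAt (hs.mem_nhds hy)).differentiableAt (by simp)).hasFDerivAt
  have hD : HasFDerivAt (fderiv ℝ ψ) (fderiv ℝ (fderiv ℝ ψ) y) y :=
    ((hψy.fderiv_right (m := ∞) (by simp)).differentiableAt (by simp)).hasFDerivAt
  have h1 : HasFDerivAt (fun z => L (φ z)) (L.comp (fderiv ℝ φ y)) y :=
    L.hasFDerivAt.comp y hφy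
  have hsymm : fderiv ℝ (fderiv ℝ ψ) y u v = fderiv ℝ (fderiv ℝ ψ) y v u :=
    (hψy.isSymmSndFDerivAt (by
      rw [minSmoothness_of_isRCLikeNormedField]
      exact WithTop.coe_le_coe.2 (le_top : (2 : ℕ∞) ≤ ⊤))).eq u v
  rw [(h1.clm_comp hD).fderiv]
  simp [hsymm]

lemma fderiv_combination {g₁ g₂ g₃ g₄ : E → G} {y : E} (h₁ : DifferentiableAt ℝ g₁ y)
    (h₂ : DifferentiableAt ℝ g₂ y) (h₃ : DifferentiableAt ℝ g₃ y) (h₄ : DifferentiableAt ℝ g₄ y)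
    (a b c : ℝ) :
    fderiv ℝ (c • g₁ - b • (g₂ + g₃) + a • g₄) y =
      c • fderiv ℝ g₁ y - b • (fderiv ℝ g₂ y + fderiv ℝ g₃ y) + a • fderiv ℝ g₄ y :=
  (((h₁.hasFDerivAt.const_smul c).sub ((h₂.hasFDerivAt.add h₃.hasFDerivAt).const_smul b)).add
    (h₄.hasFDerivAt.const_smul a)).fderiv

end Flat

section Surface

/-- The one-form `φ ∧ dψ` on a normed space. -/
def flatWedge {E : Type*} [NormedAddCommGroup E] [NormedSpace ℝ E] (φ ψ : E → R42) :
    E → E →L[ℝ] EndR42 :=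
  fun y => (wedgeL (φ y)).comp (fderiv ℝ ψ y)

section FlatWedge

variable {E : Type*} [NormedAddCommGroup E] [NormedSpace ℝ E] {φ ψ : E → R42} {s : Set E}

lemma contDiffOn_flatWedge (hs : IsOpen s) (hφ : ContDiffOn ℝ ∞ φ s) (hψ : ContDiffOn ℝ ∞ ψ s) :
    ContDiffOn ℝ ∞ (flatWedge φ ψ) s :=
  contDiffOn_bilinear_fderiv wedgeL hs hφ hψ

lemma fderiv_flatWedge (hs : IsOpen s) (hφ : ContDiffOn ℝ ∞ φ s) (hψ : ContDiffOn ℝ ∞ ψ s)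
    {y : E} (hy : y ∈ s) (u v : E) :
    fderiv ℝ (flatWedge φ ψ) y u v - fderiv ℝ (flatWedge φ ψ) y v u =
      wedge (fderiv ℝ φ y u) (fderiv ℝ ψ y v) - wedge (fderiv ℝ φ y v) (fderiv ℝ ψ y u) :=
  fderiv_bilinear_fderiv wedgeL hs hφ hψ hy u v

/-- The factor `2` arises because antisymmetrizing in `u, v` meets the skewness of `∧`; for the
mixed terms this needs the symmetric sum `φ ∧ dψ + ψ ∧ dφ`. -/
lemma fderiv_flatWedge_combination (hs : IsOpen s) (hφ : ContDiffOn ℝ ∞ φ s)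
    (hψ : ContDiffOn ℝ ∞ ψ s) {y : E} (hy : y ∈ s) (a b c : ℝ) (u v : E) :
    fderiv ℝ (c • flatWedge φ φ - b • (flatWedge φ ψ + flatWedge ψ φ) + a • flatWedge ψ ψ) y u v -
      fderiv ℝ (c • flatWedge φ φ - b • (flatWedge φ ψ + flatWedge ψ φ) + a • flatWedge ψ ψ) y v u =
      (2 : ℝ) • curl (fderiv ℝ φ y) (fderiv ℝ ψ y) a b c u v := by
  have hd : ∀ g : E → E →L[ℝ] EndR42, ContDiffOn ℝ ∞ g s → DifferentiableAt ℝ g y := fun g hg =>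
    (hg.contDiffAt (hs.mem_nhds hy)).differentiableAt (by simp)
  have e := fderiv_combination (E := E) (G := E →L[ℝ] EndR42) (hd _ (contDiffOn_flatWedge hs hφ hφ))
    (hd _ (contDiffOn_flatWedge hs hφ hψ)) (hd _ (contDiffOn_flatWedge hs hψ hφ))
    (hd _ (contDiffOn_flatWedge hs hψ hψ)) a b c
  have e' : ∀ u v, fderiv ℝ
      (c • flatWedge φ φ - b • (flatWedge φ ψ + flatWedge ψ φ) + a • flatWedge ψ ψ) y u v =
      c • fderiv ℝ (flatWedge φ φ) y u v -
        b • (fderiv ℝ (flatWedge φ ψ) y u v + fderiv ℝ (flatWedge ψ φ) y u v) +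
        a • fderiv ℝ (flatWedge ψ ψ) y u v := fun u v =>
    congrArg (fun L : E →L[ℝ] E →L[ℝ] EndR42 => L u v) e
  have k₁ := fderiv_flatWedge hs hφ hφ hy u v
  have k₂ := fderiv_flatWedge hs hφ hψ hy u v
  have k₃ := fderiv_flatWedge hs hψ hφ hy u v
  have k₄ := fderiv_flatWedge hs hψ hψ hy u v
  rw [wedge_swap (fderiv ℝ φ y v) (fderiv ℝ φ y u)] at k₁
  rw [wedge_swap (fderiv ℝ φ y v) (fderiv ℝ ψ y u)] at k₂
  rw [wedge_swap (fderiv ℝ ψ y v) (fderiv ℝ φ y u)] at k₃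
  rw [wedge_swap (fderiv ℝ ψ y v) (fderiv ℝ ψ y u)] at k₄
  rw [e', e', curl]
  linear_combination (norm := module) c • k₁ - b • (k₂ + k₃) + a • k₄

end FlatWedge

variable {M : Type*} [TopologicalSpace M] [ChartedSpace (EuclideanSpace ℝ (Fin 2)) M]
  {f : M → Submodule ℝ R42} {p q : R42} {𝔣 𝔱 : M → R42}

lemma weingartenForm_apply (a b c : ℝ) (x : M) (X : TangentSpace (𝓡 2) x) :
    weingartenForm 𝔣 𝔱 a b c x X =
      potential (𝔣 x) (𝔱 x) (deriv42 𝔣 x) (deriv42 𝔱 x) a b c X := rfl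

lemma weingartenQuadDiff_apply (a b c : ℝ) (x : M) (X Y : TangentSpace (𝓡 2) x) :
    weingartenQuadDiff 𝔣 𝔱 a b c x X Y = quadForm (deriv42 𝔣 x) (deriv42 𝔱 x) a b c X Y := rfl

omit [TopologicalSpace M] [ChartedSpace (EuclideanSpace ℝ (Fin 2)) M] in
lemma polyEval_pair {P : Fin (1 + 1) → M → R42} (t : ℝ) (x : M) :
    polyEval P t x = P 0 x + t • P 1 x := by
  simp [polyEval, Fin.sum_univ_two]

lemma apply_eq_zero_of_mem_wedgeSub {S : Submodule ℝ R42} (hS : S ≤ perp S) {ζ : EndR42}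
    (hζ : ζ ∈ wedgeSub S (perp S)) {v : R42} (hv : v ∈ S) : ζ v = 0 := by
  have hle : wedgeSub S (perp S) ≤ LinearMap.ker
      ((ContinuousLinearMap.apply ℝ R42 v).toLinearMap : EndR42 →ₗ[ℝ] R42) := by
    refine Submodule.map₂_le.2 fun m hm n hn => ?_
    have h1 : form m v = 0 := hS hv m hm
    have h2 : form n v = 0 := by rw [form_comm]; exact hn v hv
    simp [wedge_apply, h1, h2]
  exact hle hζ

namespace FramedLegendre

variable (h : FramedLegendre f p q 𝔣 𝔱)
include h

section Smooth

variable [IsManifold (𝓡 2) ∞ M] {e : OpenPartialHomeomorph M (EuclideanSpace ℝ (Fin 2))}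
  (he : e ∈ atlas (EuclideanSpace ℝ (Fin 2)) M)
include he

lemma inChart_weingartenForm (a b c : ℝ) {y : EuclideanSpace ℝ (Fin 2)} (hy : y ∈ e.target) :
    inChart (weingartenForm 𝔣 𝔱 a b c) e y =
      (c • flatWedge (𝔣 ∘ e.symm) (𝔣 ∘ e.symm) -
        b • (flatWedge (𝔣 ∘ e.symm) (𝔱 ∘ e.symm) + flatWedge (𝔱 ∘ e.symm) (𝔣 ∘ e.symm)) +
        a • flatWedge (𝔱 ∘ e.symm) (𝔱 ∘ e.symm)) y := by
  ext1 u
  simp only [Pi.add_apply, Pi.sub_apply, Pi.smul_apply, flatWedge,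
    ← deriv42_mfderiv_symm he h.smooth_f hy, ← deriv42_mfderiv_symm he h.smooth_t hy]
  rfl

lemma contDiffOn_inChart (a b c : ℝ) :
    ContDiffOn ℝ ∞ (inChart (weingartenForm 𝔣 𝔱 a b c) e) e.target := by
  have sf := contDiffOn_comp_symm he h.smooth_f
  have st := contDiffOn_comp_symm he h.smooth_t
  have o := e.open_target
  refine ContDiffOn.congr ?_ fun y hy => h.inChart_weingartenForm he a b c hy
  exact (((contDiffOn_flatWedge o sf sf).const_smul c).sub
    (((contDiffOn_flatWedge o sf st).add (contDiffOn_flatWedge o st sf)).const_smul b)).add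
    ((contDiffOn_flatWedge o st st).const_smul a)

lemma fderiv_inChart (a b c : ℝ) {y : EuclideanSpace ℝ (Fin 2)} (hy : y ∈ e.target)
    (u v : TangentSpace (𝓡 2) y) :
    fderiv ℝ (inChart (weingartenForm 𝔣 𝔱 a b c) e) y u v -
        fderiv ℝ (inChart (weingartenForm 𝔣 𝔱 a b c) e) y v u =
      (2 : ℝ) • curl (deriv42 𝔣 (e.symm y)) (deriv42 𝔱 (e.symm y)) a b c
        (mfderiv (𝓡 2) (𝓡 2) e.symm y u) (mfderiv (𝓡 2) (𝓡 2) e.symm y v) := by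
  have sf := contDiffOn_comp_symm he h.smooth_f
  have st := contDiffOn_comp_symm he h.smooth_t
  have o := e.open_target
  have hev : inChart (weingartenForm 𝔣 𝔱 a b c) e =ᶠ[nhds y]
      c • flatWedge (𝔣 ∘ e.symm) (𝔣 ∘ e.symm) -
        b • (flatWedge (𝔣 ∘ e.symm) (𝔱 ∘ e.symm) + flatWedge (𝔱 ∘ e.symm) (𝔣 ∘ e.symm)) +
        a • flatWedge (𝔱 ∘ e.symm) (𝔱 ∘ e.symm) := by
    filter_upwards [o.mem_nhds hy] with z hz using h.inChart_weingartenForm he a b c hz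
  have df : ∀ u, deriv42 𝔣 (e.symm y) (mfderiv (𝓡 2) (𝓡 2) e.symm y u) =
    fderiv ℝ (𝔣 ∘ e.symm) y u := fun u =>
      DFunLike.congr_fun (deriv42_mfderiv_symm he h.smooth_f hy) u
  have dt : ∀ u, deriv42 𝔱 (e.symm y) (mfderiv (𝓡 2) (𝓡 2) e.symm y u) =
    fderiv ℝ (𝔱 ∘ e.symm) y u := fun u =>
      DFunLike.congr_fun (deriv42_mfderiv_symm he h.smooth_t hy) u
  simp only [curl, df, dt]
  rw [hev.fderiv_eq]
  exact fderiv_flatWedge_combination o sf st hy a b c u v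

end Smooth

/-! ### Closedness and the linear Weingarten equation -/

lemma isClosed_iff [IsManifold (𝓡 2) ∞ M] (a b c : ℝ) :
    (weingartenForm 𝔣 𝔱 a b c).IsClosed ↔
      ∀ x X Y, curl (deriv42 𝔣 x) (deriv42 𝔱 x) a b c X Y = 0 := by
  constructor
  · intro hcl
    have main : ∀ e ∈ atlas (EuclideanSpace ℝ (Fin 2)) M, ∀ y ∈ e.target, ∀ X Y,
        curl (deriv42 𝔣 (e.symm y)) (deriv42 𝔱 (e.symm y)) a b c X Y = 0 := by
      intro e he y hy X Y
      obtain ⟨u, rfl⟩ := exists_eq_mfderiv_symm he hy X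
      obtain ⟨v, rfl⟩ := exists_eq_mfderiv_symm he hy Y
      have h1 := h.fderiv_inChart he a b c hy u v
      have h2 := hcl e he y hy u v
      rw [h1, smul_eq_zero_iff_right two_ne_zero] at h2
      exact h2
    intro x
    have hx := main (chartAt _ x) (chart_mem_atlas _ x) (chartAt _ x x) (mem_chart_target _ x)
    rwa [(chartAt (EuclideanSpace ℝ (Fin 2)) x).left_inv (mem_chart_source _ x)] at hx
  · intro hcurl e he y hy u v
    refine (h.fderiv_inChart he a b c hy u v).trans ?_
    rw [hcurl, smul_zero]

omit h in
lemma _root_.LieSphere.IsLinearWeingarten.curl_eq_zero_of_immersesAt {a b c : ℝ}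
    (hw : IsLinearWeingarten 𝔣 𝔱 a b c) {x : M} (hx : ImmersesAt 𝔣 x)
    (X Y : TangentSpace (𝓡 2) x) : curl (deriv42 𝔣 x) (deriv42 𝔱 x) a b c X Y = 0 := by
  obtain ⟨κ₁, κ₂, ⟨Z, hZ, h₁, h₂⟩, hκ⟩ := hw.2 x hx
  have hZ' : LinearIndependent ℝ ![Z 0, Z 1] := by
    have : ![Z 0, Z 1] = Z := by ext i : 1; fin_cases i <;> rfl
    rwa [this]
  obtain ⟨r₁, s₁, rfl⟩ := exists_eq_smul_add_smul (finrank_tangentSpace x) hZ' X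
  obtain ⟨r₂, s₂, rfl⟩ := exists_eq_smul_add_smul (finrank_tangentSpace x) hZ' Y
  rw [curl_smul_add_smul, curl_eq_zero_of_rodrigues h₁ h₂ hκ, smul_zero]

/-- The Weingarten equation is available only where `𝔣` immerses. In a smooth tangent frame `curl`
is continuous, so its zero set is closed there and contains the dense set of such points. -/
lemma curl_eq_zero [IsManifold (𝓡 2) ∞ M] (himm : Dense {x : M | ImmersesAt 𝔣 x}) {a b c : ℝ}
    (hw : IsLinearWeingarten 𝔣 𝔱 a b c) (x : M) (X Y : TangentSpace (𝓡 2) x) :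
    curl (deriv42 𝔣 x) (deriv42 𝔱 x) a b c X Y = 0 := by
  obtain ⟨V, E₁, E₂, hV, hxV, sE₁, sE₂, hE⟩ := exists_tangent_frame x
  have cw : ∀ {u v : M → R42}, ContinuousOn u V → ContinuousOn v V →
      ContinuousOn (fun y => wedge (u y) (v y)) V := fun hu hv =>
    (wedgeL.continuous.comp_continuousOn hu).clm_apply hv
  have cu₁ := (contMDiffOn_dirDeriv h.smooth_f sE₁).continuousOn
  have cu₂ := (contMDiffOn_dirDeriv h.smooth_f sE₂).continuousOn
  have cv₁ := (contMDiffOn_dirDeriv h.smooth_t sE₁).continuousOn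
  have cv₂ := (contMDiffOn_dirDeriv h.smooth_t sE₂).continuousOn
  have hcont : ContinuousOn
      (fun y => curl (deriv42 𝔣 y) (deriv42 𝔱 y) a b c (E₁ y) (E₂ y)) V :=
    (((cw cu₁ cu₂).const_smul c).sub (((cw cu₁ cv₂).add (cw cv₁ cu₂)).const_smul b)).add
      ((cw cv₁ cv₂).const_smul a)
  have hx0 : curl (deriv42 𝔣 x) (deriv42 𝔱 x) a b c (E₁ x) (E₂ x) = 0 := by
    by_contra hne
    obtain ⟨y, ⟨-, hy⟩, hyi⟩ := himm.inter_open_nonempty _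
      (hcont.isOpen_inter_preimage hV isOpen_compl_singleton) ⟨x, hxV, hne⟩
    exact hy (hw.curl_eq_zero_of_immersesAt hyi _ _)
  obtain ⟨r₁, s₁, rfl⟩ := exists_eq_smul_add_smul (finrank_tangentSpace x) (hE x hxV) X
  obtain ⟨r₂, s₂, rfl⟩ := exists_eq_smul_add_smul (finrank_tangentSpace x) (hE x hxV) Y
  rw [curl_smul_add_smul, hx0, smul_zero]

lemma isLinearWeingarten_of_curl [IsManifold (𝓡 2) ∞ M] (humb : UmbilicFree f) {a b c : ℝ}
    (habc : ¬ (a = 0 ∧ b = 0 ∧ c = 0))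
    (hcurl : ∀ x X Y, curl (deriv42 𝔣 x) (deriv42 𝔱 x) a b c X Y = 0) :
    IsLinearWeingarten 𝔣 𝔱 a b c := by
  refine ⟨habc, fun x hx => ?_⟩
  have hc := h.contactElement x
  obtain ⟨α₁, β₁, X₁, α₂, β₂, X₂, h₁, h₂, hD⟩ := h.exists_principal_pair humb x
  have h12 := (hc.curl_eq_zero_iff (finrank_tangentSpace x) h₁ h₂ hD a b c).1 (hcurl x)
  obtain ⟨b₁, r₁⟩ := hc.exists_rodrigues hx h₁
  obtain ⟨b₂, r₂⟩ := hc.exists_rodrigues hx h₂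
  obtain ⟨-, -, -, -, -, -, -, -, -, -, -, hX⟩ := hc.diagonalize h₁ h₂ hD
  refine ⟨α₁ / β₁, α₂ / β₂, ⟨![X₁, X₂], hX, r₁, r₂⟩, ?_⟩
  -- Multiplication by `β₁β₂`, nonzero where `𝔣` immerses, turns the Weingarten expression into the
  -- polarization `h12`.
  rw [← mul_div_cancel_left₀ (a * (α₁ / β₁ * (α₂ / β₂)) + _ + c) (mul_ne_zero b₁ b₂)]
  rw [div_eq_zero_iff]
  left
  rw [← h12, weingartenPolar]
  field_simp
  ring

/-! ### The quadratic differential -/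

lemma isQuadraticDifferential [IsManifold (𝓡 2) ∞ M] (a b c : ℝ) :
    IsQuadraticDifferential f (weingartenForm 𝔣 𝔱 a b c) (weingartenQuadDiff 𝔣 𝔱 a b c) := by
  intro x X Y
  have hc := h.contactElement x
  have memF : 𝔣 x ∈ f x := by simpa using h.combination_mem x 1 0
  have memT : 𝔱 x ∈ f x := by simpa using h.combination_mem x 0 1
  have hlin : LinearIndependent ℝ (![⟨𝔣 x, memF⟩, ⟨𝔱 x, memT⟩] : Fin 2 → f x) := by
    rw [LinearIndependent.pair_iff]
    intro r s hrs
    exact LinearIndependent.pair_iff.1 hc.linearIndependent r s (congrArg Subtype.val hrs)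
  let B := basisOfLinearIndependentOfCardEqFinrank hlin (by simp [h.legendre.rank_two x])
  have B0 : B 0 = ⟨𝔣 x, memF⟩ := by simp [B]
  have B1 : B 1 = ⟨𝔱 x, memT⟩ := by simp [B]
  set v₁ := c • deriv42 𝔣 x X - b • deriv42 𝔱 x X with hv₁
  set v₂ := a • deriv42 𝔱 x X - b • deriv42 𝔣 x X with hv₂
  -- The columns are `η(X) d_Y 𝔣` and `η(X) d_Y 𝔱` in the basis `𝔣, 𝔱`. For a general section, the
  -- part of `d_Y σ` in `f` is killed by `η(X)`.
  refine ⟨Matrix.toLin B B !![-form v₁ (deriv42 𝔣 x Y), -form v₁ (deriv42 𝔱 x Y);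
    -form v₂ (deriv42 𝔣 x Y), -form v₂ (deriv42 𝔱 x Y)], fun U σ hσ hx => ?_, ?_⟩
  · obtain ⟨r, s, e⟩ := h.deriv42_section hσ hx Y
    have hσx : (⟨σ x, hσ.mem x hx⟩ : f x) = -form (σ x) q • B 0 + -form (σ x) p • B 1 := by
      rw [B0, B1]
      exact Subtype.ext (h.eq_combination (hσ.mem x hx))
    obtain ⟨eF, eT, -, -⟩ := hc.potential_apply_frame a b c X
    rw [hσx, e, weingartenForm_apply]
    simp only [map_add, map_smul, Matrix.toLin_self, Fin.sum_univ_two, eF, eT,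
      ContactElement.potential_apply_screen a b c X (hc.A_mem Y),
      ContactElement.potential_apply_screen a b c X (hc.B_mem Y), ← hv₁, ← hv₂]
    simp [B0, B1]
    module
  · rw [Matrix.trace_toLin_eq, Matrix.trace_fin_two_of, weingartenQuadDiff_apply, quadForm, hv₁,
      hv₂]
    simp only [map_sub, map_smul, LinearMap.sub_apply, LinearMap.smul_apply, smul_eq_mul,
      form_comm (deriv42 𝔱 x X) (deriv42 𝔣 x Y)]
    ring

lemma exists_quadDiff_ne_zero [IsManifold (𝓡 2) ∞ M] (humb : UmbilicFree f) {a b c : ℝ}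
    (habc : ¬ (a = 0 ∧ b = 0 ∧ c = 0))
    (hcurl : ∀ x X Y, curl (deriv42 𝔣 x) (deriv42 𝔱 x) a b c X Y = 0) (x : M) :
    ∃ X Y, weingartenQuadDiff 𝔣 𝔱 a b c x X Y ≠ 0 := by
  have hc := h.contactElement x
  obtain ⟨α₁, β₁, X₁, α₂, β₂, X₂, h₁, h₂, hD⟩ := h.exists_principal_pair humb x
  have h12 := (hc.curl_eq_zero_iff (finrank_tangentSpace x) h₁ h₂ hD a b c).1 (hcurl x)
  obtain ⟨g₁, g₂, pos₁, pos₂, e₁, e₂, -⟩ := hc.quadForm_principal h₁ h₂ hD a b c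
  rcases weingartenPolar_ne_zero habc hD h12 with hn | hn
  · exact ⟨X₁, X₁, by
      rw [weingartenQuadDiff_apply, e₁]; exact mul_ne_zero (neg_ne_zero.2 hn) pos₁.ne'⟩
  · exact ⟨X₂, X₂, by
      rw [weingartenQuadDiff_apply, e₂]; exact mul_ne_zero (neg_ne_zero.2 hn) pos₂.ne'⟩

lemma isLieApplicableWith [IsManifold (𝓡 2) ∞ M] [Nonempty M] (humb : UmbilicFree f)
    {a b c : ℝ} (habc : ¬ (a = 0 ∧ b = 0 ∧ c = 0))
    (hcurl : ∀ x X Y, curl (deriv42 𝔣 x) (deriv42 𝔱 x) a b c X Y = 0) :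
    IsLieApplicableWith f (weingartenForm 𝔣 𝔱 a b c) (weingartenQuadDiff 𝔣 𝔱 a b c) where
  smooth := fun _ he => h.contDiffOn_inChart he a b c
  mem := fun x X => by
    rw [h.span x]; exact (h.contactElement x).potential_mem a b c X
  closed := (h.isClosed_iff a b c).2 hcurl
  bracket := fun x X Y => by
    simp only [weingartenForm_apply, (h.contactElement x).potential_bracket, sub_self]
  quadDiff := h.isQuadraticDifferential a b c
  ne_zero := ⟨Classical.arbitrary M, h.exists_quadDiff_ne_zero humb habc hcurl _⟩

/-- In the basis `X₁, X₂` the form is diagonal with entries `-Pᵢ gᵢ`, and with zero polarization the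
Gram identity gives `P₁ P₂ = (ac - b²)(α₁β₂ - α₂β₁)²`. -/
lemma nondegenerateAt_iff [IsManifold (𝓡 2) ∞ M] (humb : UmbilicFree f) {a b c : ℝ}
    (hcurl : ∀ x X Y, curl (deriv42 𝔣 x) (deriv42 𝔱 x) a b c X Y = 0) (x : M) :
    (weingartenQuadDiff 𝔣 𝔱 a b c).NondegenerateAt x ↔ b ^ 2 - a * c ≠ 0 := by
  have hc := h.contactElement x
  obtain ⟨α₁, β₁, X₁, α₂, β₂, X₂, h₁, h₂, hD⟩ := h.exists_principal_pair humb x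
  have h12 := (hc.curl_eq_zero_iff (finrank_tangentSpace x) h₁ h₂ hD a b c).1 (hcurl x)
  obtain ⟨g₁, g₂, pos₁, pos₂, e₁, e₂, e₁₂, -⟩ := hc.quadForm_principal h₁ h₂ hD a b c
  obtain ⟨-, -, -, -, -, -, -, -, -, -, -, hX⟩ := hc.diagonalize h₁ h₂ hD
  have hgram := weingartenPolar_gram a b c α₁ β₁ α₂ β₂
  rw [h12] at hgram
  have hexp : ∀ r₁ s₁ r₂ s₂ : ℝ, weingartenQuadDiff 𝔣 𝔱 a b c x (r₁ • X₁ + s₁ • X₂)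
      (r₂ • X₁ + s₂ • X₂) = -(r₁ * r₂ * (weingartenPolar a b c α₁ β₁ α₁ β₁ * g₁) +
        s₁ * s₂ * (weingartenPolar a b c α₂ β₂ α₂ β₂ * g₂)) := by
    intro r₁ s₁ r₂ s₂
    rw [weingartenQuadDiff_apply, quadForm_smul_add_smul, e₁, e₂, e₁₂]
    ring
  constructor
  · intro hn h0
    have hz : weingartenPolar a b c α₁ β₁ α₁ β₁ * weingartenPolar a b c α₂ β₂ α₂ β₂ = 0 := by
      linear_combination hgram - (α₁ * β₂ - α₂ * β₁) ^ 2 * h0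
    rcases mul_eq_zero.1 hz with hz | hz
    · refine h₁.ne_zero (hn X₁ fun Y => ?_)
      obtain ⟨r, s, rfl⟩ := exists_eq_smul_add_smul (finrank_tangentSpace x) hX Y
      have := hexp 1 0 r s
      simpa [hz] using this
    · refine h₂.ne_zero (hn X₂ fun Y => ?_)
      obtain ⟨r, s, rfl⟩ := exists_eq_smul_add_smul (finrank_tangentSpace x) hX Y
      have := hexp 0 1 r s
      simpa [hz] using this
  · intro hne X hn
    have hz : weingartenPolar a b c α₁ β₁ α₁ β₁ * weingartenPolar a b c α₂ β₂ α₂ β₂ ≠ 0 := by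
      intro hz
      have : (b ^ 2 - a * c) * (α₁ * β₂ - α₂ * β₁) ^ 2 = 0 := by linear_combination hgram - hz
      exact mul_ne_zero hne (pow_ne_zero 2 hD) this
    obtain ⟨r, s, rfl⟩ := exists_eq_smul_add_smul (finrank_tangentSpace x) hX X
    have k1 := hn X₁
    have k2 := hn X₂
    have l1 := hexp r s 1 0
    have l2 := hexp r s 0 1
    simp only [one_smul, zero_smul, add_zero, zero_add, k1, k2] at l1 l2
    have hr : r = 0 := by
      simpa [left_ne_zero_of_mul hz, pos₁.ne'] using l1
    have hs : s = 0 := by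
      simpa [right_ne_zero_of_mul hz, pos₂.ne'] using l2
    simp [hr, hs]

/-! ### Linear conserved quantities -/

lemma deriv42_polyEval {P : Fin (1 + 1) → M → R42} {v : R42} {k l : ℝ} (h0 : ∀ x, P 0 x = v)
    (h1 : ∀ x, P 1 x = k • 𝔣 x + l • 𝔱 x) (t : ℝ) (x : M) (X : TangentSpace (𝓡 2) x) :
    deriv42 (polyEval P t) x X = t • (k • deriv42 𝔣 x X + l • deriv42 𝔱 x X) := by
  have h𝔣' : MDifferentiableAt (𝓡 2) 𝓘(ℝ, R42) 𝔣 x := h.smooth_f.mdifferentiable (by simp) x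
  have h𝔱' : MDifferentiableAt (𝓡 2) 𝓘(ℝ, R42) 𝔱 x := h.smooth_t.mdifferentiable (by simp) x
  have hk : ∀ k : ℝ, MDifferentiableAt (𝓡 2) 𝓘(ℝ, ℝ) (fun _ : M => k) x := fun k =>
    mdifferentiableAt_const
  have e : polyEval P t = fun y => v + ((t * k) • 𝔣 y + (t * l) • 𝔱 y) := by
    funext y
    rw [polyEval_pair, h0, h1]
    module
  have d1 := (hk (t * k)).smul h𝔣'
  have d2 := (hk (t * l)).smul h𝔱'
  have e' : deriv42 (polyEval P t) x = mvfderiv (𝓡 2) (fun _ : M => v) x +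
      mvfderiv (𝓡 2) (fun y => (t * k) • 𝔣 y + (t * l) • 𝔱 y) x := by
    rw [e]
    exact mvfderiv_fun_add mdifferentiableAt_const (d1.add d2)
  have e'' : mvfderiv (𝓡 2) (fun y => (t * k) • 𝔣 y + (t * l) • 𝔱 y) x = _ :=
    mvfderiv_fun_add d1 d2
  have s1 := mvfderiv_fun_smul (hk (t * k)) h𝔣'
  have s2 := mvfderiv_fun_smul (hk (t * l)) h𝔱'
  rw [e', mvfderiv_const, zero_add]
  refine (DFunLike.congr_fun e'' X).trans ?_
  rw [add_apply]
  refine (congrArg₂ (· + ·) (DFunLike.congr_fun s1 X) (DFunLike.congr_fun s2 X)).trans ?_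
  simp [mvfderiv_const]
  module

/-- The linear coefficients lie in `f`, which the potential kills, so no term in `t²` appears. The
terms in `t` cancel by the values of the potential at `𝔭` and `𝔮`. Closedness plays no role. -/
lemma isPolynomialConservedQuantity [IsManifold (𝓡 2) ∞ M] [Nonempty M] (a b c : ℝ) :
    IsPolynomialConservedQuantity (weingartenForm 𝔣 𝔱 a b c) (pointPoly p 𝔣 𝔱 a b) ∧
      IsPolynomialConservedQuantity (weingartenForm 𝔣 𝔱 a b c) (spaceFormPoly q 𝔣 𝔱 b c) := by
  have hx := h.frame (Classical.arbitrary M)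
  refine ⟨⟨?_, ⟨0, Classical.arbitrary M, ?_⟩, fun t x X => ?_⟩,
    ⟨?_, ⟨0, Classical.arbitrary M, ?_⟩, fun t x X => ?_⟩⟩
  · intro k
    fin_cases k
    · exact contMDiff_const
    · have hb : ContMDiff (𝓡 2) 𝓘(ℝ, ℝ) ∞ (fun _ : M => -b) := contMDiff_const
      have ha : ContMDiff (𝓡 2) 𝓘(ℝ, ℝ) ∞ (fun _ : M => a) := contMDiff_const
      exact (hb.smul h.smooth_f).add (ha.smul h.smooth_t)
  · rintro (rfl : p = 0)
    simpa using hx.Tp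
  · obtain ⟨eF, eT, ep, -⟩ := (h.contactElement x).potential_apply_frame a b c X
    rw [h.deriv42_polyEval (fun _ => rfl) (fun _ => rfl), weingartenForm_apply, polyEval_pair]
    simp only [pointPoly, Matrix.cons_val_zero, Matrix.cons_val_one, map_add, map_smul, eF, eT, ep]
    module
  · intro k
    fin_cases k
    · exact contMDiff_const
    · have hc : ContMDiff (𝓡 2) 𝓘(ℝ, ℝ) ∞ (fun _ : M => c) := contMDiff_const
      have hb : ContMDiff (𝓡 2) 𝓘(ℝ, ℝ) ∞ (fun _ : M => b) := contMDiff_const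
      exact (hc.smul h.smooth_f).sub (hb.smul h.smooth_t)
  · rintro (rfl : q = 0)
    simpa using hx.Fq
  · obtain ⟨eF, eT, -, eq⟩ := (h.contactElement x).potential_apply_frame a b c X
    rw [h.deriv42_polyEval (k := c) (l := -b) (fun _ => rfl)
      (fun y => by change c • 𝔣 y - b • 𝔱 y = _; module),
      weingartenForm_apply, polyEval_pair]
    simp only [spaceFormPoly, Matrix.cons_val_zero, Matrix.cons_val_one, map_add, map_sub,
      map_smul, eF, eT, eq]
    module

/-- A one-form with values in `f ∧ f^⊥` for which the two linear polynomials are conserved. -/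
lemma eq_weingartenForm [IsManifold (𝓡 2) ∞ M] {a b c : ℝ} {η : OneForm M}
    (hη : ∀ x X, η x X ∈ wedgeSub (f x) (perp (f x)))
    (hp : IsPolynomialConservedQuantity η (pointPoly p 𝔣 𝔱 a b))
    (hq : IsPolynomialConservedQuantity η (spaceFormPoly q 𝔣 𝔱 b c)) :
    η = weingartenForm 𝔣 𝔱 a b c := by
  funext x
  ext1 X
  have hc := h.contactElement x
  obtain ⟨eF, eT, ep, eq⟩ := hc.potential_apply_frame a b c X
  have hkill : ∀ v ∈ f x, η x X v = 0 := fun v hv => apply_eq_zero_of_mem_wedgeSub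
    (h.legendre.isotropic x) (hη x X) hv
  have hF : η x X (𝔣 x) = 0 := hkill _ (by simpa using h.combination_mem x 1 0)
  have hT : η x X (𝔱 x) = 0 := hkill _ (by simpa using h.combination_mem x 0 1)
  -- The parameter `t = 1` suffices: as `η` kills `f`, the equation is linear in `t` and prescribes
  -- `η 𝔭`, and likewise `η 𝔮` below.
  have hp1 := hp.parallel 1 x X
  rw [h.deriv42_polyEval (fun _ => rfl) (fun _ => rfl), polyEval_pair] at hp1
  simp only [pointPoly, Matrix.cons_val_zero, Matrix.cons_val_one, map_add, map_smul, hF, hT,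
    one_smul, smul_zero, add_zero] at hp1
  have hq1 := hq.parallel 1 x X
  rw [h.deriv42_polyEval (k := c) (l := -b) (fun _ => rfl)
    (fun y => by change c • 𝔣 y - b • 𝔱 y = _; module), polyEval_pair] at hq1
  simp only [spaceFormPoly, Matrix.cons_val_zero, Matrix.cons_val_one, map_add, map_sub, map_smul,
    hF, hT, one_smul, smul_zero, add_zero, sub_zero] at hq1
  rw [← sub_eq_zero]
  have hmem := sub_mem (hη x X) (by
    rw [h.span x]; exact hc.potential_mem a b c X :
      weingartenForm 𝔣 𝔱 a b c x X ∈ wedgeSub (f x) (perp (f x)))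
  rw [h.span x] at hmem
  refine hc.eq_zero_of_mem_wedgeSub hmem ?_ ?_
  · rw [sub_apply, weingartenForm_apply, ep]
    linear_combination (norm := module) hp1
  · rw [sub_apply, weingartenForm_apply, eq]
    linear_combination (norm := module) hq1

end FramedLegendre

end Surface

/-! ### Complex sphere congruences and rescaled curvature spheres -/

lemma exists_eq_combination {V : Type*} [AddCommGroup V] [Module ℝ V] {α₁ β₁ α₂ β₂ : ℝ}
    (hD : α₁ * β₂ - α₂ * β₁ ≠ 0) (F T : V) (r s : ℝ) :
    ∃ k₁ k₂ : ℝ, r • F + s • T = k₁ • (α₁ • F + β₁ • T) + k₂ • (α₂ • F + β₂ • T) := by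
  refine ⟨(r * β₂ - s * α₂) / (α₁ * β₂ - α₂ * β₁), (s * α₁ - r * β₁) / (α₁ * β₂ - α₂ * β₁), ?_⟩
  have e₁ : (r * β₂ - s * α₂) / (α₁ * β₂ - α₂ * β₁) * α₁ +
      (s * α₁ - r * β₁) / (α₁ * β₂ - α₂ * β₁) * α₂ = r := by
    rw [div_mul_eq_mul_div, div_mul_eq_mul_div, ← add_div, div_eq_iff hD]; ring
  have e₂ : (r * β₂ - s * α₂) / (α₁ * β₂ - α₂ * β₁) * β₁ +
      (s * α₁ - r * β₁) / (α₁ * β₂ - α₂ * β₁) * β₂ = s := by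
    rw [div_mul_eq_mul_div, div_mul_eq_mul_div, ← add_div, div_eq_iff hD]; ring
  linear_combination (norm := module) -(e₁ • F) - e₂ • T

lemma linearIndependent_of_span_ne {v w : R42} (hv : v ≠ 0) (hw : w ≠ 0)
    (h : Submodule.span ℝ {v} ≠ Submodule.span ℝ {w}) : LinearIndependent ℝ ![v, w] := by
  rw [LinearIndependent.pair_iff' hv]
  rintro k rfl
  exact h (Submodule.span_singleton_smul_eq (IsUnit.mk0 k (left_ne_zero_of_smul hw)) v).symm

lemma star_mem_span_singleton {v w : Fin 6 → ℂ} :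
    w ∈ Submodule.span ℂ {v} ↔ star w ∈ Submodule.span ℂ {star v} := by
  simp only [Submodule.mem_span_singleton]
  constructor
  · rintro ⟨k, rfl⟩
    exact ⟨star k, (star_smul k v).symm⟩
  · rintro ⟨k, hk⟩
    exact ⟨star k, star_injective (by rw [star_smul, star_star, hk])⟩

lemma star_complexComb (ε : ℂ) (v w : R42) :
    star (complexComb ε v w) = complexComb (star ε) v w := by
  ext i
  simp [complexComb]

lemma areReal_complexComb (v w : R42) :
    AreReal (Submodule.span ℂ {complexComb 1 v w}) (Submodule.span ℂ {complexComb (-1) v w}) := by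
  refine ⟨fun u => ?_, fun u => ?_⟩ <;> rw [star_mem_span_singleton, star_complexComb] <;> simp

lemma areComplexConjugate_complexComb {v w : R42} (h : LinearIndependent ℝ ![v, w]) :
    AreComplexConjugate (Submodule.span ℂ {complexComb Complex.I v w})
      (Submodule.span ℂ {complexComb (-Complex.I) v w}) := by
  refine ⟨fun he => ?_, fun u => ?_⟩
  · have hm : complexComb Complex.I v w ∈ Submodule.span ℂ {complexComb (-Complex.I) v w} :=
      he ▸ Submodule.mem_span_singleton_self _
    obtain ⟨k, hk⟩ := Submodule.mem_span_singleton.1 hm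
    rw [LinearIndependent.pair_iff] at h
    -- Comparing real and imaginary parts of `v + i w = k (v - i w)` would give both `Re k = 1` and
    -- `Re k = -1`.
    have e₁ := h (k.re - 1) k.im (by
      ext i
      have := congrArg Complex.re (congrFun hk i)
      simp [complexComb] at this
      simp
      linarith)
    have e₂ := h k.im (-k.re - 1) (by
      ext i
      have := congrArg Complex.im (congrFun hk i)
      simp [complexComb] at this
      simp
      linarith)
    linarith [e₁.1, e₂.2]
  · rw [star_mem_span_singleton, star_complexComb]
    simp

section Pointwise

variable {V : Type*} [TopologicalSpace V] [AddCommGroup V] [Module ℝ V] {p q F T : R42}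
  {A B : V →L[ℝ] R42}

/-- After rescaling the curvature spheres, the quadratic form is the difference of the two
induced metrics. -/
lemma ContactElement.quadForm_eq_sub (h : ContactElement p q F T A B)
    (hV : Module.finrank ℝ V = 2) {α₁ β₁ α₂ β₂ : ℝ} {X₁ X₂ : V}
    (h₁ : IsPrincipal A B α₁ β₁ X₁) (h₂ : IsPrincipal A B α₂ β₂ X₂)
    (hD : α₁ * β₂ - α₂ * β₁ ≠ 0) {a b c δ e k₁ k₂ : ℝ}
    (hk₁ : k₁ ^ 2 * (α₁ * β₂ - α₂ * β₁) ^ 2 = -δ * weingartenPolar a b c α₂ β₂ α₂ β₂)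
    (hk₂ : e * k₂ ^ 2 * (α₁ * β₂ - α₂ * β₁) ^ 2 = δ * weingartenPolar a b c α₁ β₁ α₁ β₁)
    (X Y : V) :
    δ * quadForm A B a b c X Y =
      form ((k₁ * α₁) • A X + (k₁ * β₁) • B X) ((k₁ * α₁) • A Y + (k₁ * β₁) • B Y) -
        e * form ((k₂ * α₂) • A X + (k₂ * β₂) • B X) ((k₂ * α₂) • A Y + (k₂ * β₂) • B Y) := by
  obtain ⟨g₁, g₂, -, -, e₁, e₂, e₁₂, n₂, n₁⟩ := h.quadForm_principal h₁ h₂ hD a b c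
  obtain ⟨-, -, -, -, -, -, -, -, -, -, -, hX⟩ := h.diagonalize h₁ h₂ hD
  obtain ⟨r₁, s₁, rfl⟩ := exists_eq_smul_add_smul hV hX X
  obtain ⟨r₂, s₂, rfl⟩ := exists_eq_smul_add_smul hV hX Y
  -- Modulo `f`, each curvature sphere has zero derivative along its own direction, so its induced
  -- metric only sees the other one. The hypotheses on `k₁, k₂` match these two diagonal entries
  -- with those of `δ q`.
  have z₁ : ∀ r s : ℝ, (k₁ * α₁) • A (r • X₁ + s • X₂) + (k₁ * β₁) • B (r • X₁ + s • X₂) =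
      (k₁ * s) • (α₁ • A X₂ + β₁ • B X₂) := fun r s => by
    simp only [map_add, map_smul]
    linear_combination (norm := module) (k₁ * r) • h₁.eq_zero
  have z₂ : ∀ r s : ℝ, (k₂ * α₂) • A (r • X₁ + s • X₂) + (k₂ * β₂) • B (r • X₁ + s • X₂) =
      (k₂ * r) • (α₂ • A X₁ + β₂ • B X₁) := fun r s => by
    simp only [map_add, map_smul]
    linear_combination (norm := module) (k₂ * s) • h₂.eq_zero
  rw [z₁, z₁, z₂, z₂, quadForm_smul_add_smul, e₁, e₂, e₁₂]
  simp only [map_smul, LinearMap.smul_apply, n₁, n₂, smul_eq_mul]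
  linear_combination -(s₁ * s₂ * g₂) * hk₁ + r₁ * r₂ * g₁ * hk₂

end Pointwise

/-! ### Middle potential and isothermic sphere congruences -/

section Surface

variable {M : Type*} [TopologicalSpace M] [ChartedSpace (EuclideanSpace ℝ (Fin 2)) M]
  {f : M → Submodule ℝ R42} {p q : R42} {𝔣 𝔱 : M → R42}

lemma mem_osculating (X : (x : M) → TangentSpace (𝓡 2) x) (σ : M → R42) (x : M) :
    σ x ∈ osculating X σ x ∧ dirDeriv X σ x ∈ osculating X σ x :=
  ⟨Submodule.subset_span (by simp), Submodule.subset_span (by simp)⟩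

namespace FramedLegendre

variable [IsManifold (𝓡 2) ∞ M] (h : FramedLegendre f p q 𝔣 𝔱)
include h

lemma isCurvatureLift {U : Set M} (hU : IsOpen U) {α β : M → ℝ}
    (hα : ContMDiffOn (𝓡 2) 𝓘(ℝ, ℝ) ∞ α U) (hβ : ContMDiffOn (𝓡 2) 𝓘(ℝ, ℝ) ∞ β U)
    (hX : ∀ y ∈ U, ∃ X, IsPrincipal (deriv42 𝔣 y) (deriv42 𝔱 y) (α y) (β y) X) :
    IsCurvatureLift f U (fun y => α y • 𝔣 y + β y • 𝔱 y) where
  isSection := h.isSection hU hα hβ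
  ne_zero := fun y hy h0 => by
    obtain ⟨X, hX⟩ := hX y hy
    have := LinearIndependent.pair_iff.1 (h.frame y).linearIndependent _ _ h0
    have := hX.coeff_ne_zero
    tauto
  isCurvatureSphere := fun y hy => by
    obtain ⟨X, hX⟩ := hX y hy
    exact h.isCurvatureSphere_of_isPrincipal hX

lemma isMiddlePotential (humb : UmbilicFree f) {a b c : ℝ}
    (hcurl : ∀ x X Y, curl (deriv42 𝔣 x) (deriv42 𝔱 x) a b c X Y = 0) :
    IsMiddlePotential f (weingartenForm 𝔣 𝔱 a b c) := by
  intro x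
  obtain ⟨W, α₁, β₁, α₂, β₂, X₁, X₂, hW, hx, sα₁, sβ₁, sα₂, sβ₂, sX₁, sX₂, hpr⟩ :=
    h.exists_smooth_principal_pair humb x
  refine ⟨W, fun y => α₁ y • 𝔣 y + β₁ y • 𝔱 y, fun y => α₂ y • 𝔣 y + β₂ y • 𝔱 y, X₁, X₂, hx,
    ⟨h.isCurvatureLift hW sα₁ sβ₁ fun y hy => ⟨_, (hpr y hy).1⟩,
      h.isCurvatureLift hW sα₂ sβ₂ fun y hy => ⟨_, (hpr y hy).2.1⟩, fun y hy => ?_, sX₁, sX₂,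
      fun y hy => (hpr y hy).1.ne_zero, fun y hy => (hpr y hy).2.1.ne_zero,
      fun y hy => h.mem_curvatureSpace_iff.2 (hpr y hy).1.eq_zero,
      fun y hy => h.mem_curvatureSpace_iff.2 (hpr y hy).2.1.eq_zero⟩, fun Z => ?_⟩
  · rw [ne_eq, h.span_eq_of_det_eq_zero (hpr y hy).1.coeff_ne_zero (hpr y hy).2.1.coeff_ne_zero]
    exact (hpr y hy).2.2
  obtain ⟨h₁, h₂, hD⟩ := hpr x hx
  have hc := h.contactElement x
  have h12 := (hc.curl_eq_zero_iff (finrank_tangentSpace x) h₁ h₂ hD a b c).1 (hcurl x)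
  obtain ⟨-, -, -, -, -, -, -, -, -, -, -, hX⟩ := hc.diagonalize h₁ h₂ hD
  obtain ⟨z₁, z₂, rfl⟩ := exists_eq_smul_add_smul (finrank_tangentSpace x) hX Z
  obtain ⟨μ₁, e₁⟩ := hc.potential_principal h₁ h₂ hD h12
  obtain ⟨μ₂, e₂⟩ := hc.potential_principal (a := a) (b := b) (c := c) h₂ h₁
    (fun h0 => hD (by linear_combination -h0)) (by rw [← h12]; simp only [weingartenPolar]; ring)
  obtain ⟨r₁, s₁, d₁⟩ := h.deriv42_combination hW sα₁ sβ₁ hx (X₂ x)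
  obtain ⟨r₂, s₂, d₂⟩ := h.deriv42_combination hW sα₂ sβ₂ hx (X₁ x)
  -- The derivatives of the lifts differ from their screen parts by elements of `f`. Written in `σ₁,
  -- σ₂`, this correction contributes only a multiple of `σ₁ ∧ σ₂`, which lies in `S₁ ∧ S₂` and in
  -- `∧²f`.
  obtain ⟨k₁, k₂, ek⟩ := exists_eq_combination hD (𝔣 x) (𝔱 x) r₂ s₂
  obtain ⟨l₁, l₂, el⟩ := exists_eq_combination hD (𝔣 x) (𝔱 x) r₁ s₁
  rw [ek] at d₂
  rw [el] at d₁
  set σ₁ : M → R42 := fun y => α₁ y • 𝔣 y + β₁ y • 𝔱 y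
  set σ₂ : M → R42 := fun y => α₂ y • 𝔣 y + β₂ y • 𝔱 y
  have m₁ := mem_osculating X₂ σ₁ x
  have m₂ := mem_osculating X₁ σ₂ x
  refine ⟨(z₂ * μ₂) • wedge (σ₁ x) (dirDeriv X₂ σ₁ x) + (z₁ * μ₁) • wedge (σ₂ x)
      (dirDeriv X₁ σ₂ x), add_mem (Submodule.smul_mem _ _ (Submodule.mem_sup_left
        (Submodule.apply_mem_map₂ _ m₁.1 m₁.2))) (Submodule.smul_mem _ _ (Submodule.mem_sup_right
        (Submodule.apply_mem_map₂ _ m₂.1 m₂.2))),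
    (z₁ * μ₁ * k₁ - z₂ * μ₂ * l₂) • wedge (σ₁ x) (σ₂ x),
    Submodule.smul_mem _ _ (Submodule.apply_mem_map₂ _ m₁.1 m₂.1), ?_,
    Submodule.smul_mem _ _ (Submodule.apply_mem_map₂ _ (h.combination_mem x _ _)
      (h.combination_mem x _ _))⟩
  have t₁ : α₁ x • deriv42 𝔣 x (X₂ x) + β₁ x • deriv42 𝔱 x (X₂ x) =
      dirDeriv X₂ σ₁ x - (l₁ • σ₁ x + l₂ • σ₂ x) := by
    rw [dirDeriv, d₁]; simp only [σ₁, σ₂]; abel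
  have t₂ : α₂ x • deriv42 𝔣 x (X₁ x) + β₂ x • deriv42 𝔱 x (X₁ x) =
      dirDeriv X₁ σ₂ x - (k₁ • σ₁ x + k₂ • σ₂ x) := by
    rw [dirDeriv, d₂]; simp only [σ₁, σ₂]; abel
  rw [t₂] at e₁
  rw [t₁] at e₂
  rw [weingartenForm_apply, potential_smul_add_smul, e₁, e₂]
  change z₁ • μ₁ • wedge (σ₂ x) _ + z₂ • μ₂ • wedge (σ₁ x) _ = _
  simp only [map_sub, map_add, map_smul, wedge_self, wedge_swap (σ₂ x) (σ₁ x)]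
  module

lemma form_deriv42_section {U : Set M} {σ : M → R42} (hσ : IsSection f U σ) {x : M} (hx : x ∈ U)
    (X Y : TangentSpace (𝓡 2) x) :
    form (deriv42 σ x X) (deriv42 σ x Y) =
      form (-form (σ x) q • deriv42 𝔣 x X + -form (σ x) p • deriv42 𝔱 x X)
        (-form (σ x) q • deriv42 𝔣 x Y + -form (σ x) p • deriv42 𝔱 x Y) := by
  have hc := h.contactElement x
  obtain ⟨r₁, s₁, e₁⟩ := h.deriv42_section hσ hx X
  obtain ⟨r₂, s₂, e₂⟩ := h.deriv42_section hσ hx Y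
  have hm : ∀ Z, -form (σ x) q • deriv42 𝔣 x Z + -form (σ x) p • deriv42 𝔱 x Z ∈
      screen p q (𝔣 x) (𝔱 x) := fun Z =>
    add_mem (Submodule.smul_mem _ _ (hc.A_mem Z)) (Submodule.smul_mem _ _ (hc.B_mem Z))
  have m₁ := mem_screen.1 (hm X)
  have m₂ := mem_screen.1 (hm Y)
  rw [e₁, e₂]
  generalize -form (σ x) q • deriv42 𝔣 x X + -form (σ x) p • deriv42 𝔱 x X = v at *
  generalize -form (σ x) q • deriv42 𝔣 x Y + -form (σ x) p • deriv42 𝔱 x Y = w at *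
  simp only [map_add, map_smul, LinearMap.add_apply, LinearMap.smul_apply, smul_eq_mul,
    form_comm (𝔣 x) w, form_comm (𝔱 x) w, m₁, m₂, hc.FF, hc.FT, hc.TT, hc.TF]
  ring

lemma exists_isPrincipal_of_isCurvatureLift {U : Set M} {σ : M → R42}
    (hσ : IsCurvatureLift f U σ) {x : M} (hx : x ∈ U) :
    ∃ X, IsPrincipal (deriv42 𝔣 x) (deriv42 𝔱 x) (-form (σ x) q) (-form (σ x) p) X := by
  have e := h.eq_combination (hσ.isSection.mem x hx)
  obtain ⟨-, -, X, hX, hX0⟩ := hσ.isCurvatureSphere x hx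
  rw [e] at hX
  refine ⟨X, hX0, ?_, h.mem_curvatureSpace_iff.1 hX⟩
  by_contra hcon
  push Not at hcon
  refine hσ.ne_zero x hx ?_
  rw [e, hcon.1, hcon.2, zero_smul, zero_smul, add_zero]

/-- The sign `ε²` in the definition of the isothermic sphere congruences is that of `b² - ac`. -/
lemma sign_of_isothermic {a b c δ e : ℝ}
    (hcurl : ∀ x X Y, curl (deriv42 𝔣 x) (deriv42 𝔱 x) a b c X Y = 0) {U : Set M}
    {σ₁ σ₂ : M → R42} (hσ₁ : IsCurvatureLift f U σ₁) (hσ₂ : IsCurvatureLift f U σ₂) {x : M}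
    (hx : x ∈ U) (hne : Submodule.span ℝ {σ₁ x} ≠ Submodule.span ℝ {σ₂ x}) (hδ : δ = 1 ∨ δ = -1)
    (he : e = 1 ∨ e = -1)
    (hq : ∀ X Y, δ * weingartenQuadDiff 𝔣 𝔱 a b c x X Y =
      form (deriv42 σ₁ x X) (deriv42 σ₁ x Y) - e * form (deriv42 σ₂ x X) (deriv42 σ₂ x Y)) :
    0 < e * (b ^ 2 - a * c) := by
  have hc := h.contactElement x
  obtain ⟨X₁, h₁⟩ := h.exists_isPrincipal_of_isCurvatureLift hσ₁ hx
  obtain ⟨X₂, h₂⟩ := h.exists_isPrincipal_of_isCurvatureLift hσ₂ hx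
  rw [h.eq_combination (hσ₁.isSection.mem x hx), h.eq_combination (hσ₂.isSection.mem x hx), ne_eq,
    h.span_eq_of_det_eq_zero h₁.coeff_ne_zero h₂.coeff_ne_zero] at hne
  have h12 := (hc.curl_eq_zero_iff (finrank_tangentSpace x) h₁ h₂ hne a b c).1 (hcurl x)
  obtain ⟨g₁, g₂, pos₁, pos₂, e₁, e₂, -, n₂, n₁⟩ := hc.quadForm_principal h₁ h₂ hne a b c
  have q₁ := hq X₁ X₁
  have q₂ := hq X₂ X₂
  rw [h.form_deriv42_section hσ₁.isSection hx, h.form_deriv42_section hσ₂.isSection hx,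
    weingartenQuadDiff_apply] at q₁ q₂
  rw [h₁.eq_zero, n₁, e₁, map_zero] at q₁
  rw [h₂.eq_zero, n₂, e₂, map_zero] at q₂
  have hgram := weingartenPolar_gram a b c (-form (σ₁ x) q) (-form (σ₁ x) p) (-form (σ₂ x) q)
    (-form (σ₂ x) p)
  rw [h12] at hgram
  set D := -form (σ₁ x) q * -form (σ₂ x) p - -form (σ₂ x) q * -form (σ₁ x) p
  set P₁ := weingartenPolar a b c (-form (σ₁ x) q) (-form (σ₁ x) p) (-form (σ₁ x) q)
    (-form (σ₁ x) p)
  set P₂ := weingartenPolar a b c (-form (σ₂ x) q) (-form (σ₂ x) p) (-form (σ₂ x) q)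
    (-form (σ₂ x) p)
  -- Evaluating the normal form of `δ q` on `X₁` and `X₂` gives `δ P₁ = e D²` and `δ P₂ = -D²`.
  -- Inserted in the Gram identity, this yields `e (b² - ac) = D²`.
  have t₁ : δ * P₁ = e * D ^ 2 := mul_right_cancel₀ pos₁.ne' (by linear_combination -q₁)
  have t₂ : δ * P₂ = -D ^ 2 := mul_right_cancel₀ pos₂.ne' (by linear_combination -q₂)
  have hδ2 : δ ^ 2 = 1 := by rcases hδ with rfl | rfl <;> norm_num
  have he2 : e ^ 2 = 1 := by rcases he with rfl | rfl <;> norm_num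
  have hD2 : 0 < D ^ 2 := by positivity
  have : e * (b ^ 2 - a * c) = D ^ 2 := by
    refine mul_right_cancel₀ hD2.ne' ?_
    linear_combination e * hgram - e * δ * P₂ * t₁ - e ^ 2 * D ^ 2 * t₂ + D ^ 4 * he2 +
      e * P₁ * P₂ * hδ2
  rw [this]
  exact hD2

lemma exists_isothermic (humb : UmbilicFree f) {a b c e : ℝ}
    (hcurl : ∀ x X Y, curl (deriv42 𝔣 x) (deriv42 𝔱 x) a b c X Y = 0)
    (he : e = 1 ∨ e = -1) (hpos : 0 < e * (b ^ 2 - a * c)) (x : M) :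
    ∃ (U : Set M) (δ : ℝ) (σ₁ σ₂ : M → R42), x ∈ U ∧ (δ = 1 ∨ δ = -1) ∧
      IsCurvatureLift f U σ₁ ∧ IsCurvatureLift f U σ₂ ∧
      (∀ y ∈ U, Submodule.span ℝ {σ₁ y} ≠ Submodule.span ℝ {σ₂ y}) ∧
      ∀ y ∈ U, ∀ X Y, δ * weingartenQuadDiff 𝔣 𝔱 a b c y X Y =
        form (deriv42 σ₁ y X) (deriv42 σ₁ y Y) - e * form (deriv42 σ₂ y X) (deriv42 σ₂ y Y) := by
  obtain ⟨W, α₁, β₁, α₂, β₂, X₁, X₂, hW, hx, sα₁, sβ₁, sα₂, sβ₂, sX₁, sX₂, hpr⟩ :=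
    h.exists_smooth_principal_pair humb x
  have he2 : e ^ 2 = 1 := by rcases he with rfl | rfl <;> norm_num
  set D : M → ℝ := fun y => α₁ y * β₂ y - α₂ y * β₁ y with hDdef
  set P₁ : M → ℝ := fun y => weingartenPolar a b c (α₁ y) (β₁ y) (α₁ y) (β₁ y) with hP₁
  set P₂ : M → ℝ := fun y => weingartenPolar a b c (α₂ y) (β₂ y) (α₂ y) (β₂ y) with hP₂
  have hprod : ∀ y ∈ W, e * (P₁ y * P₂ y) < 0 := fun y hy => by
    obtain ⟨h₁, h₂, hD⟩ := hpr y hy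
    have h12 := ((h.contactElement y).curl_eq_zero_iff (finrank_tangentSpace y) h₁ h₂ hD a b c).1
      (hcurl y)
    have hgram := weingartenPolar_gram a b c (α₁ y) (β₁ y) (α₂ y) (β₂ y)
    rw [h12] at hgram
    have : e * (P₁ y * P₂ y) = -(e * (b ^ 2 - a * c) * D y ^ 2) := by
      linear_combination e * hgram
    rw [this, neg_lt_zero]
    have : 0 < D y ^ 2 := by positivity
    exact mul_pos hpos this
  -- Since `e P₁ P₂ < 0`, one sign `δ` makes both `-δ P₂` and `e δ P₁` positive. The neighbourhood
  -- `U` keeps these signs, so their square roots are smooth rescaling factors.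
  obtain ⟨δ, hδ, hδx⟩ : ∃ δ : ℝ, (δ = 1 ∨ δ = -1) ∧ 0 < -δ * P₂ x := by
    rcases lt_trichotomy (P₂ x) 0 with h0 | h0 | h0
    · exact ⟨1, Or.inl rfl, by linarith⟩
    · have := hprod x hx
      rw [h0, mul_zero, mul_zero] at this
      exact absurd this (lt_irrefl 0)
    · exact ⟨-1, Or.inr rfl, by linarith⟩
  have hδ2 : δ ^ 2 = 1 := by rcases hδ with rfl | rfl <;> norm_num
  have sD : ContMDiffOn (𝓡 2) 𝓘(ℝ, ℝ) ∞ D W := (sα₁.mul sβ₂).sub (sα₂.mul sβ₁)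
  have sP : ∀ (k : ℝ) {α β : M → ℝ}, ContMDiffOn (𝓡 2) 𝓘(ℝ, ℝ) ∞ α W →
      ContMDiffOn (𝓡 2) 𝓘(ℝ, ℝ) ∞ β W → ContMDiffOn (𝓡 2) 𝓘(ℝ, ℝ) ∞
        (fun y => k * weingartenPolar a b c (α y) (β y) (α y) (β y)) W := fun k α β sα sβ => by
    have hk : ∀ k : ℝ, ContMDiffOn (𝓡 2) 𝓘(ℝ, ℝ) ∞ (fun _ : M => k) W := fun _ =>
      contMDiffOn_const
    exact (hk k).mul (((((hk c).mul sβ).mul sβ).add ((hk b).mul ((sα.mul sβ).add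
      (sα.mul sβ)))).add (((hk a).mul sα).mul sα))
  have sP₂ := sP (-δ) sα₂ sβ₂
  have sP₁ := sP (e * δ) sα₁ sβ₁
  set U := W ∩ (fun y => -δ * P₂ y) ⁻¹' Set.Ioi 0 with hUdef
  have hU : IsOpen U := sP₂.continuousOn.isOpen_inter_preimage hW isOpen_Ioi
  have hUW : U ⊆ W := Set.inter_subset_left
  have pos₂ : ∀ y ∈ U, 0 < -δ * P₂ y := fun y hy => hy.2
  have pos₁ : ∀ y ∈ U, 0 < e * δ * P₁ y := fun y hy => by
    refine pos_of_mul_pos_left (b := -δ * P₂ y) ?_ (pos₂ y hy).le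
    have : e * δ * P₁ y * (-δ * P₂ y) = -(e * (P₁ y * P₂ y)) := by
      linear_combination -e * P₁ y * P₂ y * hδ2
    rw [this]
    linarith [hprod y (hUW hy)]
  have hsqrt : ∀ g : M → ℝ, ContMDiffOn (𝓡 2) 𝓘(ℝ, ℝ) ∞ g W → (∀ y ∈ U, 0 < g y) →
      ContMDiffOn (𝓡 2) 𝓘(ℝ, ℝ) ∞ (fun y => √(g y) / D y) U := fun g hg hpos y hy =>
    ((Real.contDiffAt_sqrt (hpos y hy).ne').contMDiffAt.comp_contMDiffWithinAt y
      (hg.mono hUW y hy)).div₀ (sD.mono hUW y hy) (hpr y (hUW hy)).2.2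
  have sk₁ := hsqrt _ sP₂ pos₂
  have sk₂ := hsqrt _ sP₁ pos₁
  set k₁ : M → ℝ := fun y => √(-δ * P₂ y) / D y with hk₁
  set k₂ : M → ℝ := fun y => √(e * δ * P₁ y) / D y with hk₂
  have ne₁ : ∀ y ∈ U, k₁ y ≠ 0 := fun y hy =>
    div_ne_zero (Real.sqrt_pos.2 (pos₂ y hy)).ne' (hpr y (hUW hy)).2.2
  have ne₂ : ∀ y ∈ U, k₂ y ≠ 0 := fun y hy =>
    div_ne_zero (Real.sqrt_pos.2 (pos₁ y hy)).ne' (hpr y (hUW hy)).2.2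
  have pr₁ : ∀ y ∈ U, IsPrincipal (deriv42 𝔣 y) (deriv42 𝔱 y) (k₁ y * α₁ y) (k₁ y * β₁ y) (X₁ y) :=
    fun y hy => (hpr y (hUW hy)).1.smul (ne₁ y hy)
  have pr₂ : ∀ y ∈ U, IsPrincipal (deriv42 𝔣 y) (deriv42 𝔱 y) (k₂ y * α₂ y) (k₂ y * β₂ y) (X₂ y) :=
    fun y hy => (hpr y (hUW hy)).2.1.smul (ne₂ y hy)
  have s₁ : IsCurvatureLift f U (fun y => (k₁ y * α₁ y) • 𝔣 y + (k₁ y * β₁ y) • 𝔱 y) :=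
    h.isCurvatureLift hU (sk₁.mul (sα₁.mono hUW)) (sk₁.mul (sβ₁.mono hUW))
    fun y hy => ⟨_, pr₁ y hy⟩
  have s₂ : IsCurvatureLift f U (fun y => (k₂ y * α₂ y) • 𝔣 y + (k₂ y * β₂ y) • 𝔱 y) :=
    h.isCurvatureLift hU (sk₂.mul (sα₂.mono hUW)) (sk₂.mul (sβ₂.mono hUW))
    fun y hy => ⟨_, pr₂ y hy⟩
  refine ⟨U, δ, _, _, ⟨hx, hδx⟩, hδ, s₁, s₂, fun y hy => ?_, fun y hy X Y => ?_⟩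
  · obtain ⟨h₁, h₂, hD⟩ := hpr y (hUW hy)
    rw [ne_eq, h.span_eq_of_det_eq_zero (pr₁ y hy).coeff_ne_zero (pr₂ y hy).coeff_ne_zero]
    intro h0
    exact mul_ne_zero (mul_ne_zero (ne₁ y hy) (ne₂ y hy)) hD (by linear_combination h0)
  · obtain ⟨h₁, h₂, hD⟩ := hpr y (hUW hy)
    have hD0 : D y ≠ 0 := hD
    rw [h.form_deriv42_section s₁.isSection hy, h.form_deriv42_section s₂.isSection hy]
    have hfr := h.frame y
    have eq : ∀ r s : ℝ, -form (r • 𝔣 y + s • 𝔱 y) q = r := fun r s => by simp [hfr.Fq, hfr.Tq]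
    have ep : ∀ r s : ℝ, -form (r • 𝔣 y + s • 𝔱 y) p = s := fun r s => by simp [hfr.Fp, hfr.Tp]
    simp only [eq, ep]
    refine (h.contactElement y).quadForm_eq_sub (finrank_tangentSpace y) h₁ h₂ hD ?_ ?_ X Y
    · change (√(-δ * P₂ y) / D y) ^ 2 * D y ^ 2 = -δ * P₂ y
      rw [div_pow, Real.sq_sqrt (pos₂ y hy).le, div_mul_cancel₀ _ (pow_ne_zero 2 hD0)]
    · change e * (√(e * δ * P₁ y) / D y) ^ 2 * D y ^ 2 = δ * P₁ y
      rw [div_pow, Real.sq_sqrt (pos₁ y hy).le, mul_assoc, div_mul_cancel₀ _ (pow_ne_zero 2 hD0)]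
      linear_combination δ * P₁ y * he2

lemma isothermicSphereCongruencesSatisfy (humb : UmbilicFree f) {a b c e : ℝ} {ε : ℂ}
    (hcurl : ∀ x X Y, curl (deriv42 𝔣 x) (deriv42 𝔱 x) a b c X Y = 0)
    (hε : e = 1 ∧ ε = 1 ∨ e = -1 ∧ ε = Complex.I) (hpos : 0 < e * (b ^ 2 - a * c))
    {P : Submodule ℂ (Fin 6 → ℂ) → Submodule ℂ (Fin 6 → ℂ) → Prop}
    (hP : ∀ v w : R42, LinearIndependent ℝ ![v, w] →
      P (Submodule.span ℂ {complexComb ε v w}) (Submodule.span ℂ {complexComb (-ε) v w})) :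
    IsothermicSphereCongruencesSatisfy f (weingartenQuadDiff 𝔣 𝔱 a b c) P := by
  have he : e = 1 ∨ e = -1 := hε.imp And.left And.left
  have hsq : ∀ {e : ℝ} {ε : ℂ}, e = 1 ∧ ε = 1 ∨ e = -1 ∧ ε = Complex.I → ε ^ 2 = (e : ℂ) := by
    rintro e ε (⟨rfl, rfl⟩ | ⟨rfl, rfl⟩) <;> simp
  constructor
  · intro x
    obtain ⟨U, δ, σ₁, σ₂, hx, hδ, s₁, s₂, hne, hq⟩ := h.exists_isothermic humb hcurl he hpos x
    refine ⟨U, fun y => Submodule.span ℂ {complexComb ε (σ₁ y) (σ₂ y)},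
      fun y => Submodule.span ℂ {complexComb (-ε) (σ₁ y) (σ₂ y)}, hx, δ, ε, σ₁, σ₂, hδ,
      hε.imp And.right And.right, s₁, s₂, hne, fun y hy X Y => ?_, fun y _ => ⟨rfl, rfl⟩⟩
    rw [hq y hy, hsq hε]
    push_cast
    rfl
  · rintro U sp sm ⟨δ, ε', σ₁, σ₂, hδ, hε', s₁, s₂, hne, hq, hs⟩ x hx
    obtain ⟨e', he'⟩ : ∃ e' : ℝ, e' = 1 ∧ ε' = 1 ∨ e' = -1 ∧ ε' = Complex.I := by
      rcases hε' with rfl | rfl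
      · exact ⟨1, by simp⟩
      · exact ⟨-1, by simp⟩
    -- An arbitrary normal form has its own `ε'`, but `ε'²` must have the sign of `b² - ac`. Hence
    -- `ε' = ε` and `hP` applies to any choice of lifts.
    have hpos' : 0 < e' * (b ^ 2 - a * c) := by
      refine h.sign_of_isothermic hcurl s₁ s₂ hx (hne x hx) hδ (he'.imp And.left And.left)
        fun X Y => ?_
      have := hq x hx X Y
      rw [hsq he'] at this
      exact_mod_cast this
    have hee : ε' = ε := by
      rcases hε with ⟨rfl, rfl⟩ | ⟨rfl, rfl⟩ <;> rcases he' with ⟨rfl, rfl⟩ | ⟨rfl, rfl⟩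
      · rfl
      · linarith
      · linarith
      · rfl
    rw [(hs x hx).1, (hs x hx).2, hee]
    exact hP _ _ (linearIndependent_of_span_ne (s₁.ne_zero x hx) (s₂.ne_zero x hx) (hne x hx))

omit [IsManifold (𝓡 2) ∞ M] in
/-- If `η = 0`, then its quadratic differential vanishes. -/
lemma quadDiff_zero {Q : QuadDiff M} (hQ : IsQuadraticDifferential f 0 Q) (x : M)
    (X Y : TangentSpace (𝓡 2) x) : Q x X Y = 0 := by
  obtain ⟨T, hT, e⟩ := hQ x X Y
  have : T = 0 := by
    ext1 ⟨v, hv⟩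
    obtain ⟨r, s, rfl⟩ := h.mem_iff.1 hv
    exact Subtype.ext (hT Set.univ (fun y => r • 𝔣 y + s • 𝔱 y)
      (h.isSection isOpen_univ contMDiffOn_const contMDiffOn_const) trivial)
  rw [e, this, map_zero]

lemma isOmegaWith [Nonempty M] (humb : UmbilicFree f)
    {a b c : ℝ} (habc : ¬ (a = 0 ∧ b = 0 ∧ c = 0))
    (hcurl : ∀ x X Y, curl (deriv42 𝔣 x) (deriv42 𝔱 x) a b c X Y = 0) :
    (b ^ 2 - a * c = 0 →
      IsOmegaZeroWith f (weingartenForm 𝔣 𝔱 a b c) (weingartenQuadDiff 𝔣 𝔱 a b c)) ∧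
    (b ^ 2 - a * c ≠ 0 →
      IsOmegaWith f (weingartenForm 𝔣 𝔱 a b c) (weingartenQuadDiff 𝔣 𝔱 a b c)) := by
  have hL := h.isLieApplicableWith humb habc hcurl
  refine ⟨fun h0 => ⟨hL, Set.univ, isOpen_univ, dense_univ, fun x _ => ?_⟩,
    fun h0 => ⟨hL, Set.univ, isOpen_univ, dense_univ, fun x _ => ?_⟩⟩
  · rw [h.nondegenerateAt_iff humb hcurl, not_not]
    exact h0
  · rwa [h.nondegenerateAt_iff humb hcurl]

end FramedLegendre

end Surface

end LieSphere

end

/-! ### The characterizations of linear Weingarten surfaces -/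

theorem mainTheorem9 {M : Type*} [TopologicalSpace M]
    [ChartedSpace (EuclideanSpace ℝ (Fin 2)) M] [IsManifold (𝓡 2) ∞ M] [Nonempty M]
    (f : M → Submodule ℝ LieSphere.R42) (hf : LieSphere.IsLegendre f)
    (humb : LieSphere.UmbilicFree f)
    (p q : LieSphere.R42)
    (hp : LieSphere.form p p = 1 ∨ LieSphere.form p p = -1)
    (hpq : LieSphere.form p q = 0)
    (𝔣 𝔱 : M → LieSphere.R42) (hproj : LieSphere.IsSpaceFormProjection f p q 𝔣 𝔱)
    (himm : Dense {x : M | LieSphere.ImmersesAt 𝔣 x})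
    (a b c : ℝ) :
    -- linear Weingarten iff Lie applicable with the explicit middle potential
    (LieSphere.IsLinearWeingarten 𝔣 𝔱 a b c ↔
      LieSphere.IsLieApplicableWith f (LieSphere.weingartenForm 𝔣 𝔱 a b c)
          (LieSphere.weingartenQuadDiff 𝔣 𝔱 a b c) ∧
        LieSphere.IsMiddlePotential f (LieSphere.weingartenForm 𝔣 𝔱 a b c)) ∧
    -- linear Weingarten iff the middle pencil has the two linear conserved quantities
    (LieSphere.IsLinearWeingarten 𝔣 𝔱 a b c ↔
      ∃ (η : LieSphere.OneForm M) (Q : LieSphere.QuadDiff M),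
        LieSphere.IsLieApplicableWith f η Q ∧ LieSphere.IsMiddlePotential f η ∧
        LieSphere.IsPolynomialConservedQuantity η (LieSphere.pointPoly p 𝔣 𝔱 a b) ∧
        LieSphere.IsPolynomialConservedQuantity η (LieSphere.spaceFormPoly q 𝔣 𝔱 b c)) ∧
    (LieSphere.IsLinearWeingarten 𝔣 𝔱 a b c →
      -- these are conserved quantities of the pencil of the explicit middle potential
      LieSphere.IsPolynomialConservedQuantity (LieSphere.weingartenForm 𝔣 𝔱 a b c)
        (LieSphere.pointPoly p 𝔣 𝔱 a b) ∧
      LieSphere.IsPolynomialConservedQuantity (LieSphere.weingartenForm 𝔣 𝔱 a b c)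
        (LieSphere.spaceFormPoly q 𝔣 𝔱 b c) ∧
      -- the quadratic differential vanishes at no point
      (∀ x, ∃ X Y, LieSphere.weingartenQuadDiff 𝔣 𝔱 a b c x X Y ≠ 0) ∧
      -- tubular and non-tubular cases
      (b ^ 2 - a * c = 0 →
        LieSphere.IsOmegaZeroWith f (LieSphere.weingartenForm 𝔣 𝔱 a b c)
          (LieSphere.weingartenQuadDiff 𝔣 𝔱 a b c)) ∧
      (b ^ 2 - a * c ≠ 0 →
        LieSphere.IsOmegaWith f (LieSphere.weingartenForm 𝔣 𝔱 a b c)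
          (LieSphere.weingartenQuadDiff 𝔣 𝔱 a b c)) ∧
      (0 < b ^ 2 - a * c →
        LieSphere.IsothermicSphereCongruencesSatisfy f
          (LieSphere.weingartenQuadDiff 𝔣 𝔱 a b c) LieSphere.AreReal) ∧
      (b ^ 2 - a * c < 0 →
        LieSphere.IsothermicSphereCongruencesSatisfy f
          (LieSphere.weingartenQuadDiff 𝔣 𝔱 a b c) LieSphere.AreComplexConjugate)) := by
  have h := hproj.framedLegendre hf
  have hcurl : LieSphere.IsLinearWeingarten 𝔣 𝔱 a b c → _ := fun hw => h.curl_eq_zero himm hw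
  refine ⟨⟨fun hw => ⟨h.isLieApplicableWith humb hw.1 (hcurl hw),
      h.isMiddlePotential humb (hcurl hw)⟩, ?_⟩,
    ⟨fun hw => ⟨_, _, h.isLieApplicableWith humb hw.1 (hcurl hw),
      h.isMiddlePotential humb (hcurl hw), h.isPolynomialConservedQuantity a b c⟩, ?_⟩,
    fun hw => ⟨(h.isPolynomialConservedQuantity a b c).1, (h.isPolynomialConservedQuantity a b c).2,
      h.exists_quadDiff_ne_zero humb hw.1 (hcurl hw), (h.isOmegaWith humb hw.1 (hcurl hw)).1,
      (h.isOmegaWith humb hw.1 (hcurl hw)).2, fun hpos => ?_, fun hneg => ?_⟩⟩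
  · rintro ⟨hL, -⟩
    -- Closedness alone gives the Weingarten equation; the non-vanishing quadratic differential is
    -- what excludes `a = b = c = 0`.
    refine h.isLinearWeingarten_of_curl humb ?_ ((h.isClosed_iff a b c).1 hL.closed)
    rintro ⟨rfl, rfl, rfl⟩
    obtain ⟨x, X, Y, hne⟩ := hL.ne_zero
    exact hne (by simp [LieSphere.weingartenQuadDiff])
  · rintro ⟨η, Q, hL, -, hcp, hcq⟩
    have e := h.eq_weingartenForm hL.mem hcp hcq
    subst e
    refine h.isLinearWeingarten_of_curl humb ?_ ((h.isClosed_iff a b c).1 hL.closed)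
    rintro ⟨rfl, rfl, rfl⟩
    obtain ⟨x, X, Y, hne⟩ := hL.ne_zero
    -- Here `Q` is not assumed to be the explicit differential, so for `a = b = c = 0` it vanishes
    -- only through `η = 0`.
    have e0 : LieSphere.weingartenForm 𝔣 𝔱 0 0 0 = 0 := by
      funext x
      ext1 X
      rw [LieSphere.weingartenForm_apply]
      simp [LieSphere.potential]
    exact hne (h.quadDiff_zero (e0 ▸ hL.quadDiff) x X Y)
  · exact h.isothermicSphereCongruencesSatisfy humb (hcurl hw) (Or.inl ⟨rfl, rfl⟩) (by linarith)
      fun v w _ => LieSphere.areReal_complexComb v w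
  · exact h.isothermicSphereCongruencesSatisfy humb (hcurl hw) (Or.inr ⟨rfl, rfl⟩) (by linarith)
      fun v w hvw => LieSphere.areComplexConjugate_complexComb hvw
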